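/- **Setting.** There are $K\ge1$ arms and $T\ge1$ trials. Arm $a$ has a reward function $f_a:[0,1]\to[0,1]$ that is $L$-Lipschitz ($L>0$). Contexts $x_t$ are i.i.d. uniform on $[0,1]$, noise terms $\epsilon_t$ are i.i.d. $N(0,\sigma^2)$ ($\sigma>0$), and contexts and noise are independent. Playing arm $a_t$ in trial $t$ yields the payoff $\pi_t=f_{a_t}(x_t)+\epsilon_t$. Put $f^*(x)=\max_a f_a(x)$, $\kappa(x)=f^*(x)-\max_a f_a(x)\mathbf 1\{f_a(x)\ne f^*(x)\}$, $R(T)=\sum_{t=1}^T\big(f^*(x_t)-f_{a_t}(x_t)\big)$. **Algorithm (Approx-Zooming, knowing $K,T,L,\sigma$).** A ball is $\rho=[c_0,c_1]\times\mathcal A(\rho)$ with width $\Delta(\rho)=c_1-c_0$ and $\mathcal A(\rho)\subseteq[K]$. Put $k(\rho)=\lceil 5431\,\sigma^2\ln(T|\mathcal A(\rho)|)/(L^2\Delta(\rho)^2)\rceil$. Before trial $t$ let $n_t(\rho)$ be the number of times $\rho$ has been chosen, $\mu_t(\rho)$ the mean payoff in these trials, and $UCB_t(\rho)=\mu_t(\rho)+2L\Delta(\rho)+\sqrt{6\sigma^2\ln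 T/n_t(\rho)}$ ($+\infty$ if $n_t(\rho)=0$). Initially $[0,1]\times[K]$ is the only ball, and it is flagged. In trial $t$: * If some flagged ball contains $x_t$ in its context interval, choose a widest such ball $\rho$ and play the smallest arm $a\in\mathcal A(\rho)$ with insufficient data. Arm $a$ has sufficient data when each of the 64 equal closed subintervals of $[c_0,c_1]$ contains at least $k(\rho)$ contexts at which $a$ was played from $\rho$ while $\rho$ was flagged. If after the trial all arms of $\rho$ have sufficient data, $\rho$ is replaced by new active (unflagged) balls as follows. For each half $[u,v]$ of $[c_0,c_1]$, go through the arms of $\mathcal A(\rho)$ in an arbitrary order; an arm $a$ becomes a new cluster center if $\hat D(a,y)>\frac3{16}L(v-u)$ for all present centers $y$, and otherwise joins the cluster of a nearest center. Each cluster, together with $[u,v]$, is a new active ball. Here $\hat D(a,b)^2$ is the positive part of $\frac1{200}\sum_{i=1}^{200}(\hat f_a(z_i)-\hat f_b(z_i))^2-\frac{2\sigma^2}{k(\rho)}$ with $z_i=(1-\frac i{200})u+\frac i{200}v$, and $\hat f_a(z)$ is the average of the payoffs of the $k(\rho)$ nearest neighbours of $z$ among the samples of $a$ collected while $\rho$ was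 flagged. * Otherwise choose an active ball $\rho$ of largest $UCB_t(\rho)$ among those containing $x_t$, and play any arm of $\mathcal A(\rho)$ (by any measurable rule based on the past contexts and payoffs and on the current context, such as round robin). If $n_t(\rho)>6\sigma^2\ln T/(L^2\Delta(\rho)^2)$, then $\rho$ becomes flagged. Ties are broken arbitrarily. **Finite types.** Suppose that the arms have $\Theta$ types: $f_a=g_{\theta_a}$ with $\theta_a\in[\Theta]$, and each type occurs. Let $\mathcal S^*$ be a finite partition of $[0,1]$ into (possibly degenerate) intervals on each of which the set of optimal types $\theta^*(x)=\{\theta: g_\theta(x)=f^*(x)\}$ does not change. Suppose that for some $L'>0$ and all integers $i\ge1$, with $\mu$ the Lebesgue measure, $$\mu(\{x\in[0,1]:\kappa(x)\le 22L2^{-i}\})\le 22\,|\mathcal S^*|\,L2^{-i}/L'.$$ Suppose also that $5431\,\sigma^2\ln(TK)/L^2\ge1$ (the number of nearest neighbours used by the algorithm is at least one). **Claim.** There is an absolute constant $C$ such that in every such situation $$\mathbb E[R(T)]\le C\Big(\sigma^2L^{-2}K\ln(TK)+\sqrt{\sigma^2\,|\mathcal S^*|\,L\,L'^{-1}\,T\,K\ln(TK)}\Big).$$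 -/

import Mathlib

open MeasureTheory ProbabilityTheory

noncomputable section

namespace ApproxZooming

/-! ### Reward functions, optimal reward, gap, optimal types -/

/-- The optimal reward `f*(x) = max_a f_a(x)`. -/
def optReward {K : ℕ} (f : Fin K → unitInterval → ℝ) (x : unitInterval) : ℝ :=
  ⨆ a, f a x

open scoped Classical in
/-- The gap `κ(x) = f*(x) - max_a f_a(x) 1{f_a(x) ≠ f*(x)}`. -/
def gap {K : ℕ} (f : Fin K → unitInterval → ℝ) (x : unitInterval) : ℝ :=
  optReward f x - ⨆ a, (if f a x ≠ optReward f x then f a x else 0)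

/-- The set `θ*(x)` of arm types that are optimal at the context `x`. -/
def optTypes {K Θ : ℕ} (f : Fin K → unitInterval → ℝ) (g : Fin Θ → unitInterval → ℝ)
    (x : unitInterval) : Set (Fin Θ) :=
  {θ | g θ x = optReward f x}

/-- `S` is a finite partition of the context space into (possibly degenerate) intervals across
each of which the optimal policy, i.e. the set of optimal types, does not change. -/
structure IsPolicyPartition {K Θ : ℕ} (f : Fin K → unitInterval → ℝ)
    (g : Fin Θ → unitInterval → ℝ) (S : Finset (Set unitInterval)) : Prop where
  isPartition : Setoid.IsPartition (S : Set (Set unitInterval))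
  interval : ∀ s ∈ S, s.OrdConnected
  constant : ∀ s ∈ S, ∀ x ∈ s, ∀ x' ∈ s, optTypes f g x = optTypes f g x'

/-! ### The Approx-Zooming algorithm -/

/-- A ball `[c₀(ρ), c₁(ρ)] × 𝒜(ρ)`.  Context intervals arise from `[0,1]` by repeated halving,
so an interval is recorded by its dyadic level and index. -/
structure Ball (K : ℕ) where
  level : ℕ
  index : ℕ
  arms : Finset (Fin K)

instance instDecidableEqBall {K : ℕ} : DecidableEq (Ball K) := Classical.decEq _

namespace Ball

variable {K : ℕ}

/-- The left end point `c₀(ρ)`. -/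
def lo (ρ : Ball K) : ℝ := ρ.index / 2 ^ ρ.level

/-- The right end point `c₁(ρ)`. -/
def hi (ρ : Ball K) : ℝ := (ρ.index + 1) / 2 ^ ρ.level

/-- The width `Δ(ρ) = c₁(ρ) - c₀(ρ)`. -/
def width (ρ : Ball K) : ℝ := ρ.hi - ρ.lo

/-- The whole space `[0,1] × [K]`. -/
def root (K : ℕ) : Ball K := ⟨0, 0, Finset.univ⟩

/-- The ball over the left (`ℓ = 0`) or right (`ℓ = 1`) half of the context interval of `ρ` with
arm set `A`. -/
def child (ρ : Ball K) (ℓ : Fin 2) (A : Finset (Fin K)) : Ball K :=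
  ⟨ρ.level + 1, 2 * ρ.index + ℓ, A⟩

end Ball

/-- The record of one trial: context `x_s`, chosen ball `ρ_s`, arm `a_s`, whether the ball was
flagged when it was chosen, and payoff `π_s`. A ball is never unflagged and then chosen again, so
the trials `s > τ_f(ρ)` with `ρ_s = ρ` are those with `ball = ρ` and `wasFlagged = true`. -/
structure Trial (K : ℕ) where
  context : ℝ
  ball : Ball K
  arm : Fin K
  wasFlagged : Bool
  payoff : ℝ

/-- The state of the algorithm: the active balls `𝒫`, the flagged balls `𝒫*`, and the records of
all past trials in chronological order. -/
structure State (K : ℕ) where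
  active : Finset (Ball K)
  flagged : Finset (Ball K)
  log : List (Trial K)

/-- The choices that the algorithm leaves open: how ties are broken in the two `argmax` over balls
and in the `argmin` over cluster centers, the order in which the arms are clustered, and which arm
of an active ball is played (any rule, based on the trial number, all past contexts and payoffs,
the current context and the ball; e.g. round robin). -/
structure Rules (K : ℕ) where
  pickBall : ℕ → Finset (Ball K) → Ball K
  pickBall_mem : ∀ t B, B.Nonempty → pickBall t B ∈ B
  pickCenter : ℕ → Finset (Fin K) → Fin K
  pickCenter_mem : ∀ t A, A.Nonempty → pickCenter t A ∈ A
  armOrder : ℕ → Fin 2 → Finset (Fin K) → List (Fin K)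
  armOrder_nodup : ∀ t ℓ A, (armOrder t ℓ A).Nodup
  mem_armOrder : ∀ t ℓ A a, a ∈ armOrder t ℓ A ↔ a ∈ A
  playArm : ℕ → (ℕ → ℝ × ℝ) → ℝ → Ball K → Fin K
  playArm_mem : ∀ t h x ρ, ρ.arms.Nonempty → playArm t h x ρ ∈ ρ.arms
  measurable_playArm : ∀ t ρ,
    Measurable fun p : (ℕ → ℝ × ℝ) × ℝ => playArm t p.1 p.2 ρ

section Algorithm

variable {K : ℕ}

/-- `n(ρ)`: how often `ρ` has been chosen. -/
def count (log : List (Trial K)) (ρ : Ball K) : ℕ :=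
  log.countP fun s => decide (s.ball = ρ)

/-- `μ(ρ)`: the average payoff observed from `ρ`. -/
def meanPayoff (log : List (Trial K)) (ρ : Ball K) : ℝ :=
  ((log.filter fun s => decide (s.ball = ρ)).map Trial.payoff).sum / count log ρ

/-- `UCB(ρ) = μ(ρ) + 2 L Δ(ρ) + √(6 σ² ln T / n(ρ))`, which is `+∞` for a ball not yet chosen. -/
def ucb (σ L : ℝ) (T : ℕ) (log : List (Trial K)) (ρ : Ball K) : EReal :=
  if count log ρ = 0 then ⊤ else
    ((meanPayoff log ρ + 2 * L * ρ.width
      + Real.sqrt (6 * σ ^ 2 * Real.log T / count log ρ) : ℝ) : EReal)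

/-- The number of nearest neighbours `k = 5431 σ² ln(T |𝒜(ρ)|) / (L² Δ(ρ)²)`, rounded up. -/
def numNeighbors (σ L : ℝ) (T : ℕ) (ρ : Ball K) : ℕ :=
  ⌈5431 * σ ^ 2 * Real.log (T * ρ.arms.card) / (L ^ 2 * ρ.width ^ 2)⌉₊

/-- The trials in which arm `a` was played from `ρ` during the flagged phase of `ρ`. -/
def samples (log : List (Trial K)) (ρ : Ball K) (a : Fin K) : List (Trial K) :=
  log.filter fun s => decide (s.ball = ρ ∧ s.arm = a ∧ s.wasFlagged = true)

open scoped Classical in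
/-- `SuffData(a) = 1`: each of the 64 equal subintervals of the context interval of `ρ` contains
the contexts of at least `k` samples of arm `a`. -/
def SuffData (σ L : ℝ) (T : ℕ) (log : List (Trial K)) (ρ : Ball K) (a : Fin K) : Prop :=
  ∀ i : Fin 64, numNeighbors σ L T ρ ≤ (samples log ρ a).countP fun s =>
    decide (s.context ∈ Set.Icc (ρ.lo + (i : ℝ) * ρ.width / 64)
      (ρ.lo + ((i : ℝ) + 1) * ρ.width / 64))

open scoped Classical in
/-- The sample `s` of arm `a` is one of the `k` nearest neighbours of `z`. -/
def IsNeighbor (k : ℕ) (log : List (Trial K)) (ρ : Ball K) (a : Fin K) (z : ℝ)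
    (s : Trial K) : Prop :=
  (samples log ρ a).countP (fun l => decide (|l.context - z| ≤ |s.context - z|)) ≤ k

open scoped Classical in
/-- The `k`-nearest neighbour estimate of `f_a(z)`. -/
def estimate (k : ℕ) (log : List (Trial K)) (ρ : Ball K) (a : Fin K) (z : ℝ) : ℝ :=
  1 / (k : ℝ) *
    (((samples log ρ a).filter fun s => decide (IsNeighbor k log ρ a z s)).map Trial.payoff).sum

/-- The estimated distance of the arms `a` and `b` on the interval `[u, v]`; a negative radicand
is read as `0`. -/
def estDist (σ L : ℝ) (T : ℕ) (log : List (Trial K)) (ρ : Ball K) (u v : ℝ) (a b : Fin K) : ℝ :=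
  let k := numNeighbors σ L T ρ
  let z : ℕ → ℝ := fun i => (1 - (i : ℝ) / 200) * u + (i : ℝ) / 200 * v
  Real.sqrt (1 / 200 * ∑ i ∈ Finset.Icc 1 200,
      (estimate k log ρ a (z i) - estimate k log ρ b (z i)) ^ 2 - 2 * σ ^ 2 / k)

open scoped Classical in
/-- One step of the clustering. The current clustering consists of the set of centers and, for each
center, of its cluster; the arm `a` becomes a new center if it is farther than `r` from all
centers, and otherwise it joins the cluster of a closest center. -/
def clusterStep (d : Fin K → Fin K → ℝ) (r : ℝ) (pick : Finset (Fin K) → Fin K)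
    (c : Finset (Fin K) × (Fin K → Finset (Fin K))) (a : Fin K) :
    Finset (Fin K) × (Fin K → Finset (Fin K)) :=
  if ∀ y ∈ c.1, r < d a y then
    (insert a c.1, Function.update c.2 a {a})
  else
    let y := pick (c.1.filter fun y => ∀ w ∈ c.1, d a y ≤ d a w)
    (c.1, Function.update c.2 y (insert a (c.2 y)))

/-- The balls that subpartitioning `ρ` creates over its half number `ℓ`. -/
def subPartitionHalf (σ L : ℝ) (T : ℕ) (R : Rules K) (t : ℕ) (log : List (Trial K)) (ρ : Ball K)
    (ℓ : Fin 2) : Finset (Ball K) :=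
  let u := ρ.lo + ρ.width * (ℓ : ℕ) / 2
  let v := ρ.lo + ρ.width * (1 + (ℓ : ℕ)) / 2
  let c := (R.armOrder t ℓ ρ.arms).foldl
    (clusterStep (estDist σ L T log ρ u v) (3 / 16 * L * (v - u)) (R.pickCenter t))
    (∅, fun _ => ∅)
  c.1.image fun y => ρ.child ℓ (c.2 y)

/-- The balls returned by the subroutine SubPartition. -/
def subPartition (σ L : ℝ) (T : ℕ) (R : Rules K) (t : ℕ) (log : List (Trial K)) (ρ : Ball K) :
    Finset (Ball K) :=
  subPartitionHalf σ L T R t log ρ 0 ∪ subPartitionHalf σ L T R t log ρ 1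

open scoped Classical in
/-- The balls of `B` whose context interval contains `x`. -/
def containing (B : Finset (Ball K)) (x : ℝ) : Finset (Ball K) :=
  B.filter fun ρ => x ∈ Set.Icc ρ.lo ρ.hi

open scoped Classical in
/-- The maximizers of `score` over `B`. -/
def argmaxSet {β : Type*} [LE β] (B : Finset (Ball K)) (score : Ball K → β) : Finset (Ball K) :=
  B.filter fun ρ => ∀ ρ' ∈ B, score ρ' ≤ score ρ

open scoped Classical in
/-- The ball selected at context `x`: a flagged ball of largest width among those containing `x`,
or, if no flagged ball contains `x`, an active ball of largest UCB among those containing `x`. The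
second component tells whether the ball is flagged. -/
def selectBall (σ L : ℝ) (T : ℕ) (R : Rules K) (S : State K) (x : ℝ) : Ball K × Bool :=
  let t := S.log.length
  if (containing S.flagged x).Nonempty then
    (R.pickBall t (argmaxSet (containing S.flagged x) Ball.width), true)
  else
    (R.pickBall t (argmaxSet (containing S.active x) (ucb σ L T S.log)), false)

/-- The past contexts and payoffs, padded by zeros. -/
def history (log : List (Trial K)) : ℕ → ℝ × ℝ :=
  fun s => (log.map fun r => (r.context, r.payoff)).getD s (0, 0)

open scoped Classical in
/-- The arm played at context `x`: the first arm with insufficient data if the selected ball is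
flagged, and any arm of the selected ball otherwise. (If a flagged ball has no arm with
insufficient data, any of its arms is played.) -/
def selectArm (σ L : ℝ) (T : ℕ) (R : Rules K) (S : State K) (x : ℝ) : Fin K :=
  let p := selectBall σ L T R S x
  let A := p.1.arms.filter fun a => ¬ SuffData σ L T S.log p.1 a
  if h : p.2 = true ∧ A.Nonempty then A.min' h.2
  else R.playArm S.log.length (history S.log) x p.1

open scoped Classical in
/-- One trial with context `x`, in which playing arm `a` yields the payoff `payoff a`. -/
def step (σ L : ℝ) (T : ℕ) (R : Rules K) (S : State K) (x : ℝ) (payoff : Fin K → ℝ) : State K :=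
  let p := selectBall σ L T R S x
  let ρ := p.1
  let a := selectArm σ L T R S x
  let log := S.log ++ [⟨x, ρ, a, p.2, payoff a⟩]
  if p.2 = true then
    if ∀ b ∈ ρ.arms, SuffData σ L T log ρ b then
      ⟨S.active ∪ subPartition σ L T R S.log.length log ρ, S.flagged.erase ρ, log⟩
    else ⟨S.active, S.flagged, log⟩
  else
    if 6 * σ ^ 2 * Real.log T / (L ^ 2 * ρ.width ^ 2) < count S.log ρ then
      ⟨S.active.erase ρ, insert ρ S.flagged, log⟩
    else ⟨S.active, S.flagged, log⟩

/-- The state before trial number `t` (trials are numbered from `0`), when `x s` is the context of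
trial `s` and `payoff s a` is the payoff that arm `a` yields in trial `s`. -/
def run (σ L : ℝ) (T : ℕ) (R : Rules K) (x : ℕ → ℝ) (payoff : ℕ → Fin K → ℝ) : ℕ → State K
  | 0 => ⟨∅, {Ball.root K}, []⟩
  | t + 1 => step σ L T R (run σ L T R x payoff t) (x t) (payoff t)

/-- The arm `a_t` that the algorithm plays in trial `t` with contexts `x` and noise `ε`, i.e. with
payoffs `π_s = f_{a_s}(x_s) + ε_s`. -/
def playedArm (σ L : ℝ) (T : ℕ) (R : Rules K) (f : Fin K → unitInterval → ℝ)
    (x : ℕ → unitInterval) (ε : ℕ → ℝ) (t : ℕ) : Fin K :=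
  selectArm σ L T R (run σ L T R (fun s => (x s : ℝ)) (fun s a => f a (x s) + ε s) t) (x t)

/-- The contextual regret `R(T) = ∑_t (f*(x_t) - f_{a_t}(x_t))` of the algorithm over its time
horizon. -/
def regret (σ L : ℝ) (T : ℕ) (R : Rules K) (f : Fin K → unitInterval → ℝ)
    (x : ℕ → unitInterval) (ε : ℕ → ℝ) : ℝ :=
  ∑ t ∈ Finset.range T, (optReward f (x t) - f (playedArm σ L T R f x ε t) (x t))

end Algorithm

end ApproxZooming

end

noncomputable section

namespace ApproxZooming

/-! ### Ranks in a finite set of reals -/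

/-! Classify every trial by the dyadic interval (level i, index j) of the chosen ball. The expected
regret is then a sum over intervals of (regret per play) times (expected number of plays), so three
estimates suffice. Write G = σ² ln(TK)/L² and M = |S*| L/L'.

Regret per play. Outside an event of probability at most 806/T all noise sums formed by the
algorithm are small. There the nearest neighbour estimates are accurate, so arms put into one
cluster have rewards within 2LΔ of each other over the whole new interval
(`Good.sub_le_of_mem_split`). Hence UCB bounds the reward of each arm of an active ball from above
(`Good.le_ucb`), and a ball that is chosen often enough to become flagged is 7LΔ-optimal
(`Good.sub_le_of_flag`). Its children are half as wide, hence 14LΔ-optimal: a play at level i ≥ 2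
costs at most 14L/2ⁱ (`Good.regret_le`). The bad event costs at most 806 over all T trials.

Number of intervals. A suboptimal arm loses at least the gap, so an interval of level i ≥ 2 on which
regret occurs contains a context of gap at most 20L/2ⁱ. By `card_smallGap_le` the measure condition
leaves at most 24M such intervals per level.

Plays per interval. The balls that ever lie over one interval have disjoint arm sets
(`Env.eq_of_ever`), so there are at most K of them, and each leaves the active phase after a bounded
number of plays. In the flagged phase, neither the ball nor the arm depends on where in the interval
the (irrational) context falls. That arm lacks data in one of the 64 subintervals, which a fresh
uniform context in the interval hits with conditional probability 1/64; such useful trials are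
bounded deterministically by K times the number of neighbours. So O(K G 4ⁱ) plays are expected
(`IsInput.sum_measureReal_over_le`).

Summation. Up to constants, levels below m + 2 contribute K G (1 + M L (2ᵐ - 1)) and deeper levels L
T/2ᵐ; balancing in m gives the square root (`exists_pow_balance`).

The noise bounds come from an exponential martingale for Gaussian noise selected by predictable
events (`GaussianNoise.lintegral_expProd`). Predictability requires that all choices of the
algorithm be measurable, which is checked on their countably many values. -/

lemma rank_le_rank_iff {ι : Type*} (A : Finset ι) (φ : ι → ℝ) {s m : ι} (hs : s ∈ A) :
    (A.filter fun l => φ l ≤ φ s).card ≤ (A.filter fun l => φ l ≤ φ m).card ↔ φ s ≤ φ m := by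
  constructor
  · intro h
    by_contra hlt
    rw [not_le] at hlt
    have hss : (A.filter fun l => φ l ≤ φ m) ⊂ (A.filter fun l => φ l ≤ φ s) := by
      rw [Finset.ssubset_iff_of_subset]
      · exact ⟨s, by simp [hs], by simp [hlt]⟩
      · intro l hl
        simp only [Finset.mem_filter] at hl ⊢
        exact ⟨hl.1, hl.2.trans hlt.le⟩
    exact absurd (Finset.card_lt_card hss) (not_lt.mpr h)
  · intro h
    apply Finset.card_le_card
    intro l hl
    simp only [Finset.mem_filter] at hl ⊢
    exact ⟨hl.1, hl.2.trans h⟩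

/-- Ranks map `A` bijectively onto 1, ..., |A|, so some `m` has rank exactly `k`. This shows that
the nearest neighbours number exactly `k` and are cut out by a single radius. -/
lemma exists_rank_eq {ι : Type*} (A : Finset ι) (φ : ι → ℝ) (hinj : Set.InjOn φ A) {k : ℕ}
    (hk : 1 ≤ k) (hkA : k ≤ A.card) :
    ∃ m ∈ A, (A.filter fun s => (A.filter fun l => φ l ≤ φ s).card ≤ k) =
        A.filter (fun s => φ s ≤ φ m) ∧
      (A.filter fun s => φ s ≤ φ m).card = k := by
  classical
  set r : ι → ℕ := fun s => (A.filter fun l => φ l ≤ φ s).card with hr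
  have hrinj : Set.InjOn r A := by
    intro s hs s' hs' h
    apply hinj hs hs'
    apply le_antisymm
    · exact (rank_le_rank_iff A φ hs).1 h.le
    · exact (rank_le_rank_iff A φ hs').1 h.ge
  have himg : A.image r = Finset.Icc 1 A.card := by
    apply Finset.eq_of_subset_of_card_le
    · intro n hn
      obtain ⟨s, hs, rfl⟩ := Finset.mem_image.1 hn
      rw [Finset.mem_Icc]
      constructor
      · apply Finset.card_pos.2
        exact ⟨s, by simp [hs]⟩
      · exact Finset.card_filter_le _ _
    · rw [Finset.card_image_of_injOn hrinj]
      simp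
  have hkm : k ∈ A.image r := by
    rw [himg, Finset.mem_Icc]
    exact ⟨hk, hkA⟩
  obtain ⟨m, hm, hrm⟩ := Finset.mem_image.1 hkm
  refine ⟨m, hm, ?_, hrm⟩
  apply Finset.filter_congr
  intro s hs
  rw [← hrm]
  exact rank_le_rank_iff A φ hs

/-- The elements counted are among the first `k` elements of `B`. It is applied to the samples that
arrive while a subinterval is still short of data. -/
lemma card_filter_lt_le (B : ℕ → Prop) [DecidablePred B] (k t : ℕ) :
    ((Finset.range t).filter fun s => B s ∧
      ((Finset.range s).filter B).card < k).card ≤ k := by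
  induction t with
  | zero => simp
  | succ t ih =>
    rw [Finset.range_add_one, Finset.filter_insert]
    split_ifs with h
    · rw [Finset.card_insert_of_notMem (by simp)]
      have : ((Finset.range t).filter fun s => B s ∧
          ((Finset.range s).filter B).card < k).card ≤ ((Finset.range t).filter B).card := by
        apply Finset.card_le_card
        intro s hs
        simp only [Finset.mem_filter] at hs ⊢
        exact ⟨hs.1, hs.2.1⟩
      omega
    · exact ih

/-! ### The clustering step -/

/-- The properties of a clustering of the arms in `l`. -/
structure IsClustering {K : ℕ} (d : Fin K → Fin K → ℝ) (r : ℝ) (l : List (Fin K))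
    (c : Finset (Fin K) × (Fin K → Finset (Fin K))) : Prop where
  center_mem : ∀ y ∈ c.1, y ∈ l
  cover : ∀ a ∈ l, ∃ y ∈ c.1, a ∈ c.2 y
  subset : ∀ y ∈ c.1, ∀ a ∈ c.2 y, a ∈ l
  unique : ∀ y ∈ c.1, ∀ y' ∈ c.1, ∀ a ∈ c.2 y, a ∈ c.2 y' → y = y'
  self_mem : ∀ y ∈ c.1, y ∈ c.2 y
  dist_le : ∀ y ∈ c.1, ∀ a ∈ c.2 y, a = y ∨ d a y ≤ r

lemma IsClustering.step {K : ℕ} {d : Fin K → Fin K → ℝ} {r : ℝ} {l : List (Fin K)}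
    {c : Finset (Fin K) × (Fin K → Finset (Fin K))} (h : IsClustering d r l c)
    (pick : Finset (Fin K) → Fin K) (hpick : ∀ A, A.Nonempty → pick A ∈ A) {a : Fin K}
    (ha : a ∉ l) : IsClustering d r (l ++ [a]) (clusterStep d r pick c a) := by
  classical
  have hac : a ∉ c.1 := fun h' => ha (h.center_mem a h')
  unfold clusterStep
  split_ifs with hfar
  · have hne : ∀ y ∈ c.1, y ≠ a := fun y hy e => hac (e ▸ hy)
    have hna : ∀ y ∈ c.1, a ∉ c.2 y := fun y hy h' => ha (h.subset y hy a h')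
    constructor
    · intro y hy
      rcases Finset.mem_insert.1 hy with rfl | hy
      · simp
      · simp [h.center_mem y hy]
    · intro b hb
      rcases List.mem_append.1 hb with hb | hb
      · obtain ⟨y, hy, hby⟩ := h.cover b hb
        exact ⟨y, by simp [hy], by simpa [Function.update_of_ne (hne y hy)] using hby⟩
      · obtain rfl : b = a := by simpa using hb
        exact ⟨b, by simp, by simp⟩
    · intro y hy b hb
      rcases Finset.mem_insert.1 hy with rfl | hy
      · simp at hb; simp [hb]
      · simp only [Function.update_of_ne (hne y hy)] at hb
        simp [h.subset y hy b hb]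
    · intro y hy y' hy' b hb hb'
      rcases Finset.mem_insert.1 hy with e | h1 <;> rcases Finset.mem_insert.1 hy' with e' | h2
      · rw [e, e']
      · simp only [e, Function.update_of_ne (hne y' h2), Function.update_self,
          Finset.mem_singleton] at hb hb'
        exact absurd (hb ▸ hb') (hna y' h2)
      · simp only [e', Function.update_of_ne (hne y h1), Function.update_self,
          Finset.mem_singleton] at hb hb'
        exact absurd (hb' ▸ hb) (hna y h1)
      · simp only [Function.update_of_ne (hne y h1), Function.update_of_ne (hne y' h2)] at hb hb'
        exact h.unique y h1 y' h2 b hb hb'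
    · intro y hy
      rcases Finset.mem_insert.1 hy with rfl | hy
      · simp
      · simpa [Function.update_of_ne (hne y hy)] using h.self_mem y hy
    · intro y hy b hb
      rcases Finset.mem_insert.1 hy with rfl | hy
      · simp at hb; simp [hb]
      · simp only [Function.update_of_ne (hne y hy)] at hb
        exact h.dist_le y hy b hb
  · push Not at hfar
    obtain ⟨y₀, hy₀, hdy₀⟩ := hfar
    have hne : (c.1.filter fun y => ∀ w ∈ c.1, d a y ≤ d a w).Nonempty := by
      obtain ⟨y, hy, hmin⟩ := Finset.exists_min_image c.1 (d a) ⟨y₀, hy₀⟩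
      exact ⟨y, Finset.mem_filter.2 ⟨hy, hmin⟩⟩
    have hz := hpick _ hne
    set z := pick (c.1.filter fun y => ∀ w ∈ c.1, d a y ≤ d a w) with hzdef
    rw [Finset.mem_filter] at hz
    obtain ⟨hz1, hz2⟩ := hz
    have hdz : d a z ≤ r := (hz2 y₀ hy₀).trans hdy₀
    have hmem : ∀ y b, b ∈ Function.update c.2 z (insert a (c.2 z)) y ↔
        b ∈ c.2 y ∨ (y = z ∧ b = a) := by
      intro y b
      by_cases hyz : y = z
      · subst hyz; simp [or_comm]
      · simp [hyz]
    constructor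
    · intro y hy
      simp [h.center_mem y hy]
    · intro b hb
      rcases List.mem_append.1 hb with hb | hb
      · obtain ⟨y, hy, hby⟩ := h.cover b hb
        exact ⟨y, hy, (hmem y b).2 (Or.inl hby)⟩
      · obtain rfl : b = a := by simpa using hb
        exact ⟨z, hz1, (hmem z b).2 (Or.inr ⟨rfl, rfl⟩)⟩
    · intro y hy b hb
      rcases (hmem y b).1 hb with hb | ⟨-, rfl⟩
      · simp [h.subset y hy b hb]
      · simp
    · intro y hy y' hy' b hb hb'
      rcases (hmem y b).1 hb with hb | ⟨rfl, rfl⟩ <;>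
        rcases (hmem y' b).1 hb' with hb' | ⟨hyz, hba⟩
      · exact h.unique y hy y' hy' b hb hb'
      · exact absurd (hba ▸ h.subset y hy b hb) ha
      · exact absurd (h.subset y' hy' _ hb') ha
      · exact hyz.symm
    · intro y hy
      exact (hmem y y).2 (Or.inl (h.self_mem y hy))
    · intro y hy b hb
      rcases (hmem y b).1 hb with hb | ⟨rfl, rfl⟩
      · exact h.dist_le y hy b hb
      · exact Or.inr hdz

lemma isClustering_foldl {K : ℕ} (d : Fin K → Fin K → ℝ) (r : ℝ)
    (pick : Finset (Fin K) → Fin K) (hpick : ∀ A, A.Nonempty → pick A ∈ A) (l : List (Fin K))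
    (hl : l.Nodup) :
    IsClustering d r l (l.foldl (clusterStep d r pick) (∅, fun _ => ∅)) := by
  induction l using List.reverseRecOn with
  | nil => constructor <;> simp
  | append_singleton l a ih =>
    rw [List.nodup_append] at hl
    rw [List.foldl_append]
    refine (ih hl.1).step pick hpick ?_
    intro ha
    exact hl.2.2 a ha a (by simp) rfl

/-! ### Optimal reward and gap -/

section Gap

variable {K : ℕ} {f : Fin K → unitInterval → ℝ} {L : ℝ}

lemma le_optReward (a : Fin K) (x : unitInterval) : f a x ≤ optReward f x :=
  le_ciSup (f := fun a => f a x) (Set.finite_range _).bddAbove a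

lemma exists_eq_optReward (hK : 1 ≤ K) (x : unitInterval) : ∃ a, f a x = optReward f x := by
  have : Nonempty (Fin K) := ⟨⟨0, hK⟩⟩
  exact exists_eq_ciSup_of_finite

lemma gap_le {a : Fin K} {x : unitInterval} (h : f a x ≠ optReward f x) :
    gap f x ≤ optReward f x - f a x := by
  classical
  have h1 := le_ciSup (f := fun a => if f a x ≠ optReward f x then f a x else 0)
    (Set.finite_range _).bddAbove a
  simp only [h, ne_eq, not_false_eq_true, if_true] at h1
  unfold gap
  convert sub_le_sub_left h1 (optReward f x) using 3

lemma optReward_le_add (hK : 1 ≤ K) (hf : ∀ a x x', |f a x - f a x'| ≤ L * |(x : ℝ) - (x' : ℝ)|)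
    (x x' : unitInterval) : optReward f x ≤ optReward f x' + L * |(x : ℝ) - (x' : ℝ)| := by
  obtain ⟨a, ha⟩ := exists_eq_optReward (f := f) hK x
  rw [← ha]
  have h1 := (abs_le.1 (hf a x x')).2
  have h2 := le_optReward (f := f) a x'
  linarith

/-- With the same optimal arms at both contexts, the second maximum in `gap` has its zero entries at
the same arms, so both maxima move by at most `L * |x - x'|`. Across a change of the optimal set the
gap may jump, hence `hopt`. -/
lemma gap_le_add (hK : 1 ≤ K) (hL : 0 ≤ L)
    (hf : ∀ a x x', |f a x - f a x'| ≤ L * |(x : ℝ) - (x' : ℝ)|) (x x' : unitInterval)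
    (hopt : ∀ a, f a x = optReward f x ↔ f a x' = optReward f x') :
    gap f x ≤ gap f x' + 2 * L * |(x : ℝ) - (x' : ℝ)| := by
  classical
  have : Nonempty (Fin K) := ⟨⟨0, hK⟩⟩
  have h0 : 0 ≤ L * |(x : ℝ) - (x' : ℝ)| := by positivity
  have h1 := optReward_le_add hK hf x x'
  have h2 : (⨆ a, (if f a x' ≠ optReward f x' then f a x' else 0)) ≤
      (⨆ a, (if f a x ≠ optReward f x then f a x else 0)) + L * |(x : ℝ) - (x' : ℝ)| := by
    apply ciSup_le
    intro a
    have h3 := le_ciSup (f := fun a => if f a x ≠ optReward f x then f a x else 0)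
      (Set.finite_range _).bddAbove a
    have h4 := (abs_le.1 (hf a x x')).1
    have h5 := hopt a
    by_cases h6 : f a x = optReward f x
    · rw [if_neg (not_not.2 (h5.1 h6))]
      rw [if_neg (not_not.2 h6)] at h3
      linarith
    · rw [if_pos (fun h7 => h6 (h5.2 h7))]
      rw [if_pos h6] at h3
      linarith
  unfold gap
  linarith

end Gap

/-! ### Counting dyadic intervals that contain a context with small gap -/

lemma volume_real_unitInterval_Ioo {p q : ℝ} (hp : 0 ≤ p) (hpq : p ≤ q) (hq : q ≤ 1) :
    (volume : Measure unitInterval).real {x | p < (x : ℝ) ∧ (x : ℝ) < q} = q - p := by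
  have h1 : {x : unitInterval | p < (x : ℝ) ∧ (x : ℝ) < q} =
      (Subtype.val : unitInterval → ℝ) ⁻¹' (Set.Ioo p q) := rfl
  rw [Measure.real, h1]
  have : (volume : Measure unitInterval) (Subtype.val ⁻¹' (Set.Ioo p q)) =
      volume (Set.Ioo p q) := by
    rw [Measure.Subtype.volume_def, Measure.comap_apply _ Subtype.val_injective]
    · congr 1
      rw [Subtype.image_preimage_coe]
      apply Set.inter_eq_right.2
      intro z hz
      exact ⟨by linarith [hz.1], by linarith [hz.2]⟩
    · intro s hs
      exact MeasurableSet.subtype_image measurableSet_Icc hs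
    · exact measurable_subtype_coe measurableSet_Ioo
  rw [this, Real.volume_Ioo, ENNReal.toReal_ofReal (by linarith)]

/-- Dyadic intervals of one level overlap in end points only, so open pieces of length at least `δ`
inside them are disjoint and their lengths add up within `E`. -/
lemma card_mul_le_volume (i : ℕ) (J : Finset ℕ) (hJ : ∀ j ∈ J, j < 2 ^ i) (δ : ℝ)
    (E : Set unitInterval)
    (h : ∀ j ∈ J, ∃ p q : ℝ, (j : ℝ) / 2 ^ i ≤ p ∧ p + δ ≤ q ∧ p ≤ q ∧ q ≤ ((j : ℝ) + 1) / 2 ^ i ∧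
      ∀ x : unitInterval, p < (x : ℝ) → (x : ℝ) < q → x ∈ E) :
    J.card * δ ≤ (volume : Measure unitInterval).real E := by
  choose! p q h1 h2 h3 h4 h5 using h
  set A : ℕ → Set unitInterval := fun j => {x | p j < (x : ℝ) ∧ (x : ℝ) < q j} with hA
  have hpos : (0 : ℝ) < 2 ^ i := by positivity
  have hmeas : ∀ j ∈ J, MeasurableSet (A j) := fun j _ =>
    measurable_subtype_coe measurableSet_Ioo
  have hdisj : Set.PairwiseDisjoint (J : Set ℕ) A := by
    have key : ∀ j ∈ J, ∀ j' ∈ J, j < j' → Disjoint (A j) (A j') := by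
      intro j hj j' hj' hjj
      rw [Set.disjoint_left]
      rintro x ⟨-, hx1⟩ ⟨hx2, -⟩
      have h6 : ((j : ℝ) + 1) / 2 ^ i ≤ (j' : ℝ) / 2 ^ i := by
        apply div_le_div_of_nonneg_right _ hpos.le
        exact_mod_cast hjj
      linarith [h1 j' hj', h4 j hj]
    intro j hj j' hj' hne
    rcases lt_or_gt_of_ne hne with hlt | hlt
    · exact key j hj j' hj' hlt
    · exact (key j' hj' j hj hlt).symm
  have hsum : (volume : Measure unitInterval).real (⋃ j ∈ J, A j) =
      ∑ j ∈ J, (volume : Measure unitInterval).real (A j) :=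
    measureReal_biUnion_finset hdisj hmeas
  have hle : (volume : Measure unitInterval).real (⋃ j ∈ J, A j) ≤
      (volume : Measure unitInterval).real E := by
    apply measureReal_mono
    · apply Set.iUnion₂_subset
      rintro j hj x ⟨hx1, hx2⟩
      exact h5 j hj x hx1 hx2
    · exact measure_ne_top _ _
  refine le_trans ?_ hle
  rw [hsum, ← nsmul_eq_mul]
  apply Finset.card_nsmul_le_sum
  intro j hj
  have h7 : (0 : ℝ) ≤ (j : ℝ) / 2 ^ i := by positivity
  have h8 : ((j : ℝ) + 1) / 2 ^ i ≤ 1 := by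
    rw [div_le_one hpos]
    exact_mod_cast hJ j hj
  rw [hA, volume_real_unitInterval_Ioo (h7.trans (h1 j hj)) (h3 j hj) ((h4 j hj).trans h8)]
  linarith [h2 j hj]

end ApproxZooming

namespace ApproxZooming

section GapCount

variable {K : ℕ} {f : Fin K → unitInterval → ℝ} {L : ℝ}

lemma abs_optReward_sub_le (hK : 1 ≤ K)
    (hf : ∀ a x x', |f a x - f a x'| ≤ L * |(x : ℝ) - (x' : ℝ)|)
    (x x' : unitInterval) : |optReward f x - optReward f x'| ≤ L * |(x : ℝ) - (x' : ℝ)| := by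
  have h1 := optReward_le_add hK hf x x'
  have h2 := optReward_le_add hK hf x' x
  rw [abs_sub_comm (x' : ℝ)] at h2
  rw [abs_le]
  constructor <;> linarith

lemma continuous_of_abs_sub_le {h : unitInterval → ℝ}
    (hh : ∀ x x', |h x - h x'| ≤ L * |(x : ℝ) - (x' : ℝ)|) : Continuous h := by
  have : LipschitzWith (Real.toNNReal L) h := by
    apply LipschitzWith.of_dist_le_mul
    intro x y
    rw [Real.dist_eq, Subtype.dist_eq, Real.dist_eq]
    refine (hh x y).trans ?_
    gcongr
    exact Real.le_coe_toNNReal L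
  exact this.continuous

/-- Take the zero of `optReward f - f a` nearest to `y` on the side of `x`. Between it and `y` the
arm `a` is suboptimal, so the gap is at most the loss of `a`, which vanishes at that zero and is
`2L`-Lipschitz. The alternatives are `x < y` and `y < x`. -/
lemma exists_interval_gap_le (hK : 1 ≤ K)
    (hf : ∀ a x x', |f a x - f a x'| ≤ L * |(x : ℝ) - (x' : ℝ)|) {x y : unitInterval} {a : Fin K}
    (hx : f a x = optReward f x) (hy : f a y ≠ optReward f y) :
    ∃ p q : ℝ, min (x : ℝ) y ≤ p ∧ p < q ∧ q ≤ max (x : ℝ) y ∧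
      ((∀ z : unitInterval, p < z → (z : ℝ) < q → gap f z ≤ 2 * L * (z - p)) ∨
        (∀ z : unitInterval, p < z → (z : ℝ) < q → gap f z ≤ 2 * L * (q - z))) := by
  have hopt := abs_optReward_sub_le hK hf
  have hcont : Continuous fun z => optReward f z - f a z :=
    (continuous_of_abs_sub_le hopt).sub (continuous_of_abs_sub_le (hf a))
  have hclosed : IsClosed {z | optReward f z - f a z = 0} := isClosed_singleton.preimage hcont
  have hbound : ∀ z p : unitInterval, optReward f p - f a p = 0 → f a z ≠ optReward f z →
      gap f z ≤ 2 * L * |(z : ℝ) - p| := by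
    intro z p hp hz
    have h1 := gap_le hz
    have h2 := (abs_le.1 (hopt z p)).2
    have h3 := (abs_le.1 (hf a z p)).1
    linarith
  have hne : x ≠ y := by
    rintro rfl
    exact hy hx
  rcases lt_or_gt_of_ne hne with hlt | hlt
  · have hcomp : IsCompact (Set.Icc x y ∩ {z | optReward f z - f a z = 0}) :=
      (isClosed_Icc.inter hclosed).isCompact
    obtain ⟨p, ⟨⟨hp1, hp2⟩, hp0⟩, hmax⟩ := hcomp.exists_isGreatest
      ⟨x, ⟨le_rfl, hlt.le⟩, by simp [hx]⟩
    have hpy : p < y := by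
      apply lt_of_le_of_ne hp2
      rintro rfl
      exact hy (by simp only [Set.mem_ofPred_eq] at hp0; linarith)
    refine ⟨p, y, (min_le_left _ _).trans hp1, hpy, le_max_right _ _, Or.inl ?_⟩
    intro z hz1 hz2
    rw [← abs_of_pos (sub_pos.2 hz1)]
    apply hbound z p hp0
    intro hz0
    have : z ≤ p := hmax ⟨⟨hp1.trans (le_of_lt hz1), le_of_lt hz2⟩, by simp [hz0]⟩
    exact absurd hz1 (not_lt.2 this)
  · have hcomp : IsCompact (Set.Icc y x ∩ {z | optReward f z - f a z = 0}) :=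
      (isClosed_Icc.inter hclosed).isCompact
    obtain ⟨p, ⟨⟨hp1, hp2⟩, hp0⟩, hmin⟩ := hcomp.exists_isLeast
      ⟨x, ⟨hlt.le, le_rfl⟩, by simp [hx]⟩
    have hpy : y < p := by
      apply lt_of_le_of_ne hp1
      rintro rfl
      exact hy (by simp only [Set.mem_ofPred_eq] at hp0; linarith)
    refine ⟨y, p, min_le_right _ _, hpy, le_trans (Subtype.coe_le_coe.2 hp2) (le_max_left _ _),
      Or.inr ?_⟩
    intro z hz1 hz2
    rw [← abs_of_pos (sub_pos.2 hz2), abs_sub_comm]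
    apply hbound z p hp0
    intro hz0
    have : p ≤ z := hmin ⟨⟨le_of_lt hz1, (le_of_lt hz2).trans hp2⟩, by simp [hz0]⟩
    exact absurd hz2 (not_lt.2 this)

/-- If the contexts of gap at most `22 L 2⁻ⁱ` have measure at most `22 M 2⁻ⁱ` for all `i ≥ 1`, then
at most `24 M` dyadic intervals of length `2⁻ⁱ` contain a context of gap at most `20 L 2⁻ⁱ`. -/
lemma card_smallGap_le (hK : 1 ≤ K) (hL : 0 < L)
    (hf : ∀ a x x', |f a x - f a x'| ≤ L * |(x : ℝ) - (x' : ℝ)|) {M : ℝ}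
    (hgap : ∀ i : ℕ, 1 ≤ i →
      (volume : Measure unitInterval).real {x | gap f x ≤ 22 * L / 2 ^ i} ≤ 22 * M / 2 ^ i)
    {i : ℕ} (hi : 1 ≤ i) (J : Finset ℕ) (hJ : ∀ j ∈ J, j < 2 ^ i)
    (h : ∀ j ∈ J, ∃ x : unitInterval, (j : ℝ) / 2 ^ i ≤ x ∧ (x : ℝ) ≤ ((j : ℝ) + 1) / 2 ^ i ∧
      gap f x ≤ 20 * L / 2 ^ i) :
    (J.card : ℝ) ≤ 24 * M := by
  classical
  have hpos : (0 : ℝ) < 2 ^ i := by positivity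
  set C : ℕ → Prop := fun j => ∀ x x' : unitInterval, (j : ℝ) / 2 ^ i ≤ x →
    (x : ℝ) ≤ ((j : ℝ) + 1) / 2 ^ i → (j : ℝ) / 2 ^ i ≤ x' → (x' : ℝ) ≤ ((j : ℝ) + 1) / 2 ^ i →
    ∀ a, f a x = optReward f x → f a x' = optReward f x' with hC
  have hwidth : ∀ j : ℕ, ((j : ℝ) + 1) / 2 ^ i = (j : ℝ) / 2 ^ i + 1 / 2 ^ i := by
    intro j; ring
  -- Where the optimal set is constant, one context of gap at most 20L/2ⁱ forces gap at most (20 +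
  -- 2)L/2ⁱ on the whole interval, which contributes its full length.
  have hJ1 : ((J.filter C).card : ℝ) ≤ 22 * M := by
    have h1 := card_mul_le_volume i (J.filter C) (fun j hj => hJ j (Finset.mem_filter.1 hj).1)
      (1 / 2 ^ i) {x | gap f x ≤ 22 * L / 2 ^ i} (by
        intro j hj
        rw [Finset.mem_filter] at hj
        obtain ⟨y, hy1, hy2, hy3⟩ := h j hj.1
        have hc := hj.2
        refine ⟨(j : ℝ) / 2 ^ i, ((j : ℝ) + 1) / 2 ^ i, le_rfl, (hwidth j).ge, ?_, le_rfl, ?_⟩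
        · rw [hwidth]; simp
        · intro x hx1 hx2
          have h2 := gap_le_add hK hL.le hf x y (fun a =>
            ⟨hc x y hx1.le hx2.le hy1 hy2 a, hc y x hy1 hy2 hx1.le hx2.le a⟩)
          have h3 : |(x : ℝ) - y| ≤ 1 / 2 ^ i := by
            rw [hwidth] at hx2 hy2
            rw [abs_le]; constructor <;> linarith
          have h4 : 2 * L * |(x : ℝ) - y| ≤ 2 * L * (1 / 2 ^ i) := by gcongr
          simp only [Set.mem_ofPred_eq]
          have h5 : 22 * L / 2 ^ i = 20 * L / 2 ^ i + 2 * L * (1 / 2 ^ i) := by ring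
          linarith)
    have h2 := h1.trans (hgap i hi)
    rwa [mul_one_div, div_le_div_iff_of_pos_right hpos] at h2
  -- Where the optimal set changes, the gap is at most 2L times the distance to an end point of some
  -- nondegenerate subinterval. At a fine enough scale `n` each such interval therefore contributes
  -- length 11/2ⁿ to the set of gap at most 22L/2ⁿ, and the bound 22M/2ⁿ allows 2M of them. This is
  -- where the measure condition is needed at arbitrarily fine scales.
  have hJ2 : ((J.filter fun j => ¬ C j).card : ℝ) ≤ 2 * M := by
    have h1 : ∀ j ∈ J.filter fun j => ¬ C j, ∃ p q : ℝ, (j : ℝ) / 2 ^ i ≤ p ∧ p < q ∧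
        q ≤ ((j : ℝ) + 1) / 2 ^ i ∧
        ((∀ z : unitInterval, p < z → (z : ℝ) < q → gap f z ≤ 2 * L * (z - p)) ∨
        (∀ z : unitInterval, p < z → (z : ℝ) < q → gap f z ≤ 2 * L * (q - z))) := by
      intro j hj
      have hc := (Finset.mem_filter.1 hj).2
      simp only [hC] at hc
      push Not at hc
      obtain ⟨x, x', hx1, hx2, hx1', hx2', a, ha, ha'⟩ := hc
      obtain ⟨p, q, hp, hpq, hq, hor⟩ := exists_interval_gap_le hK hf ha ha'
      exact ⟨p, q, (le_min hx1 hx1').trans hp, hpq, hq.trans (max_le hx2 hx2'), hor⟩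
    choose! p q hp hpq hq hor using h1
    obtain ⟨n, hn1, hn⟩ : ∃ n : ℕ, 1 ≤ n ∧ ∀ j ∈ J.filter fun j => ¬ C j,
        p j + 11 / 2 ^ n ≤ q j := by
      have hlim : Filter.Tendsto (fun n : ℕ => (11 : ℝ) / 2 ^ n) Filter.atTop (nhds 0) := by
        apply tendsto_const_nhds.div_atTop
        exact tendsto_pow_atTop_atTop_of_one_lt one_lt_two
      have hev : ∀ᶠ n : ℕ in Filter.atTop, ∀ j ∈ J.filter fun j => ¬ C j,
          p j + 11 / 2 ^ n ≤ q j := by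
        rw [Filter.eventually_all_finset]
        intro j hj
        filter_upwards [hlim.eventually (gt_mem_nhds (sub_pos.2 (hpq j hj)))] with n hn
        linarith
      obtain ⟨n, hn1, hn2⟩ := ((Filter.eventually_ge_atTop 1).and hev).exists
      exact ⟨n, hn1, hn2⟩
    have hposn : (0 : ℝ) < 2 ^ n := by positivity
    have h11 : (0 : ℝ) < 11 / 2 ^ n := by positivity
    have h2 := card_mul_le_volume i (J.filter fun j => ¬ C j)
      (fun j hj => hJ j (Finset.mem_filter.1 hj).1)
      (11 / 2 ^ n) {x | gap f x ≤ 22 * L / 2 ^ n} (by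
        intro j hj
        have e : 2 * L * (11 / 2 ^ n) = 22 * L / 2 ^ n := by ring
        rcases hor j hj with hz | hz
        · refine ⟨p j, p j + 11 / 2 ^ n, hp j hj, le_rfl, by linarith,
            (hn j hj).trans (hq j hj), ?_⟩
          intro x hx1 hx2
          refine (hz x hx1 (hx2.trans_le (hn j hj))).trans ?_
          rw [← e]
          gcongr
          linarith
        · refine ⟨q j - 11 / 2 ^ n, q j, ?_, by linarith, by linarith, hq j hj, ?_⟩
          · linarith [hp j hj, hn j hj]
          intro x hx1 hx2
          refine (hz x (by linarith [hn j hj]) hx2).trans ?_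
          rw [← e]
          gcongr
          linarith)
    have h3 := h2.trans (hgap n hn1)
    have h4 : ((J.filter fun j => ¬ C j).card : ℝ) * 11 / 2 ^ n ≤ 22 * M / 2 ^ n := by
      rw [mul_div_assoc]; exact h3
    rw [div_le_div_iff_of_pos_right hposn] at h4
    linarith
  have hsplit := Finset.card_filter_add_card_filter_not (s := J) C
  have : (J.card : ℝ) = (J.filter C).card + (J.filter fun j => ¬ C j).card := by
    exact_mod_cast hsplit.symm
  linarith

end GapCount

end ApproxZooming

namespace ApproxZooming

/-! ### Dyadic intervals -/

namespace Ball

variable {K : ℕ}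

lemma width_eq (ρ : Ball K) : ρ.width = 1 / 2 ^ ρ.level := by
  unfold width hi lo
  ring

lemma width_pos (ρ : Ball K) : 0 < ρ.width := by
  rw [width_eq]; positivity

lemma hi_eq (ρ : Ball K) : ρ.hi = ρ.lo + ρ.width := by
  unfold width; ring

lemma child_lo (ρ : Ball K) (ℓ : Fin 2) (A : Finset (Fin K)) :
    (ρ.child ℓ A).lo = ρ.lo + ρ.width * (ℓ : ℕ) / 2 := by
  rw [width_eq]
  simp only [child, lo]
  push_cast
  rw [pow_succ]
  field_simp

lemma child_width (ρ : Ball K) (ℓ : Fin 2) (A : Finset (Fin K)) :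
    (ρ.child ℓ A).width = ρ.width / 2 := by
  rw [width_eq, width_eq]
  simp only [child]
  rw [pow_succ]
  field_simp

lemma child_hi (ρ : Ball K) (ℓ : Fin 2) (A : Finset (Fin K)) :
    (ρ.child ℓ A).hi = ρ.lo + ρ.width * (1 + (ℓ : ℕ)) / 2 := by
  rw [hi_eq, child_lo, child_width]; ring

lemma mem_of_mem_child {ρ : Ball K} {ℓ : Fin 2} {A : Finset (Fin K)} {z : ℝ}
    (h : z ∈ Set.Icc (ρ.child ℓ A).lo (ρ.child ℓ A).hi) : z ∈ Set.Icc ρ.lo ρ.hi := by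
  rw [child_lo, child_hi] at h
  have := ρ.width_pos
  rw [hi_eq]
  fin_cases ℓ <;> simp at h <;> constructor <;> linarith [h.1, h.2]

lemma exists_mem_child {ρ : Ball K} {z : ℝ} (h : z ∈ Set.Icc ρ.lo ρ.hi) :
    ∃ ℓ : Fin 2, ∀ A, z ∈ Set.Icc (ρ.child ℓ A).lo (ρ.child ℓ A).hi := by
  rw [hi_eq] at h
  rcases le_total z (ρ.lo + ρ.width / 2) with h1 | h1
  · refine ⟨0, fun A => ?_⟩
    rw [child_lo, child_hi]
    simp
    exact ⟨h.1, h1⟩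
  · refine ⟨1, fun A => ?_⟩
    rw [child_lo, child_hi]
    simp
    constructor <;> linarith [h.1, h.2]

/-- The closed intervals of one level share end points; these are rational, so for irrational
contexts the intervals behave like a partition. -/
lemma index_eq_floor {ρ : Ball K} {z : ℝ} (hz : Irrational z) (h : z ∈ Set.Icc ρ.lo ρ.hi) :
    (ρ.index : ℤ) = ⌊z * 2 ^ ρ.level⌋ := by
  have hpos : (0 : ℝ) < 2 ^ ρ.level := by positivity
  symm
  rw [Int.floor_eq_iff]
  obtain ⟨h1, h2⟩ := h
  unfold lo at h1
  unfold hi at h2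
  rw [div_le_iff₀ hpos] at h1
  rw [le_div_iff₀ hpos] at h2
  refine ⟨by exact_mod_cast h1, lt_of_le_of_ne (by exact_mod_cast h2) ?_⟩
  intro h3
  have h4 : Irrational (z * ((2 ^ ρ.level : ℕ) : ℝ)) :=
    hz.mul_natCast (by positivity)
  apply h4.ne_nat (ρ.index + 1)
  push_cast
  exact_mod_cast h3

lemma index_eq_of_mem {ρ ρ' : Ball K} {z : ℝ} (hz : Irrational z) (h : z ∈ Set.Icc ρ.lo ρ.hi)
    (h' : z ∈ Set.Icc ρ'.lo ρ'.hi) (hl : ρ.level = ρ'.level) : ρ.index = ρ'.index := by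
  have h1 := index_eq_floor hz h
  have h2 := index_eq_floor hz h'
  rw [hl, ← h2] at h1
  exact_mod_cast h1

lemma exists_irrational_mem (ρ : Ball K) : ∃ z, Irrational z ∧ z ∈ Set.Icc ρ.lo ρ.hi := by
  have : ρ.lo < ρ.hi := by
    rw [hi_eq]; linarith [ρ.width_pos]
  obtain ⟨z, hz, h1, h2⟩ := exists_irrational_btwn this
  exact ⟨z, hz, h1.le, h2.le⟩

lemma eq_of_level_index_arms {ρ ρ' : Ball K} (h1 : ρ.level = ρ'.level) (h2 : ρ.index = ρ'.index)
    (h3 : ρ.arms = ρ'.arms) : ρ = ρ' := by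
  cases ρ; cases ρ'; simp_all

lemma mem_iff_of_level_index {ρ ρ' : Ball K} (h1 : ρ.level = ρ'.level)
    (h2 : ρ.index = ρ'.index) (z : ℝ) :
    z ∈ Set.Icc ρ.lo ρ.hi ↔ z ∈ Set.Icc ρ'.lo ρ'.hi := by
  unfold lo hi
  rw [h1, h2]

lemma lo_nonneg (ρ : Ball K) : 0 ≤ ρ.lo := by unfold lo; positivity

lemma hi_le_one {ρ : Ball K} (h : ρ.index < 2 ^ ρ.level) : ρ.hi ≤ 1 := by
  unfold hi
  rw [div_le_one (by positivity)]
  exact_mod_cast h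

end Ball

/-! ### Subpartitions -/

section SubPartition

variable {K : ℕ}

/-- The value of `subPartition` in terms of clusters. -/
structure IsSplit (d : Fin 2 → Fin K → Fin K → ℝ) (r : ℝ) (ρ : Ball K)
    (B : Finset (Ball K)) : Prop where
  mem : ∀ c ∈ B, ∃ ℓ : Fin 2, ∃ A : Finset (Fin K), c = ρ.child ℓ A ∧ A ⊆ ρ.arms ∧ A.Nonempty ∧
    ∃ y ∈ ρ.arms, ∀ b ∈ A, b = y ∨ d ℓ b y ≤ r
  cover : ∀ ℓ : Fin 2, ∀ a ∈ ρ.arms, ∃ A : Finset (Fin K), ρ.child ℓ A ∈ B ∧ a ∈ A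
  unique : ∀ c ∈ B, ∀ c' ∈ B, ∀ a, c.index = c'.index → a ∈ c.arms → a ∈ c'.arms → c = c'

lemma isSplit_subPartition (σ L : ℝ) (T : ℕ) (R : Rules K) (t : ℕ) (log : List (Trial K))
    (ρ : Ball K) :
    IsSplit (fun ℓ => estDist σ L T log ρ (ρ.lo + ρ.width * (ℓ : ℕ) / 2)
      (ρ.lo + ρ.width * (1 + (ℓ : ℕ)) / 2)) (3 / 16 * L * (ρ.width / 2)) ρ
      (subPartition σ L T R t log ρ) := by
  classical
  set d : Fin 2 → Fin K → Fin K → ℝ := fun ℓ => estDist σ L T log ρ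
    (ρ.lo + ρ.width * (ℓ : ℕ) / 2) (ρ.lo + ρ.width * (1 + (ℓ : ℕ)) / 2) with hd
  set c : Fin 2 → Finset (Fin K) × (Fin K → Finset (Fin K)) := fun ℓ =>
    (R.armOrder t ℓ ρ.arms).foldl (clusterStep (d ℓ) (3 / 16 * L * (ρ.width / 2)) (R.pickCenter t))
    (∅, fun _ => ∅) with hc
  have hcl : ∀ ℓ, IsClustering (d ℓ) (3 / 16 * L * (ρ.width / 2)) (R.armOrder t ℓ ρ.arms) (c ℓ) :=
    fun ℓ => isClustering_foldl _ _ _ (R.pickCenter_mem t) _ (R.armOrder_nodup t ℓ ρ.arms)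
  have hhalf : ∀ ℓ, subPartitionHalf σ L T R t log ρ ℓ =
      (c ℓ).1.image fun y => ρ.child ℓ ((c ℓ).2 y) := by
    intro ℓ
    unfold subPartitionHalf
    simp only [hc, hd]
    have : (ρ.lo + ρ.width * (1 + (ℓ : ℕ)) / 2 - (ρ.lo + ρ.width * (ℓ : ℕ) / 2) : ℝ) =
        ρ.width / 2 := by ring
    rw [this]
  have hmem : ∀ b, b ∈ subPartition σ L T R t log ρ ↔
      ∃ ℓ, ∃ y ∈ (c ℓ).1, ρ.child ℓ ((c ℓ).2 y) = b := by
    intro b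
    unfold subPartition
    rw [hhalf, hhalf, Finset.mem_union, Finset.mem_image, Finset.mem_image, Fin.exists_fin_two]
  constructor
  · intro b hb
    obtain ⟨ℓ, y, hy, rfl⟩ := (hmem b).1 hb
    refine ⟨ℓ, _, rfl, ?_, ⟨y, (hcl ℓ).self_mem y hy⟩, y, ?_, (hcl ℓ).dist_le y hy⟩
    · intro a ha
      exact (R.mem_armOrder _ _ _ _).1 ((hcl ℓ).subset y hy a ha)
    · exact (R.mem_armOrder _ _ _ _).1 ((hcl ℓ).center_mem y hy)
  · intro ℓ a ha
    obtain ⟨y, hy, hay⟩ := (hcl ℓ).cover a ((R.mem_armOrder _ _ _ _).2 ha)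
    exact ⟨_, (hmem _).2 ⟨ℓ, y, hy, rfl⟩, hay⟩
  · intro b hb b' hb' a hidx ha ha'
    obtain ⟨ℓ, y, hy, rfl⟩ := (hmem b).1 hb
    obtain ⟨ℓ', y', hy', rfl⟩ := (hmem b').1 hb'
    have hℓ : ℓ = ℓ' := by
      simp only [Ball.child] at hidx
      ext
      omega
    subst hℓ
    rw [(hcl ℓ).unique y hy y' hy' a ha ha']

end SubPartition

/-! ### Lists of trials as indexed families -/

lemma countP_map_range {α : Type*} (g : ℕ → α) (p : α → Bool) (t : ℕ) :
    ((List.range t).map g).countP p = ((Finset.range t).filter fun s => p (g s) = true).card := by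
  induction t with
  | zero => simp
  | succ t ih =>
    rw [List.range_succ, List.map_append, List.countP_append, ih, Finset.range_add_one,
      Finset.filter_insert]
    split_ifs with h
    · rw [Finset.card_insert_of_notMem (by simp)]
      simp [h]
    · simp [h]

lemma sum_filter_map_range {α : Type*} (g : ℕ → α) (p : α → Bool) (h : α → ℝ) (t : ℕ) :
    ((((List.range t).map g).filter p).map h).sum =
      ∑ s ∈ (Finset.range t).filter (fun s => p (g s) = true), h (g s) := by
  induction t with
  | zero => simp
  | succ t ih =>
    rw [List.range_succ, List.map_append, List.filter_append, List.map_append, List.sum_append, ih,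
      Finset.range_add_one, Finset.filter_insert]
    split_ifs with hp
    · rw [Finset.sum_insert (by simp)]
      simp [hp, add_comm]
    · simp [hp]

/-! ### Runs of the algorithm -/

/-- The data that determine a run of the algorithm. -/
structure Env (K : ℕ) where
  σ : ℝ
  L : ℝ
  T : ℕ
  R : Rules K
  x : ℕ → ℝ
  pay : ℕ → Fin K → ℝ

namespace Env

variable {K : ℕ} (e : Env K)

/-- The state before trial `t`. -/
def st (t : ℕ) : State K := run e.σ e.L e.T e.R e.x e.pay t

/-- The ball chosen in trial `t`. -/
def ball (t : ℕ) : Ball K := (selectBall e.σ e.L e.T e.R (e.st t) (e.x t)).1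

/-- Whether the ball chosen in trial `t` was flagged. -/
def flag (t : ℕ) : Bool := (selectBall e.σ e.L e.T e.R (e.st t) (e.x t)).2

/-- The arm played in trial `t`. -/
def arm (t : ℕ) : Fin K := selectArm e.σ e.L e.T e.R (e.st t) (e.x t)

/-- The record of trial `t`. -/
def tr (t : ℕ) : Trial K := ⟨e.x t, e.ball t, e.arm t, e.flag t, e.pay t (e.arm t)⟩

lemma st_zero : e.st 0 = ⟨∅, {Ball.root K}, []⟩ := rfl

lemma st_succ (t : ℕ) :
    e.st (t + 1) = step e.σ e.L e.T e.R (e.st t) (e.x t) (e.pay t) := rfl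

lemma log_succ (t : ℕ) : (e.st (t + 1)).log = (e.st t).log ++ [e.tr t] := by
  rw [st_succ]
  unfold step
  simp only
  split_ifs <;> rfl

/-- Turns all statements about logs into statements about finite sets of trial numbers. -/
lemma log_eq (t : ℕ) : (e.st t).log = (List.range t).map e.tr := by
  induction t with
  | zero => rfl
  | succ t ih => rw [log_succ, ih, List.range_succ, List.map_append]; rfl

lemma length_log (t : ℕ) : (e.st t).log.length = t := by
  rw [log_eq]; simp

lemma count_log (t : ℕ) (ρ : Ball K) :
    count (e.st t).log ρ = ((Finset.range t).filter fun s => e.ball s = ρ).card := by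
  unfold count
  rw [log_eq, countP_map_range]
  congr 1
  exact Finset.filter_congr fun s _ => decide_eq_true_iff

/-- The trials before `t` in which arm `a` was played from the flagged ball `ρ`. -/
def sampleSet (t : ℕ) (ρ : Ball K) (a : Fin K) : Finset ℕ :=
  (Finset.range t).filter fun s => e.ball s = ρ ∧ e.arm s = a ∧ e.flag s = true

lemma countP_samples (t : ℕ) (ρ : Ball K) (a : Fin K) (p : Trial K → Prop) [DecidablePred p] :
    (samples (e.st t).log ρ a).countP (fun s => decide (p s)) =
      ((e.sampleSet t ρ a).filter fun s => p (e.tr s)).card := by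
  unfold samples sampleSet
  rw [log_eq, List.countP_filter, countP_map_range, Finset.filter_filter]
  congr 1
  apply Finset.filter_congr
  intro s _
  rw [Bool.and_eq_true, decide_eq_true_iff, decide_eq_true_iff, and_comm]
  rfl

/-- The `q`-th of the 64 equal subintervals of the context interval of `ρ`. -/
def sub (ρ : Ball K) (q : Fin 64) : Set ℝ :=
  Set.Icc (ρ.lo + (q : ℝ) * ρ.width / 64) (ρ.lo + ((q : ℝ) + 1) * ρ.width / 64)

open scoped Classical in
/-- The number of samples before trial `t` in the `q`-th subinterval. -/
def subCount (t : ℕ) (ρ : Ball K) (a : Fin K) (q : Fin 64) : ℕ :=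
  ((e.sampleSet t ρ a).filter fun s => e.x s ∈ sub ρ q).card

lemma suffData_iff (t : ℕ) (ρ : Ball K) (a : Fin K) :
    SuffData e.σ e.L e.T (e.st t).log ρ a ↔
      ∀ q, numNeighbors e.σ e.L e.T ρ ≤ e.subCount t ρ a q := by
  classical
  unfold SuffData subCount
  refine forall_congr' fun q => ?_
  have := e.countP_samples t ρ a (fun s => s.context ∈ sub ρ q)
  unfold sub at this
  rw [iff_iff_eq]
  congr 1
  exact Eq.trans (by congr!) (this.trans rfl)

/-- The threshold on the number of plays at which a ball is flagged. -/
def thr (ρ : Ball K) : ℝ := 6 * e.σ ^ 2 * Real.log e.T / (e.L ^ 2 * ρ.width ^ 2)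

/-- The balls that replace `ball t` if it is split in trial `t`. -/
def split (t : ℕ) : Finset (Ball K) :=
  subPartition e.σ e.L e.T e.R t (e.st (t + 1)).log (e.ball t)

/-- The distance estimates in trial `t`. -/
def dhat (t : ℕ) (ℓ : Fin 2) : Fin K → Fin K → ℝ :=
  estDist e.σ e.L e.T (e.st (t + 1)).log (e.ball t)
    ((e.ball t).lo + (e.ball t).width * (ℓ : ℕ) / 2)
    ((e.ball t).lo + (e.ball t).width * (1 + (ℓ : ℕ)) / 2)

lemma isSplit_split (t : ℕ) :
    IsSplit (e.dhat t) (3 / 16 * e.L * ((e.ball t).width / 2)) (e.ball t) (e.split t) :=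
  isSplit_subPartition _ _ _ _ _ _ _

/-- All arms of the ball chosen in trial `t` have sufficient data after the trial. -/
def AllSuff (t : ℕ) : Prop :=
  ∀ b ∈ (e.ball t).arms, SuffData e.σ e.L e.T (e.st (t + 1)).log (e.ball t) b

lemma st_succ_of_split {t : ℕ} (h1 : e.flag t = true) (h2 : e.AllSuff t) :
    (e.st (t + 1)).active = (e.st t).active ∪ e.split t ∧
      (e.st (t + 1)).flagged = (e.st t).flagged.erase (e.ball t) := by
  unfold AllSuff at h2
  unfold split
  rw [log_succ] at h2 ⊢
  have ht := e.length_log t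
  rw [st_succ]
  unfold step
  simp only
  split_ifs with h3 h4 h4
  · rw [ht]
    exact ⟨rfl, rfl⟩
  · exact absurd h2 h4
  · exact absurd h1 h3
  · exact absurd h1 h3

lemma st_succ_of_not_split {t : ℕ} (h1 : e.flag t = true) (h2 : ¬ e.AllSuff t) :
    (e.st (t + 1)).active = (e.st t).active ∧ (e.st (t + 1)).flagged = (e.st t).flagged := by
  unfold AllSuff at h2
  rw [log_succ] at h2
  rw [st_succ]
  unfold step
  simp only
  split_ifs with h3 h4 h4
  · exact absurd h4 h2
  · exact ⟨rfl, rfl⟩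
  · exact absurd h1 h3
  · exact absurd h1 h3

lemma st_succ_of_flag {t : ℕ} (h1 : e.flag t = false)
    (h2 : e.thr (e.ball t) < count (e.st t).log (e.ball t)) :
    (e.st (t + 1)).active = (e.st t).active.erase (e.ball t) ∧
      (e.st (t + 1)).flagged = insert (e.ball t) (e.st t).flagged := by
  have h1' : ¬ e.flag t = true := by simp [h1]
  rw [st_succ]
  unfold step
  simp only
  split_ifs with h3 h4 h4
  · exact absurd h3 h1'
  · exact absurd h3 h1'
  · exact ⟨rfl, rfl⟩
  · exact absurd h2 h4

lemma st_succ_of_not_flag {t : ℕ} (h1 : e.flag t = false)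
    (h2 : ¬ e.thr (e.ball t) < count (e.st t).log (e.ball t)) :
    (e.st (t + 1)).active = (e.st t).active ∧ (e.st (t + 1)).flagged = (e.st t).flagged := by
  have h1' : ¬ e.flag t = true := by simp [h1]
  rw [st_succ]
  unfold step
  simp only
  split_ifs with h3 h4 h4
  · exact absurd h3 h1'
  · exact absurd h3 h1'
  · exact absurd h4 h2
  · exact ⟨rfl, rfl⟩

end Env

/-! ### Selection of balls and arms -/

section Select

variable {K : ℕ} {σ L : ℝ} {T : ℕ} {R : Rules K}

lemma mem_containing {B : Finset (Ball K)} {x : ℝ} {ρ : Ball K} :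
    ρ ∈ containing B x ↔ ρ ∈ B ∧ x ∈ Set.Icc ρ.lo ρ.hi := by
  unfold containing
  rw [Finset.mem_filter]

lemma mem_argmaxSet {β : Type*} [LE β] {B : Finset (Ball K)} {score : Ball K → β} {ρ : Ball K} :
    ρ ∈ argmaxSet B score ↔ ρ ∈ B ∧ ∀ ρ' ∈ B, score ρ' ≤ score ρ := by
  classical
  unfold argmaxSet
  rw [Finset.mem_filter]

lemma argmaxSet_nonempty {β : Type*} [LinearOrder β] {B : Finset (Ball K)} (score : Ball K → β)
    (h : B.Nonempty) : (argmaxSet B score).Nonempty := by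
  obtain ⟨ρ, h1, h2⟩ := Finset.exists_max_image B score h
  exact ⟨ρ, mem_argmaxSet.2 ⟨h1, h2⟩⟩

lemma selectBall_snd (S : State K) (x : ℝ) :
    (selectBall σ L T R S x).2 = true ↔ (containing S.flagged x).Nonempty := by
  unfold selectBall
  simp only
  split_ifs with h <;> simp [h]

lemma selectBall_flagged {S : State K} {x : ℝ} (h : (selectBall σ L T R S x).2 = true) :
    (selectBall σ L T R S x).1 ∈ argmaxSet (containing S.flagged x) Ball.width := by
  have h1 := (selectBall_snd S x).1 h
  unfold selectBall
  simp only [h1, if_true]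
  exact R.pickBall_mem _ _ (argmaxSet_nonempty _ h1)

lemma selectBall_active {S : State K} {x : ℝ} (h : (selectBall σ L T R S x).2 = false)
    (hne : (containing S.active x).Nonempty) :
    (selectBall σ L T R S x).1 ∈ argmaxSet (containing S.active x) (ucb σ L T S.log) := by
  have h1 : ¬ (containing S.flagged x).Nonempty := by
    rw [← selectBall_snd (σ := σ) (L := L) (T := T) (R := R), h]
    simp
  unfold selectBall
  simp only [h1, if_false]
  exact R.pickBall_mem _ _ (argmaxSet_nonempty _ hne)

lemma selectArm_mem {S : State K} {x : ℝ} (h : (selectBall σ L T R S x).1.arms.Nonempty) :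
    selectArm σ L T R S x ∈ (selectBall σ L T R S x).1.arms := by
  classical
  unfold selectArm
  simp only
  split_ifs with h1
  · exact (Finset.mem_filter.1 (Finset.min'_mem _ h1.2)).1
  · exact R.playArm_mem _ _ _ _ h

lemma not_suffData_selectArm {S : State K} {x : ℝ} (h : (selectBall σ L T R S x).2 = true)
    (hne : ∃ a ∈ (selectBall σ L T R S x).1.arms,
      ¬ SuffData σ L T S.log (selectBall σ L T R S x).1 a) :
    ¬ SuffData σ L T S.log (selectBall σ L T R S x).1 (selectArm σ L T R S x) := by
  classical
  obtain ⟨a, ha, ha'⟩ := hne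
  have h1 : ((selectBall σ L T R S x).1.arms.filter fun a =>
      ¬ SuffData σ L T S.log (selectBall σ L T R S x).1 a).Nonempty :=
    ⟨a, Finset.mem_filter.2 ⟨ha, ha'⟩⟩
  unfold selectArm
  simp only
  rw [dif_pos ⟨h, by convert h1⟩]
  have h2 := (Finset.mem_filter.1 (Finset.min'_mem _ h1)).2
  convert h2

end Select

end ApproxZooming

namespace ApproxZooming

/-! ### Invariants of the balls that are present -/

namespace Env

variable {K : ℕ} (e : Env K)

/-- The balls present before trial `t`. -/
def cur (t : ℕ) : Finset (Ball K) := (e.st t).active ∪ (e.st t).flagged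

/-- The ball `ρ` has been present before some trial `s ≤ t`. -/
def Ever (t : ℕ) (ρ : Ball K) : Prop := ∃ s ≤ t, ρ ∈ e.cur s

variable {e} in
lemma Ever.mono {t t' : ℕ} (h : t ≤ t') {ρ : Ball K} (hρ : e.Ever t ρ) : e.Ever t' ρ := by
  obtain ⟨s, hs, h1⟩ := hρ
  exact ⟨s, hs.trans h, h1⟩

lemma ever_of_mem {t : ℕ} {ρ : Ball K} (h : ρ ∈ e.cur t) : e.Ever t ρ := ⟨t, le_rfl, h⟩

lemma ever_succ {t : ℕ} {ρ : Ball K} : e.Ever (t + 1) ρ ↔ e.Ever t ρ ∨ ρ ∈ e.cur (t + 1) := by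
  constructor
  · rintro ⟨s, hs, h1⟩
    rcases Nat.lt_or_ge s (t + 1) with h | h
    · exact Or.inl ⟨s, by omega, h1⟩
    · obtain rfl : s = t + 1 := by omega
      exact Or.inr h1
  · rintro (h | h)
    · exact h.mono (by omega)
    · exact e.ever_of_mem h

/-- The invariants of the state before trial `t`. -/
structure Inv (t : ℕ) : Prop where
  disj : Disjoint (e.st t).active (e.st t).flagged
  cover : ∀ z ∈ Set.Icc (0 : ℝ) 1, ∀ a, ∃ ρ ∈ e.cur t, z ∈ Set.Icc ρ.lo ρ.hi ∧ a ∈ ρ.arms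
  arms : ∀ ρ ∈ e.cur t, ρ.arms.Nonempty
  index : ∀ ρ ∈ e.cur t, ρ.index < 2 ^ ρ.level
  level : ∀ ρ ∈ (e.st t).active, 1 ≤ ρ.level
  -- Among all balls ever present at a point `(z, a)` the current one is deepest and alone at its
  -- level. This is what makes newly created balls new, and makes balls over the same interval with
  -- a common arm coincide.
  newest : ∀ ρ ∈ e.cur t, ∀ ρ', e.Ever t ρ' → ∀ z a, Irrational z → z ∈ Set.Icc ρ.lo ρ.hi →
    z ∈ Set.Icc ρ'.lo ρ'.hi → a ∈ ρ.arms → a ∈ ρ'.arms →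
    ρ'.level ≤ ρ.level ∧ (ρ'.level = ρ.level → ρ' = ρ)

/-- The four possible outcomes of a trial. -/
lemma step_cases (t : ℕ) :
    (e.flag t = true ∧ e.AllSuff t ∧ (e.st (t + 1)).active = (e.st t).active ∪ e.split t ∧
      (e.st (t + 1)).flagged = (e.st t).flagged.erase (e.ball t)) ∨
    (e.flag t = true ∧ ¬ e.AllSuff t ∧ (e.st (t + 1)).active = (e.st t).active ∧
      (e.st (t + 1)).flagged = (e.st t).flagged) ∨
    (e.flag t = false ∧ e.thr (e.ball t) < count (e.st t).log (e.ball t) ∧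
      (e.st (t + 1)).active = (e.st t).active.erase (e.ball t) ∧
      (e.st (t + 1)).flagged = insert (e.ball t) (e.st t).flagged) ∨
    (e.flag t = false ∧ ¬ e.thr (e.ball t) < count (e.st t).log (e.ball t) ∧
      (e.st (t + 1)).active = (e.st t).active ∧ (e.st (t + 1)).flagged = (e.st t).flagged) := by
  by_cases h1 : e.flag t = true
  · by_cases h2 : e.AllSuff t
    · exact Or.inl ⟨h1, h2, e.st_succ_of_split h1 h2⟩
    · exact Or.inr (Or.inl ⟨h1, h2, e.st_succ_of_not_split h1 h2⟩)
  · have h1' : e.flag t = false := by simpa using h1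
    by_cases h2 : e.thr (e.ball t) < count (e.st t).log (e.ball t)
    · exact Or.inr (Or.inr (Or.inl ⟨h1', h2, e.st_succ_of_flag h1' h2⟩))
    · exact Or.inr (Or.inr (Or.inr ⟨h1', h2, e.st_succ_of_not_flag h1' h2⟩))

lemma ball_of_flag {t : ℕ} (h : e.flag t = true) :
    e.ball t ∈ (e.st t).flagged ∧ e.x t ∈ Set.Icc (e.ball t).lo (e.ball t).hi ∧
      ∀ ρ ∈ (e.st t).flagged, e.x t ∈ Set.Icc ρ.lo ρ.hi → ρ.width ≤ (e.ball t).width := by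
  have h1 := selectBall_flagged h
  rw [mem_argmaxSet, mem_containing] at h1
  exact ⟨h1.1.1, h1.1.2, fun ρ hρ hx => h1.2 ρ (mem_containing.2 ⟨hρ, hx⟩)⟩

lemma notMem_of_not_flag {t : ℕ} (h : e.flag t = false) {ρ : Ball K}
    (hρ : ρ ∈ (e.st t).flagged) : e.x t ∉ Set.Icc ρ.lo ρ.hi := by
  intro hx
  have h1 : e.flag t = true := (selectBall_snd _ _).2 ⟨ρ, mem_containing.2 ⟨hρ, hx⟩⟩
  rw [h] at h1
  exact absurd h1 (by simp)

lemma exists_active {t : ℕ} (hinv : e.Inv t) (hx : e.x t ∈ Set.Icc (0 : ℝ) 1)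
    (h : e.flag t = false) (a : Fin K) :
    ∃ ρ ∈ (e.st t).active, e.x t ∈ Set.Icc ρ.lo ρ.hi ∧ a ∈ ρ.arms := by
  obtain ⟨ρ, hρ, h1, h2⟩ := hinv.cover _ hx a
  rcases Finset.mem_union.1 hρ with h3 | h3
  · exact ⟨ρ, h3, h1, h2⟩
  · exact absurd h1 (e.notMem_of_not_flag h h3)

lemma ball_of_not_flag {t : ℕ} (hK : 1 ≤ K) (hinv : e.Inv t) (hx : e.x t ∈ Set.Icc (0 : ℝ) 1)
    (h : e.flag t = false) :
    e.ball t ∈ (e.st t).active ∧ e.x t ∈ Set.Icc (e.ball t).lo (e.ball t).hi ∧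
      ∀ ρ ∈ (e.st t).active, e.x t ∈ Set.Icc ρ.lo ρ.hi →
        ucb e.σ e.L e.T (e.st t).log ρ ≤ ucb e.σ e.L e.T (e.st t).log (e.ball t) := by
  obtain ⟨ρ, hρ, h1, -⟩ := e.exists_active hinv hx h ⟨0, hK⟩
  have h1 := selectBall_active h ⟨ρ, mem_containing.2 ⟨hρ, h1⟩⟩
  rw [mem_argmaxSet, mem_containing] at h1
  exact ⟨h1.1.1, h1.1.2, fun ρ hρ hx => h1.2 ρ (mem_containing.2 ⟨hρ, hx⟩)⟩

lemma ball_mem_cur {t : ℕ} (hK : 1 ≤ K) (hinv : e.Inv t) (hx : e.x t ∈ Set.Icc (0 : ℝ) 1) :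
    e.ball t ∈ e.cur t ∧ e.x t ∈ Set.Icc (e.ball t).lo (e.ball t).hi := by
  by_cases h : e.flag t = true
  · have := e.ball_of_flag h
    exact ⟨Finset.mem_union_right _ this.1, this.2.1⟩
  · have := e.ball_of_not_flag hK hinv hx (by simpa using h)
    exact ⟨Finset.mem_union_left _ this.1, this.2.1⟩

lemma arm_mem {t : ℕ} (hK : 1 ≤ K) (hinv : e.Inv t) (hx : e.x t ∈ Set.Icc (0 : ℝ) 1) :
    e.arm t ∈ (e.ball t).arms :=
  selectArm_mem (hinv.arms _ (e.ball_mem_cur hK hinv hx).1)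

/-- A ball created in trial `t` has not been present before. -/
lemma not_ever_of_mem_split {t : ℕ} (hinv : e.Inv t) (h : e.flag t = true) {c : Ball K}
    (hc : c ∈ e.split t) {ρ : Ball K} (hρ : e.Ever t ρ) {z : ℝ} {a : Fin K} (hz : Irrational z)
    (h1 : z ∈ Set.Icc c.lo c.hi) (h2 : z ∈ Set.Icc ρ.lo ρ.hi) (h3 : a ∈ c.arms)
    (h4 : a ∈ ρ.arms) : ρ.level < c.level := by
  obtain ⟨ℓ, A, rfl, hA, -, -⟩ := (e.isSplit_split t).mem c hc
  have h5 := (hinv.newest (e.ball t) (Finset.mem_union_right _ (e.ball_of_flag h).1) ρ hρ z a hz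
    (Ball.mem_of_mem_child h1) h2 (hA h3) h4).1
  simp only [Ball.child]
  omega

lemma inv_zero (hK : 1 ≤ K) : e.Inv 0 := by
  have hcur : e.cur 0 = {Ball.root K} := by
    unfold cur
    rw [st_zero]
    simp
  have hever : ∀ ρ, e.Ever 0 ρ → ρ = Ball.root K := by
    rintro ρ ⟨s, hs, h⟩
    obtain rfl : s = 0 := by omega
    rw [hcur] at h
    simpa using h
  constructor
  · rw [st_zero]; simp
  · intro z hz a
    refine ⟨Ball.root K, by simp [hcur], ?_, by simp [Ball.root]⟩
    simpa [Ball.root, Ball.lo, Ball.hi] using hz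
  · intro ρ hρ
    rw [hcur, Finset.mem_singleton] at hρ
    subst hρ
    exact ⟨⟨0, hK⟩, by simp [Ball.root]⟩
  · intro ρ hρ
    rw [hcur, Finset.mem_singleton] at hρ
    subst hρ
    simp [Ball.root]
  · rw [st_zero]; simp
  · intro ρ hρ ρ' hρ' z a _ _ _ _ _
    rw [hcur, Finset.mem_singleton] at hρ
    rw [hever ρ' hρ', hρ]
    simp

lemma Inv.of_cur_eq {t : ℕ} (hinv : e.Inv t) (hcur : e.cur (t + 1) = e.cur t)
    (hact : (e.st (t + 1)).active ⊆ (e.st t).active)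
    (hdisj : Disjoint (e.st (t + 1)).active (e.st (t + 1)).flagged) : e.Inv (t + 1) := by
  have hever : ∀ ρ, e.Ever (t + 1) ρ → e.Ever t ρ := by
    intro ρ hρ
    rcases e.ever_succ.1 hρ with h | h
    · exact h
    · rw [hcur] at h
      exact e.ever_of_mem h
  refine ⟨hdisj, ?_, ?_, ?_, fun ρ hρ => hinv.level ρ (hact hρ), ?_⟩
  · rw [hcur]; exact hinv.cover
  · rw [hcur]; exact hinv.arms
  · rw [hcur]; exact hinv.index
  · rw [hcur]
    exact fun ρ hρ ρ' hρ' => hinv.newest ρ hρ ρ' (hever ρ' hρ')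

lemma inv_succ {t : ℕ} (hK : 1 ≤ K) (hx : e.x t ∈ Set.Icc (0 : ℝ) 1) (hinv : e.Inv t) :
    e.Inv (t + 1) := by
  rcases e.step_cases t with ⟨hf, -, ha, hfl⟩ | ⟨-, -, ha, hfl⟩ | ⟨hf, -, ha, hfl⟩ |
    ⟨-, -, ha, hfl⟩
  · have hsp := e.isSplit_split t
    have hbf := (e.ball_of_flag hf).1
    have hbc : e.ball t ∈ e.cur t := Finset.mem_union_right _ hbf
    have hcur : ∀ ρ, ρ ∈ e.cur (t + 1) ↔ (ρ ∈ e.cur t ∧ ρ ≠ e.ball t) ∨ ρ ∈ e.split t := by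
      intro ρ
      unfold cur
      rw [ha, hfl]
      have h1 : e.ball t ∉ (e.st t).active := fun h =>
        Finset.disjoint_left.1 hinv.disj h hbf
      simp only [Finset.mem_union, Finset.mem_erase]
      constructor
      · rintro ((h | h) | h)
        · exact Or.inl ⟨Or.inl h, fun h' => h1 (h' ▸ h)⟩
        · exact Or.inr h
        · exact Or.inl ⟨Or.inr h.2, h.1⟩
      · rintro (⟨h | h, h'⟩ | h)
        · exact Or.inl (Or.inl h)
        · exact Or.inr ⟨h', h⟩
        · exact Or.inl (Or.inr h)
    -- A child present earlier could be compared with itself and would be strictly deeper than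
    -- itself.
    have hnew : ∀ c ∈ e.split t, ¬ e.Ever t c := by
      intro c hc hec
      obtain ⟨z, hz, hzc⟩ := c.exists_irrational_mem
      obtain ⟨ℓ, A, hcA, -, ⟨a, haA⟩, -⟩ := hsp.mem c hc
      have hac : a ∈ c.arms := by rw [hcA]; exact haA
      exact lt_irrefl _ (e.not_ever_of_mem_split hinv hf hc hec hz hzc hzc hac hac)
    constructor
    · rw [ha, hfl, Finset.disjoint_left]
      intro ρ hρ hρ'
      rw [Finset.mem_erase] at hρ'
      rcases Finset.mem_union.1 hρ with h | h
      · exact Finset.disjoint_left.1 hinv.disj h hρ'.2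
      · exact hnew ρ h (e.ever_of_mem (Finset.mem_union_right _ hρ'.2))
    · intro z hz a
      obtain ⟨ρ, hρ, hzρ, haρ⟩ := hinv.cover z hz a
      by_cases h : ρ = e.ball t
      · subst h
        obtain ⟨ℓ, hℓ⟩ := Ball.exists_mem_child hzρ
        obtain ⟨A, hA, haA⟩ := hsp.cover ℓ a haρ
        exact ⟨_, (hcur _).2 (Or.inr hA), hℓ A, haA⟩
      · exact ⟨ρ, (hcur _).2 (Or.inl ⟨hρ, h⟩), hzρ, haρ⟩
    · intro ρ hρ
      rcases (hcur ρ).1 hρ with h | h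
      · exact hinv.arms ρ h.1
      · obtain ⟨ℓ, A, rfl, -, hA, -⟩ := hsp.mem ρ h
        exact hA
    · intro ρ hρ
      rcases (hcur ρ).1 hρ with h | h
      · exact hinv.index ρ h.1
      · obtain ⟨ℓ, A, rfl, -, -, -⟩ := hsp.mem ρ h
        have h1 := hinv.index _ hbc
        simp only [Ball.child]
        rw [pow_succ]
        omega
    · intro ρ hρ
      rw [ha] at hρ
      rcases Finset.mem_union.1 hρ with h | h
      · exact hinv.level ρ h
      · obtain ⟨ℓ, A, rfl, -, -, -⟩ := hsp.mem ρ h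
        simp [Ball.child]
    · intro ρ hρ ρ' hρ' z a hz hzρ hzρ' haρ haρ'
      rcases (hcur ρ).1 hρ with h | h
      · rcases e.ever_succ.1 hρ' with h' | h'
        · exact hinv.newest ρ h.1 ρ' h' z a hz hzρ hzρ' haρ haρ'
        rcases (hcur ρ').1 h' with h'' | h''
        · exact hinv.newest ρ h.1 ρ' (e.ever_of_mem h''.1) z a hz hzρ hzρ' haρ haρ'
        -- A surviving ball `ρ` at a point of a new child shares that point with the split ball. The
        -- invariant used in both directions identifies the two, but the split ball has been
        -- removed.
        · exfalso
          obtain ⟨ℓ, A, rfl, hA, -, -⟩ := hsp.mem ρ' h''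
          have hzb := Ball.mem_of_mem_child hzρ'
          have h1 := hinv.newest ρ h.1 _ (e.ever_of_mem hbc) z a hz hzρ hzb haρ (hA haρ')
          have h2 := hinv.newest _ hbc ρ (e.ever_of_mem h.1) z a hz hzb hzρ (hA haρ') haρ
          exact h.2 (h2.2 (le_antisymm h2.1 h1.1))
      · have key : ∀ ρ'', e.Ever t ρ'' → z ∈ Set.Icc ρ''.lo ρ''.hi → a ∈ ρ''.arms →
            ρ''.level ≤ ρ.level ∧ (ρ''.level = ρ.level → ρ'' = ρ) := by
          intro ρ'' h'' hz'' ha''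
          have := e.not_ever_of_mem_split hinv hf h h'' hz hzρ hz'' haρ ha''
          exact ⟨this.le, fun h => absurd h this.ne⟩
        rcases e.ever_succ.1 hρ' with h' | h'
        · exact key ρ' h' hzρ' haρ'
        rcases (hcur ρ').1 h' with h'' | h''
        · exact key ρ' (e.ever_of_mem h''.1) hzρ' haρ'
        · have hl : ρ'.level = ρ.level := by
            obtain ⟨ℓ, A, rfl, -⟩ := hsp.mem ρ h
            obtain ⟨ℓ', A', rfl, -⟩ := hsp.mem ρ' h''
            rfl
          have := hsp.unique ρ' h'' ρ h a (Ball.index_eq_of_mem hz hzρ' hzρ hl) haρ' haρ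
          exact ⟨hl.le, fun _ => this⟩
  · apply hinv.of_cur_eq
    · unfold cur; rw [ha, hfl]
    · rw [ha]
    · rw [ha, hfl]; exact hinv.disj
  · have hb := (e.ball_of_not_flag hK hinv hx hf).1
    apply hinv.of_cur_eq
    · unfold cur
      rw [ha, hfl, Finset.union_insert, ← Finset.insert_union, Finset.insert_erase hb]
    · rw [ha]; exact Finset.erase_subset _ _
    · rw [ha, hfl, Finset.disjoint_left]
      intro ρ hρ hρ'
      rw [Finset.mem_erase] at hρ
      rcases Finset.mem_insert.1 hρ' with h | h
      · exact hρ.1 h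
      · exact Finset.disjoint_left.1 hinv.disj hρ.2 h
  · apply hinv.of_cur_eq
    · unfold cur; rw [ha, hfl]
    · rw [ha]
    · rw [ha, hfl]; exact hinv.disj

lemma inv (hK : 1 ≤ K) (hx : ∀ t, e.x t ∈ Set.Icc (0 : ℝ) 1) (t : ℕ) : e.Inv t := by
  induction t with
  | zero => exact e.inv_zero hK
  | succ t ih => exact e.inv_succ hK (hx t) ih

end Env

end ApproxZooming

namespace ApproxZooming

/-! ### Lifetimes of balls and deterministic play counts -/

namespace Env

variable {K : ℕ} (e : Env K)

/-- Apply `newest` at the later of the two times, at an irrational point of the common interval.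
Hence balls over one dyadic interval, at whatever times they live, have disjoint arm sets. -/
lemma eq_of_ever (hK : 1 ≤ K) (hx : ∀ t, e.x t ∈ Set.Icc (0 : ℝ) 1) {t t' : ℕ} {ρ ρ' : Ball K}
    (hρ : e.Ever t ρ) (hρ' : e.Ever t' ρ') (hl : ρ.level = ρ'.level) (hi : ρ.index = ρ'.index)
    {a : Fin K} (ha : a ∈ ρ.arms) (ha' : a ∈ ρ'.arms) : ρ = ρ' := by
  obtain ⟨s, -, hs⟩ := hρ
  obtain ⟨s', -, hs'⟩ := hρ'
  obtain ⟨z, hz, hzρ⟩ := ρ.exists_irrational_mem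
  have hzρ' := (Ball.mem_iff_of_level_index hl hi z).1 hzρ
  rcases le_total s s' with h | h
  · exact ((e.inv hK hx s').newest ρ' hs' ρ ⟨s, h, hs⟩ z a hz hzρ' hzρ ha' ha).2 hl
  · exact (((e.inv hK hx s).newest ρ hs ρ' ⟨s', h, hs'⟩ z a hz hzρ hzρ' ha ha').2 hl.symm).symm

lemma ball_ever (hK : 1 ≤ K) (hx : ∀ t, e.x t ∈ Set.Icc (0 : ℝ) 1) (t : ℕ) :
    e.Ever t (e.ball t) :=
  e.ever_of_mem (e.ball_mem_cur hK (e.inv hK hx t) (hx t)).1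

lemma not_ever_split (hK : 1 ≤ K) (hx : ∀ t, e.x t ∈ Set.Icc (0 : ℝ) 1) {t : ℕ}
    (h : e.flag t = true) {c : Ball K} (hc : c ∈ e.split t) : ¬ e.Ever t c := by
  intro hec
  obtain ⟨z, hz, hzc⟩ := c.exists_irrational_mem
  obtain ⟨ℓ, A, hcA, -, ⟨a, haA⟩, -⟩ := (e.isSplit_split t).mem c hc
  have hac : a ∈ c.arms := by rw [hcA]; exact haA
  exact lt_irrefl _ (e.not_ever_of_mem_split (e.inv hK hx t) h hc hec hz hzc hzc hac hac)

/-- Only newly created balls enter the active set; a ball that has left it never returns. -/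
lemma active_of_active_succ (hK : 1 ≤ K) (hx : ∀ t, e.x t ∈ Set.Icc (0 : ℝ) 1) {t : ℕ}
    {ρ : Ball K} (h : ρ ∈ (e.st (t + 1)).active) : ρ ∈ (e.st t).active ∨ ¬ e.Ever t ρ := by
  rcases e.step_cases t with ⟨hf, -, ha, -⟩ | ⟨-, -, ha, -⟩ | ⟨-, -, ha, -⟩ | ⟨-, -, ha, -⟩ <;>
    rw [ha] at h
  · rcases Finset.mem_union.1 h with h | h
    · exact Or.inl h
    · exact Or.inr (e.not_ever_split hK hx hf h)
  · exact Or.inl h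
  · exact Or.inl (Finset.mem_of_mem_erase h)
  · exact Or.inl h

lemma notMem_active_of_le (hK : 1 ≤ K) (hx : ∀ t, e.x t ∈ Set.Icc (0 : ℝ) 1) {t t' : ℕ}
    (htt : t ≤ t') {ρ : Ball K} (hρ : e.Ever t ρ) (h : ρ ∉ (e.st t).active) :
    ρ ∉ (e.st t').active := by
  induction t', htt using Nat.le_induction with
  | base => exact h
  | succ t' htt ih =>
    intro h'
    rcases e.active_of_active_succ hK hx h' with h1 | h1
    · exact ih h1
    · exact h1 (hρ.mono htt)

/-- Samples are collected in the flagged phase only, and a ball that has been flagged is never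
active afterwards. -/
lemma sampleSet_eq_empty (hK : 1 ≤ K) (hx : ∀ t, e.x t ∈ Set.Icc (0 : ℝ) 1) {t : ℕ} {ρ : Ball K}
    (h : ρ ∈ (e.st t).active ∨ ¬ e.Ever t ρ) (a : Fin K) : e.sampleSet t ρ a = ∅ := by
  rw [Finset.eq_empty_iff_forall_notMem]
  intro s hs
  simp only [sampleSet, Finset.mem_filter, Finset.mem_range] at hs
  obtain ⟨hst, hb, -, hf⟩ := hs
  have h1 := e.ball_ever hK hx s
  have h2 := (e.ball_of_flag hf).1
  rw [hb] at h1 h2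
  have h3 : ρ ∉ (e.st s).active := fun h3 =>
    Finset.disjoint_left.1 (e.inv hK hx s).disj h3 h2
  rcases h with h | h
  · exact e.notMem_active_of_le hK hx hst.le h1 h3 h
  · exact h (h1.mono hst.le)

lemma sampleSet_succ_of_ne {t : ℕ} {ρ : Ball K} (h : e.ball t ≠ ρ) (a : Fin K) :
    e.sampleSet (t + 1) ρ a = e.sampleSet t ρ a := by
  unfold sampleSet
  rw [Finset.range_add_one, Finset.filter_insert, if_neg]
  exact fun h' => h h'.1

/-- A flagged ball has an arm with insufficient data. -/
lemma exists_not_suffData (hK : 1 ≤ K) (hx : ∀ t, e.x t ∈ Set.Icc (0 : ℝ) 1)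
    (hk : ∀ ρ : Ball K, ρ.arms.Nonempty → 1 ≤ numNeighbors e.σ e.L e.T ρ) (t : ℕ) :
    ∀ ρ ∈ (e.st t).flagged, ∃ a ∈ ρ.arms, ¬ SuffData e.σ e.L e.T (e.st t).log ρ a := by
  have hempty : ∀ t (ρ : Ball K), ρ.arms.Nonempty → (∀ a, e.sampleSet t ρ a = ∅) →
      ∃ a ∈ ρ.arms, ¬ SuffData e.σ e.L e.T (e.st t).log ρ a := by
    intro t ρ hne hemp
    obtain ⟨a, ha⟩ := hne
    refine ⟨a, ha, ?_⟩
    rw [suffData_iff]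
    intro h
    have h1 := h 0
    -- With zero neighbours required, an empty sample would count as sufficient; `1 ≤ k` excludes
    -- this.
    have h2 := hk ρ ⟨a, ha⟩
    unfold subCount at h1
    rw [hemp] at h1
    simp at h1
    omega
  have hmono : ∀ t (ρ : Ball K), e.ball t ≠ ρ →
      (∃ a ∈ ρ.arms, ¬ SuffData e.σ e.L e.T (e.st t).log ρ a) →
      ∃ a ∈ ρ.arms, ¬ SuffData e.σ e.L e.T (e.st (t + 1)).log ρ a := by
    rintro t ρ hne ⟨a, ha, h⟩
    refine ⟨a, ha, ?_⟩
    rw [suffData_iff] at h ⊢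
    unfold subCount at h ⊢
    rwa [e.sampleSet_succ_of_ne hne]
  induction t with
  | zero =>
    intro ρ hρ
    refine hempty 0 ρ ((e.inv hK hx 0).arms ρ (Finset.mem_union_right _ hρ)) ?_
    intro a
    simp [sampleSet]
  | succ t ih =>
    intro ρ hρ
    have hi := e.inv hK hx t
    rcases e.step_cases t with ⟨hf, hs, ha, hfl⟩ | ⟨hf, hs, ha, hfl⟩ | ⟨hf, -, ha, hfl⟩ |
      ⟨hf, -, ha, hfl⟩ <;> rw [hfl] at hρ
    · rw [Finset.mem_erase] at hρ
      exact hmono t ρ (Ne.symm hρ.1) (ih ρ hρ.2)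
    · by_cases h : e.ball t = ρ
      · subst h
        unfold AllSuff at hs
        push Not at hs
        exact hs
      · exact hmono t ρ h (ih ρ hρ)
    · by_cases h : e.ball t = ρ
      · subst h
        have hb := (e.ball_of_not_flag hK hi (hx t) hf).1
        apply hempty _ _ (hi.arms _ (Finset.mem_union_left _ hb))
        intro a
        have h1 := e.sampleSet_eq_empty hK hx (Or.inl hb) a
        unfold sampleSet at h1 ⊢
        rw [Finset.range_add_one, Finset.filter_insert, if_neg (by simp [hf])]
        exact h1
      · have hρ' : ρ ∈ (e.st t).flagged := by
          rcases Finset.mem_insert.1 hρ with h' | h'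
          · exact absurd h'.symm h
          · exact h'
        exact hmono t ρ h (ih ρ hρ')
    · by_cases h : e.ball t = ρ
      · subst h
        have hb := (e.ball_of_not_flag hK hi (hx t) hf).1
        exact absurd hρ (Finset.disjoint_left.1 hi.disj hb)
      · exact hmono t ρ h (ih ρ hρ)

lemma thr_nonneg (ρ : Ball K) (hT : 1 ≤ e.T) : 0 ≤ e.thr ρ := by
  unfold thr
  have : 0 ≤ Real.log e.T := Real.log_nonneg (by exact_mod_cast hT)
  positivity

/-- A ball is chosen at most `thr ρ + 2` times while it is active. -/
lemma card_unflagged_le (hK : 1 ≤ K) (hx : ∀ t, e.x t ∈ Set.Icc (0 : ℝ) 1) (hT : 1 ≤ e.T)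
    (ρ : Ball K) (t : ℕ) :
    (((Finset.range t).filter fun s => e.ball s = ρ ∧ e.flag s = false).card : ℝ) ≤
      e.thr ρ + 2 := by
  set U : ℕ → Finset ℕ := fun t =>
    (Finset.range t).filter fun s => e.ball s = ρ ∧ e.flag s = false with hU
  have hthr := e.thr_nonneg ρ hT
  have hUsucc : ∀ t, U (t + 1) = if e.ball t = ρ ∧ e.flag t = false then insert t (U t) else U t :=
    fun t => by simp only [hU]; rw [Finset.range_add_one, Finset.filter_insert]
  have hUc : ∀ t, (U t).card ≤ count (e.st t).log ρ := by
    intro t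
    rw [count_log]
    apply Finset.card_le_card
    intro s hs
    simp only [hU, Finset.mem_filter] at hs ⊢
    exact ⟨hs.1, hs.2.1⟩
  -- The threshold is compared with the count before the trial. So a ball that stays active has been
  -- played at most `thr ρ + 1` times, and the play that flags it adds one.
  have hmain : ((U t).card : ℝ) ≤ e.thr ρ + 2 ∧
      (ρ ∈ (e.st t).active → ((U t).card : ℝ) ≤ e.thr ρ + 1) := by
    induction t with
    | zero =>
      have : U 0 = ∅ := by simp [hU]
      rw [this]
      simp
      constructor
      · linarith
      · intro _; linarith
    | succ t ih =>
      have hi := e.inv hK hx t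
      by_cases h : e.ball t = ρ ∧ e.flag t = false
      · rw [hUsucc, if_pos h, Finset.card_insert_of_notMem (by simp [hU])]
        have hb := (e.ball_of_not_flag hK hi (hx t) h.2).1
        rw [h.1] at hb
        have h1 := ih.2 hb
        push_cast
        refine ⟨by linarith, fun hact => ?_⟩
        rcases e.step_cases t with ⟨hf, -⟩ | ⟨hf, -⟩ | ⟨-, -, ha, -⟩ | ⟨-, hc, -, -⟩
        · rw [h.2] at hf; exact absurd hf (by simp)
        · rw [h.2] at hf; exact absurd hf (by simp)
        · rw [ha, h.1] at hact
          simp at hact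
        · rw [h.1, not_lt] at hc
          have : ((U t).card : ℝ) ≤ count (e.st t).log ρ := by exact_mod_cast hUc t
          linarith
      · rw [hUsucc, if_neg h]
        refine ⟨ih.1, fun hact => ?_⟩
        rcases e.active_of_active_succ hK hx hact with h1 | h1
        · exact ih.2 h1
        · have : U t = ∅ := by
            rw [Finset.eq_empty_iff_forall_notMem]
            intro s hs
            simp only [hU, Finset.mem_filter, Finset.mem_range] at hs
            apply h1
            rw [← hs.2.1]
            exact (e.ball_ever hK hx s).mono hs.1.le
          rw [this]
          simp
          linarith
  exact hmain.1

/-- The ball chosen in trial `s` lies over the dyadic interval with level `i` and index `j`. -/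
def Over (i j s : ℕ) : Prop := (e.ball s).level = i ∧ (e.ball s).index = j

instance (i j : ℕ) : DecidablePred (e.Over i j) := fun s =>
  inferInstanceAs (Decidable ((e.ball s).level = i ∧ (e.ball s).index = j))

/-- Charge each ball over the interval to its least arm: disjointness of arm sets makes the charge
injective, so there are at most `K` balls. The factor `4 ^ i` is `1 / Δ²`. -/
lemma card_unflagged_over_le (hK : 1 ≤ K) (hx : ∀ t, e.x t ∈ Set.Icc (0 : ℝ) 1) (hT : 1 ≤ e.T)
    (i j t : ℕ) :
    (((Finset.range t).filter fun s => e.Over i j s ∧ e.flag s = false).card : ℝ) ≤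
      K * (6 * e.σ ^ 2 * Real.log e.T * 4 ^ i / e.L ^ 2 + 2) := by
  classical
  have hne : ∀ s, (e.ball s).arms.Nonempty := fun s =>
    (e.inv hK hx s).arms _ (e.ball_mem_cur hK (e.inv hK hx s) (hx s)).1
  set m : ℕ → Fin K := fun s => (e.ball s).arms.min' (hne s) with hm
  set A := (Finset.range t).filter fun s => e.Over i j s ∧ e.flag s = false with hA
  have h1 : A.card = ∑ a : Fin K, (A.filter fun s => m s = a).card :=
    Finset.card_eq_sum_card_fiberwise (fun s _ => Finset.mem_univ (m s))
  have hlog : 0 ≤ Real.log e.T := Real.log_nonneg (by exact_mod_cast hT)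
  have h2 : ∀ a : Fin K, ((A.filter fun s => m s = a).card : ℝ) ≤
      6 * e.σ ^ 2 * Real.log e.T * 4 ^ i / e.L ^ 2 + 2 := by
    intro a
    rcases (A.filter fun s => m s = a).eq_empty_or_nonempty with h | ⟨s₀, hs₀⟩
    · rw [h]
      simp
      positivity
    · simp only [hA, Finset.mem_filter] at hs₀
      obtain ⟨⟨-, ⟨hl, hj⟩, -⟩, hms₀⟩ := hs₀
      have h3 := e.card_unflagged_le hK hx hT (e.ball s₀) t
      have h4 : e.thr (e.ball s₀) = 6 * e.σ ^ 2 * Real.log e.T * 4 ^ i / e.L ^ 2 := by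
        unfold thr
        rw [Ball.width_eq, hl]
        have : (4 : ℝ) ^ i = 2 ^ i * 2 ^ i := by rw [← mul_pow]; norm_num
        rw [this]
        field_simp
      rw [h4] at h3
      refine le_trans ?_ h3
      norm_cast
      apply Finset.card_le_card
      intro s hs
      simp only [hA, Finset.mem_filter] at hs ⊢
      obtain ⟨⟨hst, ⟨hl', hj'⟩, hf⟩, hms⟩ := hs
      refine ⟨hst, ?_, hf⟩
      refine e.eq_of_ever hK hx (e.ball_ever hK hx s) (e.ball_ever hK hx s₀) (hl'.trans hl.symm)
        (hj'.trans hj.symm) (a := a) ?_ ?_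
      · rw [← hms]; exact Finset.min'_mem _ _
      · rw [← hms₀]; exact Finset.min'_mem _ _
  rw [h1]
  push_cast
  calc ∑ a : Fin K, ((A.filter fun s => m s = a).card : ℝ)
      ≤ ∑ _a : Fin K, (6 * e.σ ^ 2 * Real.log e.T * 4 ^ i / e.L ^ 2 + 2) :=
        Finset.sum_le_sum fun a _ => h2 a
    _ = _ := by rw [Finset.sum_const, Finset.card_univ, Fintype.card_fin, nsmul_eq_mul]

/-- In trial `s` a flagged ball over the given dyadic interval is chosen, the context lies in its
`q`-th subinterval, and this subinterval had less than the required number of samples. -/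
def Useful (i j : ℕ) (q : Fin 64) (s : ℕ) : Prop :=
  e.Over i j s ∧ e.flag s = true ∧ e.x s ∈ sub (e.ball s) q ∧
    e.subCount s (e.ball s) (e.arm s) q < numNeighbors e.σ e.L e.T (e.ball s)

-- For a fixed arm all these trials use one and the same ball, and each adds a sample to a
-- subinterval that holds fewer than `k`. So there are at most `k` of them per arm.
open scoped Classical in
lemma card_useful_le (hK : 1 ≤ K) (hx : ∀ t, e.x t ∈ Set.Icc (0 : ℝ) 1) {i j : ℕ} (q : Fin 64)
    {k : ℕ} (hk : ∀ ρ : Ball K, ρ.level = i → numNeighbors e.σ e.L e.T ρ ≤ k) (t : ℕ) :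
    ((Finset.range t).filter fun s => e.Useful i j q s).card ≤ K * k := by
  set A := (Finset.range t).filter fun s => e.Useful i j q s with hA
  have h1 : A.card = ∑ a : Fin K, (A.filter fun s => e.arm s = a).card :=
    Finset.card_eq_sum_card_fiberwise (fun s _ => Finset.mem_univ (e.arm s))
  have h2 : ∀ a : Fin K, (A.filter fun s => e.arm s = a).card ≤ k := by
    intro a
    rcases (A.filter fun s => e.arm s = a).eq_empty_or_nonempty with h | ⟨s₀, hs₀⟩
    · rw [h]; simp
    · simp only [hA, Finset.mem_filter] at hs₀
      obtain ⟨⟨-, ⟨hl, hj⟩, -⟩, hms₀⟩ := hs₀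
      refine le_trans ?_ (card_filter_lt_le (fun s => (e.ball s = e.ball s₀ ∧ e.arm s = a ∧
        e.flag s = true) ∧ e.x s ∈ sub (e.ball s₀) q) k t)
      apply Finset.card_le_card
      intro s hs
      simp only [hA, Finset.mem_filter] at hs ⊢
      obtain ⟨⟨hst, ⟨hl', hj'⟩, hf, hxs, hc⟩, hms⟩ := hs
      have hb : e.ball s = e.ball s₀ := by
        refine e.eq_of_ever hK hx (e.ball_ever hK hx s) (e.ball_ever hK hx s₀) (hl'.trans hl.symm)
          (hj'.trans hj.symm) (a := a) ?_ ?_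
        · rw [← hms]; exact e.arm_mem hK (e.inv hK hx s) (hx s)
        · rw [← hms₀]; exact e.arm_mem hK (e.inv hK hx s₀) (hx s₀)
      refine ⟨hst, ⟨⟨hb, hms, hf⟩, hb ▸ hxs⟩, ?_⟩
      refine lt_of_lt_of_le ?_ (hk _ hl')
      refine lt_of_le_of_lt (le_of_eq ?_) hc
      unfold subCount sampleSet
      rw [Finset.filter_filter, hb, hms]
  rw [h1]
  calc ∑ a : Fin K, (A.filter fun s => e.arm s = a).card
      ≤ ∑ _a : Fin K, k := Finset.sum_le_sum fun a _ => h2 a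
    _ = _ := by simp

lemma one_le_numNeighbors (hσ : 0 < e.σ) (hL : 0 < e.L) (hT : 2 ≤ e.T) {ρ : Ball K}
    (hρ : ρ.arms.Nonempty) : 1 ≤ numNeighbors e.σ e.L e.T ρ := by
  unfold numNeighbors
  rw [Nat.one_le_ceil_iff]
  have h1 : 1 ≤ ρ.arms.card := Finset.card_pos.2 hρ
  have h2 : (1 : ℝ) < e.T * ρ.arms.card := by
    have : 1 < e.T * ρ.arms.card := by nlinarith
    exact_mod_cast this
  have := Real.log_pos h2
  have := ρ.width_pos
  positivity

lemma le_numNeighbors (hT : 1 ≤ e.T) {ρ : Ball K} (hρ : ρ.arms.Nonempty) :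
    5431 * e.σ ^ 2 * Real.log e.T / (e.L ^ 2 * ρ.width ^ 2) ≤ numNeighbors e.σ e.L e.T ρ := by
  unfold numNeighbors
  refine le_trans ?_ (Nat.le_ceil _)
  have h1 : (1 : ℝ) ≤ ρ.arms.card := by exact_mod_cast Finset.card_pos.2 hρ
  have h0 : (1 : ℝ) ≤ e.T := by exact_mod_cast hT
  gcongr
  nlinarith

lemma numNeighbors_le (hK : 1 ≤ K) (hT : 1 ≤ e.T) (ρ : Ball K) :
    numNeighbors e.σ e.L e.T ρ ≤
      ⌈5431 * e.σ ^ 2 * Real.log (e.T * K) * 4 ^ ρ.level / e.L ^ 2⌉₊ := by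
  unfold numNeighbors
  apply Nat.ceil_mono
  rw [Ball.width_eq]
  have h4 : (4 : ℝ) ^ ρ.level = 2 ^ ρ.level * 2 ^ ρ.level := by rw [← mul_pow]; norm_num
  rw [h4]
  have h5 : 5431 * e.σ ^ 2 * Real.log (e.T * ρ.arms.card) / (e.L ^ 2 * (1 / 2 ^ ρ.level) ^ 2) =
      5431 * e.σ ^ 2 * Real.log (e.T * ρ.arms.card) * (2 ^ ρ.level * 2 ^ ρ.level) / e.L ^ 2 := by
    field_simp
  rw [h5]
  have h6 : Real.log (e.T * ρ.arms.card) ≤ Real.log (e.T * K) := by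
    have h0 : (1 : ℝ) ≤ e.T := by exact_mod_cast hT
    have hK' : (1 : ℝ) ≤ K := by exact_mod_cast hK
    rcases Nat.eq_zero_or_pos ρ.arms.card with h | h
    · rw [h]
      simp
      exact Real.log_nonneg (by nlinarith)
    · have h1 : (1 : ℝ) ≤ ρ.arms.card := by exact_mod_cast h
      have h2 : (ρ.arms.card : ℝ) ≤ K := by
        have := Finset.card_le_univ ρ.arms
        rw [Fintype.card_fin] at this
        exact_mod_cast this
      apply Real.log_le_log (by nlinarith)
      gcongr
  gcongr

end Env

end ApproxZooming

namespace ApproxZooming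

/-! ### The ball selected by the flagged rule is constant on its interval -/

namespace Ball

variable {K : ℕ}

lemma mem_iff_index_eq_floor {ρ : Ball K} {z : ℝ} (hz : Irrational z) :
    z ∈ Set.Icc ρ.lo ρ.hi ↔ (ρ.index : ℤ) = ⌊z * 2 ^ ρ.level⌋ := by
  refine ⟨index_eq_floor hz, fun h => ?_⟩
  have hpos : (0 : ℝ) < 2 ^ ρ.level := by positivity
  have h1 := Int.floor_le (z * 2 ^ ρ.level)
  have h2 := Int.lt_floor_add_one (z * 2 ^ ρ.level)
  rw [← h] at h1 h2
  push_cast at h1 h2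
  unfold lo hi
  constructor
  · rwa [div_le_iff₀ hpos]
  · rw [le_div_iff₀ hpos]
    exact h2.le

/-- Dyadic nesting: the index at a coarser level is the integer quotient, by a power of two, of the
index at the finer level. -/
lemma mem_iff_of_level_le {ρ ρ' : Ball K} {z z' : ℝ} (hz : Irrational z) (hz' : Irrational z')
    (h : z ∈ Set.Icc ρ.lo ρ.hi) (h' : z' ∈ Set.Icc ρ.lo ρ.hi) (hl : ρ'.level ≤ ρ.level) :
    z ∈ Set.Icc ρ'.lo ρ'.hi ↔ z' ∈ Set.Icc ρ'.lo ρ'.hi := by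
  rw [mem_iff_index_eq_floor hz, mem_iff_index_eq_floor hz']
  rw [mem_iff_index_eq_floor hz] at h
  rw [mem_iff_index_eq_floor hz'] at h'
  have key : ∀ y : ℝ, ⌊y * 2 ^ ρ'.level⌋ = ⌊y * 2 ^ ρ.level⌋ / ((2 ^ (ρ.level - ρ'.level) : ℕ) : ℤ) := by
    intro y
    rw [← Int.floor_div_natCast]
    congr 1
    have : (2 : ℝ) ^ ρ.level = 2 ^ ρ'.level * 2 ^ (ρ.level - ρ'.level) := by
      rw [← pow_add]; congr 1; omega
    rw [this]
    push_cast
    field_simp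
  rw [key z, key z', ← h, ← h']

lemma width_le_iff {ρ ρ' : Ball K} : ρ.width ≤ ρ'.width ↔ ρ'.level ≤ ρ.level := by
  rw [width_eq, width_eq, one_div_le_one_div (by positivity) (by positivity)]
  exact pow_le_pow_iff_right₀ one_lt_two

end Ball

section Select

variable {K : ℕ} {σ L : ℝ} {T : ℕ} {R : Rules K}

/-- Flagged balls at least as wide as the selected one contain both points or neither, and narrower
ones lose at both points. Preferring the widest ball thus makes the choice independent of the
position of the context in the interval. -/
lemma selectBall_eq_of_flagged {S : State K} {z z' : ℝ} (hz : Irrational z) (hz' : Irrational z')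
    (h : (selectBall σ L T R S z).2 = true)
    (hmem : z' ∈ Set.Icc (selectBall σ L T R S z).1.lo (selectBall σ L T R S z).1.hi) :
    selectBall σ L T R S z' = selectBall σ L T R S z := by
  have h1 := selectBall_flagged h
  set ρ := (selectBall σ L T R S z).1 with hρ
  rw [mem_argmaxSet, mem_containing] at h1
  obtain ⟨⟨hρf, hzρ⟩, hmax⟩ := h1
  have hiff : ∀ ρ' : Ball K, ρ'.level ≤ ρ.level →
      (z ∈ Set.Icc ρ'.lo ρ'.hi ↔ z' ∈ Set.Icc ρ'.lo ρ'.hi) := fun ρ' hl =>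
    Ball.mem_iff_of_level_le hz hz' hzρ hmem hl
  have hmax' : ∀ ρ' ∈ S.flagged, z' ∈ Set.Icc ρ'.lo ρ'.hi → ρ'.width ≤ ρ.width := by
    intro ρ' h1 h2
    by_contra hlt
    have hl := Ball.width_le_iff.1 (not_le.1 hlt).le
    exact hlt (hmax ρ' (mem_containing.2 ⟨h1, (hiff ρ' hl).2 h2⟩))
  have hset : argmaxSet (containing S.flagged z') Ball.width =
      argmaxSet (containing S.flagged z) Ball.width := by
    ext ρ'
    simp only [mem_argmaxSet, mem_containing]
    constructor
    · rintro ⟨⟨h1, h2⟩, h3⟩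
      have h4 := h3 ρ ⟨hρf, hmem⟩
      refine ⟨⟨h1, (hiff ρ' (Ball.width_le_iff.1 h4)).2 h2⟩, ?_⟩
      rintro ρ'' ⟨h5, h6⟩
      exact (hmax ρ'' (mem_containing.2 ⟨h5, h6⟩)).trans h4
    · rintro ⟨⟨h1, h2⟩, h3⟩
      have h4 := h3 ρ ⟨hρf, hzρ⟩
      refine ⟨⟨h1, (hiff ρ' (Ball.width_le_iff.1 h4)).1 h2⟩, ?_⟩
      rintro ρ'' ⟨h5, h6⟩
      exact (hmax' ρ'' h5 h6).trans h4
  have hne : (containing S.flagged z).Nonempty := ⟨ρ, mem_containing.2 ⟨hρf, hzρ⟩⟩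
  have hne' : (containing S.flagged z').Nonempty := ⟨ρ, mem_containing.2 ⟨hρf, hmem⟩⟩
  unfold selectBall
  simp only
  rw [if_pos hne, if_pos hne', hset]

/-- The least arm lacking data does not depend on the context; the free rule `playArm`, which may,
is not reached. -/
lemma selectArm_eq_of_flagged {S : State K} {z z' : ℝ}
    (heq : selectBall σ L T R S z' = selectBall σ L T R S z)
    (h : (selectBall σ L T R S z).2 = true)
    (hne : ∃ a ∈ (selectBall σ L T R S z).1.arms,
      ¬ SuffData σ L T S.log (selectBall σ L T R S z).1 a) :
    selectArm σ L T R S z' = selectArm σ L T R S z := by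
  classical
  obtain ⟨a, ha, ha'⟩ := hne
  have h1 : ((selectBall σ L T R S z).1.arms.filter fun a =>
      ¬ SuffData σ L T S.log (selectBall σ L T R S z).1 a).Nonempty :=
    ⟨a, Finset.mem_filter.2 ⟨ha, ha'⟩⟩
  unfold selectArm
  simp only
  simp only [heq]
  rw [dif_pos ⟨h, by convert h1⟩, dif_pos ⟨h, by convert h1⟩]

end Select

/-! ### Accuracy of the nearest neighbour estimates -/

/-- The points at which two arms are compared over the half number `ℓ` of `ρ`. -/
def gridPoint {K : ℕ} (ρ : Ball K) (ℓ : Fin 2) (i : ℕ) : ℝ :=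
  (1 - (i : ℝ) / 200) * (ρ.lo + ρ.width * (ℓ : ℕ) / 2) +
    (i : ℝ) / 200 * (ρ.lo + ρ.width * (1 + (ℓ : ℕ)) / 2)

lemma gridPoint_eq {K : ℕ} (ρ : Ball K) (ℓ : Fin 2) (i : ℕ) :
    gridPoint ρ ℓ i = ρ.lo + ρ.width * (ℓ : ℕ) / 2 + (i : ℝ) / 200 * (ρ.width / 2) := by
  unfold gridPoint; ring

lemma gridPoint_mem {K : ℕ} (ρ : Ball K) (ℓ : Fin 2) {i : ℕ} (hi : i ≤ 200) :
    gridPoint ρ ℓ i ∈ Set.Icc ρ.lo ρ.hi := by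
  rw [gridPoint_eq, Ball.hi_eq]
  have h1 : (i : ℝ) / 200 ≤ 1 := by
    rw [div_le_one (by norm_num)]; exact_mod_cast hi
  have h2 : ((ℓ : ℕ) : ℝ) ≤ 1 := by exact_mod_cast Nat.lt_succ_iff.1 ℓ.2
  have hw := ρ.width_pos
  constructor
  · have : 0 ≤ ρ.width * (ℓ : ℕ) / 2 + (i : ℝ) / 200 * (ρ.width / 2) := by positivity
    linarith
  · have : ρ.width * (ℓ : ℕ) / 2 + (i : ℝ) / 200 * (ρ.width / 2) ≤
        ρ.width * 1 / 2 + 1 * (ρ.width / 2) := by gcongr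
    linarith

/-- Rationality is what allows `NoTies` to exclude two contexts at equal distance from a grid point.
-/
lemma exists_rat_gridPoint {K : ℕ} (ρ : Ball K) (ℓ : Fin 2) (i : ℕ) :
    ∃ q : ℚ, (q : ℝ) = gridPoint ρ ℓ i := by
  refine ⟨(ρ.index : ℚ) / 2 ^ ρ.level + 1 / 2 ^ ρ.level * (ℓ : ℕ) / 2 +
    (i : ℚ) / 200 * (1 / 2 ^ ρ.level / 2), ?_⟩
  rw [gridPoint_eq, Ball.width_eq]
  unfold Ball.lo
  push_cast
  ring

namespace Env

variable {K : ℕ} (e : Env K)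

lemma exists_mem_sub {ρ : Ball K} {z : ℝ} (hz : z ∈ Set.Icc ρ.lo ρ.hi) :
    ∃ q : Fin 64, z ∈ sub ρ q := by
  obtain ⟨h1, h2⟩ := hz
  rw [Ball.hi_eq] at h2
  have hw := ρ.width_pos
  set u : ℝ := (z - ρ.lo) * 64 / ρ.width with hu
  have hzu : z = ρ.lo + u * ρ.width / 64 := by rw [hu]; field_simp; ring
  have hu0 : 0 ≤ u := by
    rw [hu]
    apply div_nonneg _ hw.le
    nlinarith
  have hu64 : u ≤ 64 := by
    rw [hu, div_le_iff₀ hw]; linarith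
  rcases eq_or_lt_of_le hu64 with h | h
  · refine ⟨63, ?_⟩
    unfold sub
    rw [hzu, h]
    constructor
    · have : ((63 : Fin 64) : ℝ) = 63 := by norm_num
      rw [this]
      linarith
    · have : ((63 : Fin 64) : ℝ) = 63 := by norm_num
      rw [this]
      linarith
  · have hfl : ⌊u⌋₊ < 64 := by
      rw [Nat.floor_lt hu0]; exact_mod_cast h
    refine ⟨⟨⌊u⌋₊, hfl⟩, ?_⟩
    unfold sub
    rw [hzu]
    have h3 := Nat.floor_le hu0
    have h4 := (Nat.lt_floor_add_one u).le
    constructor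
    · simp only
      gcongr
    · simp only
      gcongr

/-- No two contexts have the same distance to a rational point. -/
def NoTies : Prop := ∀ s s', s ≠ s' → e.x s ≠ e.x s' ∧ Irrational (e.x s + e.x s')

variable {e} in
lemma NoTies.injective (h : e.NoTies) (q : ℚ) : Function.Injective fun s => |e.x s - q| := by
  intro s s' hss
  by_contra hne
  obtain ⟨h1, h2⟩ := h s s' hne
  rcases abs_eq_abs.1 hss with h3 | h3
  · exact h1 (by linarith)
  · apply h2.ne_rat (2 * q)
    push_cast
    linarith

/-- `estimate` selects by rank but divides by `k`, so it is an average only if exactly `k` samples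
are selected, which absence of ties guarantees. Cutting out the neighbours by the distance of one
trial `m` leaves finitely many sets for the union bound. -/
lemma exists_estimate_eq (hties : e.NoTies) {t : ℕ} {ρ : Ball K} {a : Fin K} {k : ℕ} (hk : 1 ≤ k)
    (hk' : k ≤ (e.sampleSet t ρ a).card) (q : ℚ) :
    ∃ m ∈ e.sampleSet t ρ a,
      ((e.sampleSet t ρ a).filter fun s => |e.x s - q| ≤ |e.x m - q|).card = k ∧
      estimate k (e.st t).log ρ a q = 1 / (k : ℝ) *
        ∑ s ∈ (e.sampleSet t ρ a).filter (fun s => |e.x s - q| ≤ |e.x m - q|),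
          e.pay s (e.arm s) := by
  classical
  obtain ⟨m, hm, h1, h2⟩ := exists_rank_eq (e.sampleSet t ρ a) (fun s => |e.x s - q|)
    ((hties.injective q).injOn) hk hk'
  refine ⟨m, hm, h2, ?_⟩
  rw [← h1]
  unfold estimate
  congr 1
  have h3 : ∀ s, IsNeighbor k (e.st t).log ρ a q (e.tr s) ↔
      ((e.sampleSet t ρ a).filter fun l => |e.x l - q| ≤ |e.x s - q|).card ≤ k := by
    intro s
    unfold IsNeighbor
    have h4 := e.countP_samples t ρ a (fun l => |l.context - q| ≤ |(e.tr s).context - q|)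
    have h5 : (samples (e.st t).log ρ a).countP
        (fun l => @decide (|l.context - (q : ℝ)| ≤ |(e.tr s).context - q|)
          (Classical.propDecidable _)) =
        ((e.sampleSet t ρ a).filter fun l => |e.x l - q| ≤ |e.x s - q|).card :=
      Eq.trans (by congr!) (h4.trans rfl)
    rw [← h5]
  unfold samples
  rw [List.filter_filter, log_eq, sum_filter_map_range]
  apply Finset.sum_congr
  · unfold sampleSet
    rw [Finset.filter_filter]
    apply Finset.filter_congr
    intro s _
    rw [Bool.and_eq_true, decide_eq_true_iff, decide_eq_true_iff, and_comm, ← log_eq, h3 s]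
    rfl
  · intro s _
    rfl

/-- The noise averages of nearest neighbours are small before trial `T`. -/
def GoodNeighbors (ε : ℕ → ℝ) : Prop :=
  ∀ (ρ : Ball K) (a : Fin K) (t m : ℕ) (ℓ : Fin 2) (i : ℕ), t ≤ e.T → m < e.T → i ≤ 200 →
    |∑ s ∈ (e.sampleSet t ρ a).filter (fun s => |e.x s - gridPoint ρ ℓ i| ≤
        |e.x m - gridPoint ρ ℓ i|), ε s| ≤
      Real.sqrt (10 * e.σ ^ 2 * Real.log e.T *
        ((e.sampleSet t ρ a).filter (fun s => |e.x s - gridPoint ρ ℓ i| ≤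
        |e.x m - gridPoint ρ ℓ i|)).card)

/-- The mean noise of every ball is small before trial `T`. -/
def GoodMeans (ε : ℕ → ℝ) : Prop :=
  ∀ (ρ : Ball K) (t : ℕ), t ≤ e.T →
    |∑ s ∈ (Finset.range t).filter (fun s => e.ball s = ρ), ε s| ≤
      Real.sqrt (6 * e.σ ^ 2 * Real.log e.T *
        ((Finset.range t).filter (fun s => e.ball s = ρ)).card)

/-- Bias plus noise. The subinterval of the grid point holds at least `k` samples, all within Δ/64
of it, so the `k` nearest ones are no farther and the bias is at most LΔ/64. The noise part is
`GoodNeighbors`. -/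
lemma abs_estimate_sub_le (hties : e.NoTies) {ε : ℕ → ℝ} {F : Fin K → ℝ → ℝ}
    (hpay : ∀ s a, e.pay s a = F a (e.x s) + ε s) (hL : 0 < e.L)
    (hF : ∀ a z z', |F a z - F a z'| ≤ e.L * |z - z'|) (hgood : e.GoodNeighbors ε)
    {t : ℕ} (ht : t ≤ e.T) {ρ : Ball K} {a : Fin K} (hk : 1 ≤ numNeighbors e.σ e.L e.T ρ)
    (hsuff : SuffData e.σ e.L e.T (e.st t).log ρ a) (ℓ : Fin 2) {i : ℕ} (hi : i ≤ 200) :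
    |estimate (numNeighbors e.σ e.L e.T ρ) (e.st t).log ρ a (gridPoint ρ ℓ i) -
        F a (gridPoint ρ ℓ i)| ≤
      e.L * (ρ.width / 64) +
        Real.sqrt (10 * e.σ ^ 2 * Real.log e.T / numNeighbors e.σ e.L e.T ρ) := by
  classical
  set k := numNeighbors e.σ e.L e.T ρ with hkdef
  rw [suffData_iff] at hsuff
  obtain ⟨q, hq⟩ := exists_mem_sub (gridPoint_mem ρ ℓ hi)
  have hcard : k ≤ (e.sampleSet t ρ a).card := (hsuff 0).trans (Finset.card_filter_le _ _)
  obtain ⟨r, hr⟩ := exists_rat_gridPoint ρ ℓ i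
  obtain ⟨m, hm, hNk, hest⟩ := e.exists_estimate_eq hties hk hcard r
  rw [hr] at hNk hest
  have hmT : m < e.T := by
    have := (Finset.mem_filter.1 hm).1
    rw [Finset.mem_range] at this
    omega
  have hnoise := hgood ρ a t m ℓ i ht hmT hi
  rw [hNk] at hnoise
  set z := gridPoint ρ ℓ i with hz
  set N := (e.sampleSet t ρ a).filter fun s => |e.x s - z| ≤ |e.x m - z| with hN
  have hw := ρ.width_pos
  have hrad : |e.x m - z| ≤ ρ.width / 64 := by
    by_contra hlt
    rw [not_le] at hlt
    have hclose : ∀ s, e.x s ∈ sub ρ q → |e.x s - z| ≤ ρ.width / 64 := by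
      intro s hs
      unfold sub at hs hq
      have e1 : ρ.lo + ((q : ℝ) + 1) * ρ.width / 64 =
        ρ.lo + (q : ℝ) * ρ.width / 64 + ρ.width / 64 := by ring
      rw [e1] at hs hq
      rw [abs_le]
      constructor <;> linarith [hs.1, hs.2, hq.1, hq.2]
    have hsub : ((e.sampleSet t ρ a).filter fun s => e.x s ∈ sub ρ q) ⊂ N := by
      rw [Finset.ssubset_iff_of_subset]
      · refine ⟨m, Finset.mem_filter.2 ⟨hm, le_rfl⟩, ?_⟩
        intro hmem
        exact not_lt.2 (hclose m (Finset.mem_filter.1 hmem).2) hlt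
      · intro s hs
        rw [Finset.mem_filter] at hs
        exact Finset.mem_filter.2 ⟨hs.1, (hclose s hs.2).trans hlt.le⟩
    have h1 := Finset.card_lt_card hsub
    have h2 := hsuff q
    unfold subCount at h2
    rw [hNk] at h1
    omega
  have hkpos : (0 : ℝ) < k := by exact_mod_cast hk
  have hsum : ∑ s ∈ N, e.pay s (e.arm s) = ∑ s ∈ N, (F a (e.x s) - F a z) + k * F a z +
      ∑ s ∈ N, ε s := by
    have : ∑ s ∈ N, e.pay s (e.arm s) = ∑ s ∈ N, ((F a (e.x s) - F a z) + F a z + ε s) := by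
      apply Finset.sum_congr rfl
      intro s hs
      have := (Finset.mem_filter.1 (Finset.mem_filter.1 hs).1).2
      rw [hpay, this.2.1]
      ring
    rw [this, Finset.sum_add_distrib, Finset.sum_add_distrib, Finset.sum_const, hNk, nsmul_eq_mul]
  have hbias : |∑ s ∈ N, (F a (e.x s) - F a z)| ≤ k * (e.L * (ρ.width / 64)) := by
    refine (Finset.abs_sum_le_sum_abs _ _).trans ?_
    rw [← hNk, ← nsmul_eq_mul]
    apply Finset.sum_le_card_nsmul
    intro s hs
    refine (hF a _ _).trans ?_
    have := (Finset.mem_filter.1 hs).2.trans hrad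
    gcongr
  have hsq : Real.sqrt (10 * e.σ ^ 2 * Real.log e.T * k) =
      k * Real.sqrt (10 * e.σ ^ 2 * Real.log e.T / k) := by
    have : 10 * e.σ ^ 2 * Real.log e.T * k = k ^ 2 * (10 * e.σ ^ 2 * Real.log e.T / k) := by
      field_simp
    rw [this, Real.sqrt_mul (by positivity), Real.sqrt_sq hkpos.le]
  rw [hsq] at hnoise
  rw [hest, hsum]
  have hfin : 1 / (k : ℝ) * (∑ s ∈ N, (F a (e.x s) - F a z) + k * F a z + ∑ s ∈ N, ε s) - F a z =
      (∑ s ∈ N, (F a (e.x s) - F a z) + ∑ s ∈ N, ε s) / k := by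
    field_simp
    ring
  rw [hfin, abs_div, abs_of_pos hkpos, div_le_iff₀ hkpos]
  refine (abs_add_le _ _).trans ?_
  linarith

end Env

end ApproxZooming

namespace ApproxZooming

/-! ### From distance estimates to nearly optimal balls -/

lemma sum_grid : ∑ i ∈ Finset.Icc 1 200, ((i : ℕ) : ℝ) / 200 = 100.5 := by
  rw [← Finset.sum_div, ← Nat.cast_sum]
  have : ∑ i ∈ Finset.Icc 1 200, i = 20100 := by decide +kernel
  rw [this]
  norm_num

/-- By convexity each distance lies below its chord in the relative position `s` of `x`, so the mean
distance to the grid is about half the width. The trivial bound by the full width would be too weak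
for the constant 2 in `Similar`. -/
lemma sum_abs_sub_grid_le {u w x : ℝ} (hw : 0 < w) (hx : x ∈ Set.Icc u (u + w)) :
    ∑ i ∈ Finset.Icc 1 200, |x - (u + ((i : ℕ) : ℝ) / 200 * w)| ≤ 100.5 * w := by
  obtain ⟨h1, h2⟩ := hx
  obtain ⟨s, hs⟩ : ∃ s, x = u + s * w := ⟨(x - u) / w, by field_simp; ring⟩
  have hs0 : 0 ≤ s := by
    by_contra h
    rw [not_le] at h
    nlinarith
  have hs1 : s ≤ 1 := by
    by_contra h
    rw [not_le] at h
    nlinarith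
  have hterm : ∀ i ∈ Finset.Icc 1 200, |x - (u + ((i : ℕ) : ℝ) / 200 * w)| ≤
      ((1 - 2 * s) * ((i : ℝ) / 200) + s) * w := by
    intro i hi
    rw [Finset.mem_Icc] at hi
    have hi0 : (0 : ℝ) ≤ (i : ℝ) / 200 := by positivity
    have hi1 : (i : ℝ) / 200 ≤ 1 := by
      rw [div_le_one (by norm_num)]; exact_mod_cast hi.2
    have e1 : x - (u + ((i : ℕ) : ℝ) / 200 * w) = (s - (i : ℝ) / 200) * w := by rw [hs]; ring
    rw [e1, abs_mul, abs_of_pos hw]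
    gcongr
    rw [abs_le]
    constructor <;> nlinarith
  refine (Finset.sum_le_sum hterm).trans ?_
  rw [← Finset.sum_mul, Finset.sum_add_distrib, ← Finset.mul_sum, sum_grid]
  simp
  rw [mul_le_mul_iff_of_pos_right hw]
  linarith

lemma sum_abs_le_of_sum_sq_le {d : ℕ → ℝ} {B : ℝ} (hB : 0 ≤ B)
    (h : 1 / 200 * ∑ i ∈ Finset.Icc 1 200, d i ^ 2 ≤ B ^ 2) :
    ∑ i ∈ Finset.Icc 1 200, |d i| ≤ 200 * B := by
  have h1 := sq_sum_le_card_mul_sum_sq (s := Finset.Icc 1 200) (f := fun i => |d i|)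
  simp only [sq_abs, Nat.card_Icc] at h1
  norm_num at h1
  apply le_of_sq_le_sq₀ _ (by positivity)
  · nlinarith
where
  le_of_sq_le_sq₀ {a b : ℝ} (h : a ^ 2 ≤ b ^ 2) (hb : 0 ≤ b) : a ≤ b :=
    abs_le_of_sq_le_sq' h hb |>.2

namespace Env

variable {K : ℕ} (e : Env K)

/-- The noise level at which the estimates are used. -/
lemma sqrt_div_numNeighbors_le (hσ : 0 < e.σ) (hL : 0 < e.L) (hT : 2 ≤ e.T) {ρ : Ball K}
    (hρ : ρ.arms.Nonempty) :
    Real.sqrt (10 * e.σ ^ 2 * Real.log e.T / numNeighbors e.σ e.L e.T ρ) ≤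
        0.043 * (e.L * ρ.width) ∧
      2 * e.σ ^ 2 / numNeighbors e.σ e.L e.T ρ ≤ 0.00054 * (e.L * ρ.width) ^ 2 := by
  have hw := ρ.width_pos
  have hlog : 0.69 ≤ Real.log e.T := by
    have h1 : Real.log 2 ≤ Real.log e.T := by
      apply Real.log_le_log (by norm_num); exact_mod_cast hT
    linarith [Real.log_two_gt_d9]
  have hk := e.le_numNeighbors (by omega) hρ
  have hk1 : (1 : ℝ) ≤ numNeighbors e.σ e.L e.T ρ := by
    exact_mod_cast e.one_le_numNeighbors hσ hL hT hρ
  set k : ℝ := (numNeighbors e.σ e.L e.T ρ : ℝ) with hkdef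
  rw [div_le_iff₀ (by positivity)] at hk
  have hkp : 0 < k := by linarith
  -- The constants are √(10/5431) < 0.043 and 2/(5431 · 0.69) < 0.00054, the latter with ln T ≥ ln 2
  -- > 0.69.
  constructor
  · apply Real.sqrt_le_iff.2
    refine ⟨by positivity, ?_⟩
    rw [div_le_iff₀ hkp]
    nlinarith
  · rw [div_le_iff₀ hkp]
    have h3 : 0 ≤ e.σ ^ 2 := sq_nonneg _
    have h4 : 5431 * e.σ ^ 2 * 0.69 ≤ 5431 * e.σ ^ 2 * Real.log e.T := by gcongr
    nlinarith

/-- The assumptions on contexts and noise under which the analysis of a run is deterministic. -/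
structure Good (ε : ℕ → ℝ) (F : Fin K → ℝ → ℝ) : Prop where
  hK : 1 ≤ K
  hσ : 0 < e.σ
  hL : 0 < e.L
  hT : 2 ≤ e.T
  hx : ∀ t, e.x t ∈ Set.Icc (0 : ℝ) 1
  hties : e.NoTies
  hpay : ∀ s a, e.pay s a = F a (e.x s) + ε s
  hF : ∀ a z z', |F a z - F a z'| ≤ e.L * |z - z'|
  neighbors : e.GoodNeighbors ε
  means : e.GoodMeans ε

variable {e} {ε : ℕ → ℝ} {F : Fin K → ℝ → ℝ}

/-- At each grid point the estimate of either arm errs by at most (1/64 + 0.043)LΔ < 0.0587LΔ. In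
units of LΔ/2, the clustering radius 3/16 together with the correction 2σ²/k bounds the quadratic
mean, hence the mean, of the estimated differences by 0.1932; and 0.1932 + 4 · 0.0587 < 0.43. -/
lemma Good.sum_abs_sub_center_le (h : e.Good ε F) {t : ℕ} (ht : t < e.T) (hs : e.AllSuff t)
    {ℓ : Fin 2} {b y : Fin K} (hb : b ∈ (e.ball t).arms) (hy : y ∈ (e.ball t).arms)
    (hd : b = y ∨ e.dhat t ℓ b y ≤ 3 / 16 * e.L * ((e.ball t).width / 2)) :
    ∑ i ∈ Finset.Icc 1 200, |F b (gridPoint (e.ball t) ℓ i) - F y (gridPoint (e.ball t) ℓ i)| ≤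
      200 * (0.43 * (e.L * ((e.ball t).width / 2))) := by
  have hL := h.hL
  set ρ := e.ball t with hρ
  have hw := ρ.width_pos
  rcases hd with rfl | hd
  · simp
    positivity
  have hne : ρ.arms.Nonempty := ⟨b, hb⟩
  have hk := e.one_le_numNeighbors h.hσ h.hL h.hT hne
  obtain ⟨hq1, hq2⟩ := e.sqrt_div_numNeighbors_le h.hσ h.hL h.hT hne
  have hest : ∀ a ∈ ρ.arms, ∀ i ∈ Finset.Icc 1 200,
      |estimate (numNeighbors e.σ e.L e.T ρ) (e.st (t + 1)).log ρ a (gridPoint ρ ℓ i) -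
        F a (gridPoint ρ ℓ i)| ≤ 0.0587 * (e.L * ρ.width) := by
    intro a ha i hi
    have h1 := e.abs_estimate_sub_le h.hties h.hpay h.hL h.hF h.neighbors (t := t + 1) (by omega)
      hk (hs a ha) ℓ (Finset.mem_Icc.1 hi).2
    have : e.L * (ρ.width / 64) = 1 / 64 * (e.L * ρ.width) := by ring
    rw [this] at h1
    have h2 : 0 < e.L * ρ.width := by positivity
    linarith
  set k := numNeighbors e.σ e.L e.T ρ with hkdef
  set D : ℕ → ℝ := fun i => estimate k (e.st (t + 1)).log ρ b (gridPoint ρ ℓ i) -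
    estimate k (e.st (t + 1)).log ρ y (gridPoint ρ ℓ i) with hD
  have hdhat : e.dhat t ℓ b y =
      Real.sqrt (1 / 200 * ∑ i ∈ Finset.Icc 1 200, D i ^ 2 - 2 * e.σ ^ 2 / k) := rfl
  rw [hdhat, Real.sqrt_le_left (by positivity)] at hd
  have hsum : ∑ i ∈ Finset.Icc 1 200, |D i| ≤ 200 * (0.1932 * (e.L * (ρ.width / 2))) := by
    apply sum_abs_le_of_sum_sq_le (by positivity)
    have : 0 < (e.L * ρ.width) ^ 2 := by positivity
    nlinarith
  have hterm : ∀ i ∈ Finset.Icc 1 200, |F b (gridPoint ρ ℓ i) - F y (gridPoint ρ ℓ i)| ≤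
      |D i| + 2 * (0.0587 * (e.L * ρ.width)) := by
    intro i hi
    have h1 := abs_le.1 (hest b hb i hi)
    have h2 := abs_le.1 (hest y hy i hi)
    have h3 := abs_le.1 (le_refl |D i|)
    simp only [hD] at h3 ⊢
    rw [abs_le]
    constructor <;> linarith [h1.1, h1.2, h2.1, h2.2, h3.1, h3.2]
  refine (Finset.sum_le_sum hterm).trans ?_
  rw [Finset.sum_add_distrib, Finset.sum_const, Nat.card_Icc, nsmul_eq_mul]
  have h2 : 0 < e.L * ρ.width := by positivity
  norm_num
  norm_num at hsum
  linarith

/-- Arms of the same ball, other than the root, have similar rewards on its context interval. -/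
lemma Good.sub_le_of_mem_split (h : e.Good ε F) {t : ℕ} (ht : t < e.T) (hs : e.AllSuff t)
    {c : Ball K} (hc : c ∈ e.split t) {a b : Fin K} (ha : a ∈ c.arms) (hb : b ∈ c.arms)
    {x x' : ℝ} (hx : x ∈ Set.Icc c.lo c.hi) (hx' : x' ∈ Set.Icc c.lo c.hi) :
    F a x - F b x' ≤ 2 * e.L * c.width := by
  have hL := h.hL
  obtain ⟨ℓ, A, rfl, hA, -, y, hy, hyA⟩ := (e.isSplit_split t).mem c hc
  have hw := (e.ball t).width_pos
  rw [Ball.hi_eq, Ball.child_lo, Ball.child_width] at hx hx'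
  rw [Ball.child_width]
  have h1 := h.sum_abs_sub_center_le ht hs (ℓ := ℓ) (hA ha) hy (hyA a ha)
  have h2 := h.sum_abs_sub_center_le ht hs (ℓ := ℓ) (hA hb) hy (hyA b hb)
  have h3 := sum_abs_sub_grid_le (by positivity) hx
  have h4 := sum_abs_sub_grid_le (by positivity) hx'
  set w := (e.ball t).width with hwdef
  set g : ℕ → ℝ := gridPoint (e.ball t) ℓ with hg
  have hgi : ∀ i : ℕ, (e.ball t).lo + w * (ℓ : ℕ) / 2 + (i : ℝ) / 200 * (w / 2) = g i := by
    intro i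
    rw [hg, gridPoint_eq]
  simp only [hgi] at h3 h4
  -- Go from `(a, x)` to `(b, x')` through the center at each grid point and average over the grid:
  -- 2 · 0.43 for the arms and 2 · 0.5025 for the contexts, less than 2 in total.
  have hterm : ∀ i ∈ Finset.Icc 1 200, F a x - F b x' ≤
      |F a (g i) - F y (g i)| + |F b (g i) - F y (g i)| + e.L * |x - g i| + e.L * |x' - g i| := by
    intro i _
    have h5 := (abs_le.1 (h.hF a x (g i))).2
    have h6 := (abs_le.1 (h.hF b x' (g i))).1
    have h7 := le_abs_self (F a (g i) - F y (g i))
    have h8 := neg_abs_le (F b (g i) - F y (g i))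
    linarith
  have hsum := Finset.sum_le_sum hterm
  rw [Finset.sum_const, Nat.card_Icc, nsmul_eq_mul, Finset.sum_add_distrib, Finset.sum_add_distrib,
    Finset.sum_add_distrib, ← Finset.mul_sum, ← Finset.mul_sum] at hsum
  have h9 := mul_le_mul_of_nonneg_left h3 hL.le
  have h10 := mul_le_mul_of_nonneg_left h4 hL.le
  have hLw : 0 < e.L * w := by positivity
  norm_num at hsum h1 h2 h9 h10
  linarith

lemma Good.inv (h : e.Good ε F) (t : ℕ) : e.Inv t := e.inv h.hK h.hx t

/-- Rewards of the arms of `ρ` over its context interval differ by at most `2 L Δ(ρ)`. -/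
def Similar (F : Fin K → ℝ → ℝ) (L : ℝ) (ρ : Ball K) : Prop :=
  ∀ a ∈ ρ.arms, ∀ b ∈ ρ.arms, ∀ x ∈ Set.Icc ρ.lo ρ.hi, ∀ x' ∈ Set.Icc ρ.lo ρ.hi,
    F a x - F b x' ≤ 2 * L * ρ.width

/-- All payoffs of `ρ` come from its own arms and its own interval, so apart from noise each is
within 2LΔ of `F a z` by similarity. -/
lemma Good.abs_meanPayoff_sub_le (h : e.Good ε F) {t : ℕ} (ht : t ≤ e.T) {ρ : Ball K}
    (hsim : Similar F e.L ρ) (hcount : count (e.st t).log ρ ≠ 0) {a : Fin K} (ha : a ∈ ρ.arms)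
    {z : ℝ} (hz : z ∈ Set.Icc ρ.lo ρ.hi) :
    |meanPayoff (e.st t).log ρ - F a z| ≤ 2 * e.L * ρ.width +
      Real.sqrt (6 * e.σ ^ 2 * Real.log e.T / count (e.st t).log ρ) := by
  have hnoise := h.means ρ t ht
  have hmean : meanPayoff (e.st t).log ρ =
      (∑ s ∈ (Finset.range t).filter (fun s => e.ball s = ρ), e.pay s (e.arm s)) /
        count (e.st t).log ρ := by
    unfold meanPayoff
    congr 1
    rw [log_eq, sum_filter_map_range]
    apply Finset.sum_congr
    · exact Finset.filter_congr fun s _ => decide_eq_true_iff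
    · intro s _; rfl
  have hc := e.count_log t ρ
  rw [← hc] at hnoise
  set n := count (e.st t).log ρ with hn
  set N := (Finset.range t).filter fun s => e.ball s = ρ with hN
  have hnpos : (0 : ℝ) < n := by
    have : 0 < n := Nat.pos_of_ne_zero hcount
    exact_mod_cast this
  have hsum : ∑ s ∈ N, e.pay s (e.arm s) = ∑ s ∈ N, (F (e.arm s) (e.x s) - F a z) + n * F a z +
      ∑ s ∈ N, ε s := by
    have : ∑ s ∈ N, e.pay s (e.arm s) =
        ∑ s ∈ N, ((F (e.arm s) (e.x s) - F a z) + F a z + ε s) := by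
      apply Finset.sum_congr rfl
      intro s _
      rw [h.hpay]
      ring
    rw [this, Finset.sum_add_distrib, Finset.sum_add_distrib, Finset.sum_const, ← hc, nsmul_eq_mul]
  have hbias : |∑ s ∈ N, (F (e.arm s) (e.x s) - F a z)| ≤ n * (2 * e.L * ρ.width) := by
    refine (Finset.abs_sum_le_sum_abs _ _).trans ?_
    rw [hc, ← nsmul_eq_mul]
    apply Finset.sum_le_card_nsmul
    intro s hs
    have hb : e.ball s = ρ := (Finset.mem_filter.1 hs).2
    have hm := e.arm_mem h.hK (h.inv s) (h.hx s)
    have hxs := (e.ball_mem_cur h.hK (h.inv s) (h.hx s)).2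
    rw [hb] at hm hxs
    rw [abs_le]
    have h1 := hsim _ hm _ ha _ hxs _ hz
    have h2 := hsim _ ha _ hm _ hz _ hxs
    constructor <;> linarith
  have hsq : Real.sqrt (6 * e.σ ^ 2 * Real.log e.T * n) =
      n * Real.sqrt (6 * e.σ ^ 2 * Real.log e.T / n) := by
    have : 6 * e.σ ^ 2 * Real.log e.T * n = n ^ 2 * (6 * e.σ ^ 2 * Real.log e.T / n) := by
      field_simp
    rw [this, Real.sqrt_mul (by positivity), Real.sqrt_sq hnpos.le]
  rw [hsq] at hnoise
  rw [hmean, hsum]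
  have hfin : (∑ s ∈ N, (F (e.arm s) (e.x s) - F a z) + n * F a z + ∑ s ∈ N, ε s) / n - F a z =
      (∑ s ∈ N, (F (e.arm s) (e.x s) - F a z) + ∑ s ∈ N, ε s) / n := by
    field_simp
    ring
  rw [hfin, abs_div, abs_of_pos hnpos, div_le_iff₀ hnpos]
  refine (abs_add_le _ _).trans ?_
  linarith

lemma Good.le_ucb (h : e.Good ε F) {t : ℕ} (ht : t ≤ e.T) {ρ : Ball K}
    (hsim : Similar F e.L ρ) {a : Fin K} (ha : a ∈ ρ.arms) {z : ℝ} (hz : z ∈ Set.Icc ρ.lo ρ.hi) :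
    ((F a z : ℝ) : EReal) ≤ ucb e.σ e.L e.T (e.st t).log ρ := by
  unfold ucb
  split_ifs with hc
  · exact le_top
  · rw [EReal.coe_le_coe_iff]
    have := (abs_le.1 (h.abs_meanPayoff_sub_le ht hsim hc ha hz)).1
    linarith

/-- What is known about the balls present before trial `t`. -/
structure Acc (e : Env K) (F : Fin K → ℝ → ℝ) (t : ℕ) : Prop where
  similar : ∀ ρ ∈ e.cur t, 1 ≤ ρ.level → Similar F e.L ρ
  flagged : ∀ ρ ∈ (e.st t).flagged, 1 ≤ ρ.level → ∀ a ∈ ρ.arms, ∀ b, ∀ x ∈ Set.Icc ρ.lo ρ.hi,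
    F b x - F a x ≤ 7 * e.L * ρ.width
  deep : ∀ ρ ∈ e.cur t, 2 ≤ ρ.level → ∀ a ∈ ρ.arms, ∀ b, ∀ x ∈ Set.Icc ρ.lo ρ.hi,
    F b x - F a x ≤ 14 * e.L * ρ.width

/-- The arms of a ball that becomes flagged are nearly optimal. -/
lemma Good.sub_le_of_flag (h : e.Good ε F) {t : ℕ} (ht : t < e.T) (hacc : Acc e F t)
    (hf : e.flag t = false) (hc : e.thr (e.ball t) < count (e.st t).log (e.ball t)) {a : Fin K}
    (ha : a ∈ (e.ball t).arms) (b : Fin K) {x : ℝ}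
    (hx : x ∈ Set.Icc (e.ball t).lo (e.ball t).hi) :
    F b x - F a x ≤ 7 * e.L * (e.ball t).width := by
  have hL := h.hL
  obtain ⟨hact, hxb, hmax⟩ := e.ball_of_not_flag h.hK (h.inv t) (h.hx t) hf
  obtain ⟨ρ', hρ', hxρ', hbρ'⟩ := e.exists_active (h.inv t) (h.hx t) hf b
  have hw := (e.ball t).width_pos
  have hthr := e.thr_nonneg (e.ball t) (by have := h.hT; omega)
  have hcpos : (0 : ℝ) < count (e.st t).log (e.ball t) := lt_of_le_of_lt hthr hc
  have hc0 : count (e.st t).log (e.ball t) ≠ 0 := by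
    intro h0
    rw [h0] at hcpos
    simp at hcpos
  have hsim' := hacc.similar ρ' (Finset.mem_union_left _ hρ') ((h.inv t).level ρ' hρ')
  have hsim := hacc.similar _ (Finset.mem_union_left _ hact) ((h.inv t).level _ hact)
  -- Optimism: some active ball at the current context contains `b`, and the chosen ball has at
  -- least its UCB.
  have h1 := (h.le_ucb ht.le hsim' hbρ' hxρ').trans (hmax ρ' hρ' hxρ')
  unfold ucb at h1
  rw [if_neg hc0, EReal.coe_le_coe_iff] at h1
  have h2 := (abs_le.1 (h.abs_meanPayoff_sub_le ht.le hsim hc0 ha hx)).2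
  have h3 := (abs_le.1 (h.hF b x (e.x t))).2
  -- Passing the flagging threshold brings the confidence radius down to LΔ. Then 7 = 2 (bonus in
  -- UCB) + 2 (bias of the mean) + 2 (two radii) + 1 (moving the context).
  have h4 : Real.sqrt (6 * e.σ ^ 2 * Real.log e.T / count (e.st t).log (e.ball t)) ≤
      e.L * (e.ball t).width := by
    apply Real.sqrt_le_iff.2
    refine ⟨by positivity, ?_⟩
    rw [div_le_iff₀ hcpos]
    unfold thr at hc
    rw [div_lt_iff₀ (by positivity)] at hc
    nlinarith
  have h5 : |x - e.x t| ≤ (e.ball t).width := by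
    rw [Ball.hi_eq] at hx hxb
    rw [abs_le]
    constructor <;> linarith [hx.1, hx.2, hxb.1, hxb.2]
  have h6 : e.L * |x - e.x t| ≤ e.L * (e.ball t).width := by gcongr
  linarith

lemma Good.acc (h : e.Good ε F) {t : ℕ} (ht : t ≤ e.T) : Acc e F t := by
  induction t with
  | zero =>
    have hcur : ∀ ρ ∈ e.cur 0, ρ = Ball.root K := by
      intro ρ hρ
      unfold cur at hρ
      rw [st_zero] at hρ
      simpa using hρ
    constructor
    · intro ρ hρ hl
      rw [hcur ρ hρ] at hl
      simp [Ball.root] at hl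
    · intro ρ hρ hl
      rw [hcur ρ (Finset.mem_union_right _ hρ)] at hl
      simp [Ball.root] at hl
    · intro ρ hρ hl
      rw [hcur ρ hρ] at hl
      simp [Ball.root] at hl
  | succ t ih =>
    have hacc := ih (by omega)
    have hL := h.hL
    rcases e.step_cases t with ⟨hf, hs, ha, hfl⟩ | ⟨-, -, ha, hfl⟩ | ⟨hf, hc, ha, hfl⟩ |
      ⟨-, -, ha, hfl⟩
    · have hcur : ∀ ρ ∈ e.cur (t + 1), ρ ∈ e.cur t ∨ ρ ∈ e.split t := by
        intro ρ hρ
        unfold cur at hρ ⊢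
        rw [ha, hfl] at hρ
        simp only [Finset.mem_union, Finset.mem_erase] at hρ ⊢
        tauto
      constructor
      · intro ρ hρ hl
        rcases hcur ρ hρ with h1 | h1
        · exact hacc.similar ρ h1 hl
        · exact fun a ha b hb x hx x' hx' => h.sub_le_of_mem_split (by omega) hs h1 ha hb hx hx'
      · intro ρ hρ
        rw [hfl] at hρ
        exact hacc.flagged ρ (Finset.mem_of_mem_erase hρ)
      · intro ρ hρ hl a haρ b x hx
        rcases hcur ρ hρ with h1 | h1
        · exact hacc.deep ρ h1 hl a haρ b x hx
        -- The parent has level at least 1, so its bound 7LΔ is available and becomes 14LΔ at half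
        -- the width. Children of the root are excluded, since the root is flagged from the
        -- beginning without evidence.
        · obtain ⟨ℓ, A, rfl, hA, -⟩ := (e.isSplit_split t).mem ρ h1
          have hl' : 1 ≤ (e.ball t).level := by
            simp only [Ball.child] at hl
            omega
          have := hacc.flagged _ (e.ball_of_flag hf).1 hl' a (hA haρ) b x (Ball.mem_of_mem_child hx)
          rw [Ball.child_width]
          linarith
    · have hcur : e.cur (t + 1) = e.cur t := by unfold cur; rw [ha, hfl]
      exact ⟨by rw [hcur]; exact hacc.similar, by rw [hfl]; exact hacc.flagged,
        by rw [hcur]; exact hacc.deep⟩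
    · have hb := (e.ball_of_not_flag h.hK (h.inv t) (h.hx t) hf).1
      have hcur : e.cur (t + 1) = e.cur t := by
        unfold cur
        rw [ha, hfl, Finset.union_insert, ← Finset.insert_union, Finset.insert_erase hb]
      refine ⟨by rw [hcur]; exact hacc.similar, ?_, by rw [hcur]; exact hacc.deep⟩
      intro ρ hρ hl a haρ b x hx
      rw [hfl] at hρ
      rcases Finset.mem_insert.1 hρ with rfl | h1
      · exact h.sub_le_of_flag (by omega) hacc hf hc haρ b hx
      · exact hacc.flagged ρ h1 hl a haρ b x hx
    · have hcur : e.cur (t + 1) = e.cur t := by unfold cur; rw [ha, hfl]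
      exact ⟨by rw [hcur]; exact hacc.similar, by rw [hfl]; exact hacc.flagged,
        by rw [hcur]; exact hacc.deep⟩

/-- The regret of a trial in which a ball of level `i ≥ 2` is chosen. -/
lemma Good.regret_le (h : e.Good ε F) {t : ℕ} (ht : t < e.T) (hl : 2 ≤ (e.ball t).level)
    (b : Fin K) : F b (e.x t) - F (e.arm t) (e.x t) ≤ 14 * e.L / 2 ^ (e.ball t).level := by
  have hb := e.ball_mem_cur h.hK (h.inv t) (h.hx t)
  have := (h.acc ht.le).deep _ hb.1 hl _ (e.arm_mem h.hK (h.inv t) (h.hx t)) b _ hb.2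
  rw [Ball.width_eq] at this
  rwa [mul_one_div] at this

end Env

end ApproxZooming

namespace ApproxZooming

/-! ### Measurability -/

section CountablyValued

variable {Ω : Type*} {mΩ : MeasurableSpace Ω} {α β : Type*}

/-- The function `f` has measurable fibers. -/
def MeasFibers [mΩ : MeasurableSpace Ω] (f : Ω → α) : Prop := ∀ v, MeasurableSet {ω | f ω = v}

lemma measFibers_const (v : α) : MeasFibers (fun _ : Ω => v) := fun w => by
  by_cases h : v = w <;> simp [h]

/-- Split over the countably many values of `f`. Balls, arms and clusterings carry no chosen
σ-algebra, so measurability of fibers takes the place of `Measurable` for the discrete choices. -/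
lemma MeasFibers.measurableSet [Countable α] {f : Ω → α} (hf : MeasFibers f)
    {p : α → Ω → Prop} (hp : ∀ v, MeasurableSet {ω | p v ω}) : MeasurableSet {ω | p (f ω) ω} := by
  have : {ω | p (f ω) ω} = ⋃ v, ({ω | f ω = v} ∩ {ω | p v ω}) := by
    ext ω
    simp
  rw [this]
  exact MeasurableSet.iUnion fun v => (hf v).inter (hp v)

lemma MeasFibers.bind [Countable α] {f : Ω → α} (hf : MeasFibers f) {g : α → Ω → β}
    (hg : ∀ v, MeasFibers (g v)) : MeasFibers fun ω => g (f ω) ω := fun w =>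
  hf.measurableSet (p := fun v ω => g v ω = w) fun v => hg v w

lemma MeasFibers.comp [Countable α] {f : Ω → α} (hf : MeasFibers f) (g : α → β) :
    MeasFibers fun ω => g (f ω) :=
  hf.bind (g := fun v _ => g v) fun v => measFibers_const (g v)

lemma MeasFibers.setOf [Countable α] {f : Ω → α} (hf : MeasFibers f) (p : α → Prop) :
    MeasurableSet {ω | p (f ω)} :=
  hf.measurableSet (p := fun v _ => p v) fun v => by by_cases h : p v <;> simp [h]

lemma MeasFibers.ite {p : Ω → Prop} [∀ ω, Decidable (p ω)] (hp : MeasurableSet {ω | p ω})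
    {f g : Ω → α} (hf : MeasFibers f) (hg : MeasFibers g) :
    MeasFibers fun ω => if p ω then f ω else g ω := by
  intro v
  have : {ω | (if p ω then f ω else g ω) = v} =
      ({ω | p ω} ∩ {ω | f ω = v}) ∪ ({ω | p ω}ᶜ ∩ {ω | g ω = v}) := by
    ext ω
    by_cases h : p ω <;> simp [h]
  rw [this]
  exact (hp.inter (hf v)).union (hp.compl.inter (hg v))

lemma measFibers_filter (B : Finset α) {p : Ω → α → Prop} [∀ ω, DecidablePred (p ω)]
    (hp : ∀ b ∈ B, MeasurableSet {ω | p ω b}) : MeasFibers fun ω => B.filter (p ω) := by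
  classical
  intro v
  by_cases hv : v ⊆ B
  · have : {ω | B.filter (p ω) = v} = ⋂ b ∈ B, {ω | p ω b ↔ b ∈ v} := by
      ext ω
      simp only [Set.mem_ofPred_eq, Set.mem_iInter, Finset.ext_iff, Finset.mem_filter]
      constructor
      · intro h b hb
        rw [← h b]
        simp [hb]
      · intro h b
        constructor
        · rintro ⟨hb, hpb⟩
          exact (h b hb).1 hpb
        · intro hb
          exact ⟨hv hb, (h b (hv hb)).2 hb⟩
    rw [this]
    refine Finset.measurableSet_biInter B fun b hb => ?_
    by_cases hbv : b ∈ v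
    · simp only [hbv, iff_true]
      exact hp b hb
    · simp only [hbv, iff_false]
      exact (hp b hb).compl
  · have : {ω | B.filter (p ω) = v} = ∅ := by
      ext ω
      simp only [Set.mem_ofPred_eq, Set.mem_empty_iff_false, iff_false]
      rintro rfl
      exact hv (Finset.filter_subset _ _)
    rw [this]
    exact MeasurableSet.empty

lemma MeasFibers.measurable_nat {f : Ω → ℕ} (hf : MeasFibers f) : Measurable f :=
  measurable_to_countable' hf

end CountablyValued

section Logs

variable {K : ℕ} {Ω : Type*} [mΩ : MeasurableSpace Ω]

instance : Countable (Ball K) := by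
  have : Function.Injective fun ρ : Ball K => (ρ.level, ρ.index, ρ.arms) := by
    intro ρ ρ' h
    simp only [Prod.mk.injEq] at h
    exact Ball.eq_of_level_index_arms h.1 h.2.1 h.2.2
  exact this.countable

/-- A random trial with deterministic ball, arm and flag. -/
def MeasTrial (τ : Ω → Trial K) : Prop :=
  ∃ (c p : Ω → ℝ) (b : Ball K) (a : Fin K) (f : Bool), Measurable c ∧ Measurable p ∧
    τ = fun ω => ⟨c ω, b, a, f, p ω⟩

/-- A random log of length `n` with deterministic balls, arms and flags. -/
def MeasLog (n : ℕ) (lg : Ω → List (Trial K)) : Prop :=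
  ∃ τs : List (Ω → Trial K), τs.length = n ∧ (∀ τ ∈ τs, MeasTrial τ) ∧
    ∀ ω, lg ω = τs.map fun τ => τ ω

variable {n : ℕ} {lg : Ω → List (Trial K)}

lemma MeasLog.length_eq (h : MeasLog n lg) (ω : Ω) : (lg ω).length = n := by
  obtain ⟨τs, hn, -, hlg⟩ := h
  rw [hlg, List.length_map, hn]

lemma MeasLog.countP (h : MeasLog n lg) {P : Ω → Trial K → Bool}
    (hP : ∀ τ : Ω → Trial K, MeasTrial τ → MeasurableSet {ω | P ω (τ ω) = true}) :
    MeasFibers fun ω => (lg ω).countP (P ω) := by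
  obtain ⟨τs, -, hτ, hlg⟩ := h
  simp only [hlg]
  clear hlg
  induction τs with
  | nil => exact measFibers_const 0
  | cons τ τs ih =>
    have ih' := ih fun τ' h' => hτ τ' (List.mem_cons_of_mem _ h')
    have h1 := hP τ (hτ τ List.mem_cons_self)
    have : (fun ω => ((τ :: τs).map fun τ => τ ω).countP (P ω)) = fun ω =>
        if P ω (τ ω) = true then (τs.map fun τ => τ ω).countP (P ω) + 1
          else (τs.map fun τ => τ ω).countP (P ω) := by
      funext ω
      rw [List.map_cons, List.countP_cons]
      split_ifs <;> rfl
    rw [this]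
    exact MeasFibers.ite h1 (ih'.comp (· + 1)) ih'

lemma MeasLog.sum_filter (h : MeasLog n lg) {P : Ω → Trial K → Bool}
    (hP : ∀ τ : Ω → Trial K, MeasTrial τ → MeasurableSet {ω | P ω (τ ω) = true}) :
    Measurable fun ω => (((lg ω).filter (P ω)).map Trial.payoff).sum := by
  obtain ⟨τs, -, hτ, hlg⟩ := h
  simp only [hlg]
  clear hlg
  induction τs with
  | nil => simp
  | cons τ τs ih =>
    have ih' := ih fun τ' h' => hτ τ' (List.mem_cons_of_mem _ h')
    have h1 := hP τ (hτ τ List.mem_cons_self)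
    have hpay : Measurable fun ω => (τ ω).payoff := by
      obtain ⟨c, p, b, a, f, -, hp, rfl⟩ := hτ τ List.mem_cons_self
      exact hp
    have : (fun ω => ((((τ :: τs).map fun τ => τ ω).filter (P ω)).map Trial.payoff).sum) = fun ω =>
        if P ω (τ ω) = true then
          (τ ω).payoff + (((τs.map fun τ => τ ω).filter (P ω)).map Trial.payoff).sum
          else (((τs.map fun τ => τ ω).filter (P ω)).map Trial.payoff).sum := by
      funext ω
      rw [List.map_cons, List.filter_cons]
      split_ifs <;> simp
    rw [this]
    exact Measurable.ite h1 (hpay.add ih') ih'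

lemma measurableSet_trial_disc {τ : Ω → Trial K} (hτ : MeasTrial τ)
    (p : Ball K → Fin K → Bool → Prop) :
    MeasurableSet {ω | p (τ ω).ball (τ ω).arm (τ ω).wasFlagged} := by
  obtain ⟨c, q, b, a, f, -, -, rfl⟩ := hτ
  by_cases h : p b a f <;> simp [h]

lemma MeasTrial.context {τ : Ω → Trial K} (hτ : MeasTrial τ) :
    Measurable fun ω => (τ ω).context := by
  obtain ⟨c, q, b, a, f, hc, -, rfl⟩ := hτ
  exact hc

lemma MeasLog.count (h : MeasLog n lg) (ρ : Ball K) : MeasFibers fun ω => count (lg ω) ρ := by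
  unfold ApproxZooming.count
  apply h.countP
  intro τ hτ
  simpa using measurableSet_trial_disc hτ fun b _ _ => b = ρ

lemma MeasLog.meanPayoff (h : MeasLog n lg) (ρ : Ball K) :
    Measurable fun ω => meanPayoff (lg ω) ρ := by
  unfold ApproxZooming.meanPayoff
  apply Measurable.div
  · apply h.sum_filter
    intro τ hτ
    simpa using measurableSet_trial_disc hτ fun b _ _ => b = ρ
  · exact measurable_from_nat.comp (h.count ρ).measurable_nat

lemma MeasLog.ucb (h : MeasLog n lg) (σ L : ℝ) (T : ℕ) (ρ : Ball K) :
    Measurable fun ω => ucb σ L T (lg ω) ρ := by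
  unfold ApproxZooming.ucb
  apply Measurable.ite ((h.count ρ).setOf (· = 0)) measurable_const
  apply measurable_coe_real_ereal.comp
  apply Measurable.add
  · exact (h.meanPayoff ρ).add measurable_const
  · exact (measurable_from_nat (f := fun c : ℕ =>
      Real.sqrt (6 * σ ^ 2 * Real.log T / c))).comp (h.count ρ).measurable_nat

lemma MeasLog.countP_samples (h : MeasLog n lg) (ρ : Ball K) (a : Fin K)
    {P : Ω → Trial K → Bool}
    (hP : ∀ τ : Ω → Trial K, MeasTrial τ → MeasurableSet {ω | P ω (τ ω) = true}) :
    MeasFibers fun ω => (samples (lg ω) ρ a).countP (P ω) := by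
  unfold samples
  simp only [List.countP_filter]
  apply h.countP
  intro τ hτ
  have h1 := measurableSet_trial_disc hτ fun b a' f => b = ρ ∧ a' = a ∧ f = true
  simp only [Bool.and_eq_true, decide_eq_true_eq]
  exact (hP τ hτ).inter h1

lemma MeasLog.suffData (h : MeasLog n lg) (σ L : ℝ) (T : ℕ) (ρ : Ball K) (a : Fin K) :
    MeasurableSet {ω | SuffData σ L T (lg ω) ρ a} := by
  unfold SuffData
  rw [Set.ofPred_forall]
  apply MeasurableSet.iInter
  intro i
  apply (h.countP_samples ρ a ?_).setOf (fun c => numNeighbors σ L T ρ ≤ c)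
  intro τ hτ
  simp only [decide_eq_true_eq]
  exact hτ.context measurableSet_Icc

lemma MeasLog.estimate (h : MeasLog n lg) (k : ℕ) (ρ : Ball K) (a : Fin K) (z : ℝ) :
    Measurable fun ω => estimate k (lg ω) ρ a z := by
  unfold ApproxZooming.estimate
  apply Measurable.const_mul
  unfold samples
  simp only [List.filter_filter]
  apply h.sum_filter
  intro τ hτ
  have h1 := measurableSet_trial_disc hτ fun b a' f => b = ρ ∧ a' = a ∧ f = true
  simp only [Bool.and_eq_true, decide_eq_true_eq]
  refine MeasurableSet.inter (s₁ := {ω | IsNeighbor k (lg ω) ρ a z (τ ω)}) ?_ h1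
  unfold IsNeighbor
  apply (h.countP_samples ρ a ?_).setOf (fun c => c ≤ k)
  intro τ' hτ'
  simp only [decide_eq_true_eq]
  have h2 := hτ.context
  have h3 := hτ'.context
  apply measurableSet_le <;> fun_prop

lemma MeasLog.estDist (h : MeasLog n lg) (σ L : ℝ) (T : ℕ) (ρ : Ball K) (u v : ℝ)
    (a b : Fin K) : Measurable fun ω => estDist σ L T (lg ω) ρ u v a b := by
  unfold ApproxZooming.estDist
  simp only
  apply Measurable.sqrt
  apply Measurable.sub_const
  apply Measurable.const_mul
  apply Finset.measurable_sum
  intro i _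
  exact ((h.estimate _ _ _ _).sub (h.estimate _ _ _ _)).pow_const 2

lemma measFibers_clusterStep {d : Ω → Fin K → Fin K → ℝ}
    (hd : ∀ a b, Measurable fun ω => d ω a b) (r : ℝ) (pick : Finset (Fin K) → Fin K)
    (c : Finset (Fin K) × (Fin K → Finset (Fin K))) (a : Fin K) :
    MeasFibers fun ω => clusterStep (d ω) r pick c a := by
  unfold clusterStep
  apply MeasFibers.ite
  · have : {ω | ∀ y ∈ c.1, r < d ω a y} = ⋂ y ∈ c.1, {ω | r < d ω a y} := by
      ext; simp
    rw [this]
    exact Finset.measurableSet_biInter _ fun y _ => measurableSet_lt measurable_const (hd a y)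
  · exact measFibers_const _
  · simp only
    refine (measFibers_filter c.1 ?_).comp
      fun A => (c.1, Function.update c.2 (pick A) (insert a (c.2 (pick A))))
    intro y _
    have : {ω | ∀ w ∈ c.1, d ω a y ≤ d ω a w} = ⋂ w ∈ c.1, {ω | d ω a y ≤ d ω a w} := by
      ext; simp
    rw [this]
    exact Finset.measurableSet_biInter _ fun w _ => measurableSet_le (hd a y) (hd a w)

lemma measFibers_foldl_clusterStep {d : Ω → Fin K → Fin K → ℝ}
    (hd : ∀ a b, Measurable fun ω => d ω a b) (r : ℝ) (pick : Finset (Fin K) → Fin K)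
    (l : List (Fin K)) (c : Finset (Fin K) × (Fin K → Finset (Fin K))) :
    MeasFibers fun ω => l.foldl (clusterStep (d ω) r pick) c := by
  induction l using List.reverseRecOn with
  | nil => exact measFibers_const c
  | append_singleton l a ih =>
    simp only [List.foldl_append, List.foldl_cons, List.foldl_nil]
    exact ih.bind (g := fun c ω => clusterStep (d ω) r pick c a)
      fun c => measFibers_clusterStep hd r pick c a

lemma MeasLog.subPartition (h : MeasLog n lg) (σ L : ℝ) (T : ℕ) (R : Rules K) (t : ℕ)
    (ρ : Ball K) : MeasFibers fun ω => subPartition σ L T R t (lg ω) ρ := by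
  have hhalf : ∀ ℓ, MeasFibers fun ω => subPartitionHalf σ L T R t (lg ω) ρ ℓ := by
    intro ℓ
    unfold subPartitionHalf
    exact (measFibers_foldl_clusterStep (fun a b => h.estDist σ L T ρ _ _ a b) _ _ _ _).comp
      fun c => c.1.image fun y => ρ.child ℓ (c.2 y)
  unfold ApproxZooming.subPartition
  exact (hhalf 0).bind (g := fun A ω => A ∪ subPartitionHalf σ L T R t (lg ω) ρ 1)
    fun A => (hhalf 1).comp fun B => A ∪ B

lemma measFibers_containing (B : Finset (Ball K)) {x : Ω → ℝ} (hx : Measurable x) :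
    MeasFibers fun ω => containing B (x ω) := by
  unfold containing
  exact measFibers_filter B fun ρ _ => hx measurableSet_Icc

lemma MeasLog.selectBall (h : MeasLog n lg) (σ L : ℝ) (T : ℕ) (R : Rules K)
    (A B : Finset (Ball K)) {x : Ω → ℝ} (hx : Measurable x) :
    MeasFibers fun ω => selectBall σ L T R ⟨A, B, lg ω⟩ (x ω) := by
  unfold ApproxZooming.selectBall
  simp only [h.length_eq]
  apply MeasFibers.ite
  · exact (measFibers_containing B hx).setOf Finset.Nonempty
  · exact (measFibers_containing B hx).comp
      fun C => (R.pickBall n (argmaxSet C Ball.width), true)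
  · refine (measFibers_containing A hx).bind
      (g := fun C ω => (R.pickBall n (argmaxSet C (ApproxZooming.ucb σ L T (lg ω))), false))
      fun C => ?_
    refine MeasFibers.comp ?_ fun D => (R.pickBall n D, false)
    unfold argmaxSet
    refine @measFibers_filter _ _ _ C (fun ω ρ => ∀ ρ' ∈ C,
      ApproxZooming.ucb σ L T (lg ω) ρ' ≤ ApproxZooming.ucb σ L T (lg ω) ρ) (_) ?_
    intro ρ _
    have : {ω | ∀ ρ' ∈ C, ApproxZooming.ucb σ L T (lg ω) ρ' ≤ ApproxZooming.ucb σ L T (lg ω) ρ} =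
        ⋂ ρ' ∈ C, {ω | ApproxZooming.ucb σ L T (lg ω) ρ' ≤ ApproxZooming.ucb σ L T (lg ω) ρ} := by
      ext; simp
    rw [this]
    exact Finset.measurableSet_biInter _ fun ρ' _ =>
      measurableSet_le (h.ucb σ L T ρ') (h.ucb σ L T ρ)

lemma MeasLog.history (h : MeasLog n lg) : Measurable fun ω => history (lg ω) := by
  obtain ⟨τs, -, hτ, hlg⟩ := h
  rw [measurable_pi_iff]
  intro s
  unfold ApproxZooming.history
  simp only [hlg, List.map_map]
  by_cases hs : s < τs.length
  · have hτs := hτ τs[s] (List.getElem_mem hs)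
    have : (fun ω => (τs.map ((fun r : Trial K => (r.context, r.payoff)) ∘ fun τ => τ ω)).getD s
        (0, 0)) = fun ω => ((τs[s] ω).context, (τs[s] ω).payoff) := by
      funext ω
      simp [List.getD, hs]
    rw [this]
    obtain ⟨c, p, b, a, f, hc, hp, he⟩ := hτs
    rw [he]
    exact hc.prodMk hp
  · have : (fun ω => (τs.map ((fun r : Trial K => (r.context, r.payoff)) ∘ fun τ => τ ω)).getD s
        (0, 0)) = fun ω => (0, 0) := by
      funext ω
      simp [List.getD, hs]
    rw [this]
    exact measurable_const

/-- Once the ball and its set of arms lacking data are fixed, the only randomness left is in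
`playArm`, which is measurable by the definition of `Rules`. -/
lemma MeasLog.selectArm (h : MeasLog n lg) (σ L : ℝ) (T : ℕ) (R : Rules K)
    (A B : Finset (Ball K)) {x : Ω → ℝ} (hx : Measurable x) :
    MeasFibers fun ω => selectArm σ L T R ⟨A, B, lg ω⟩ (x ω) := by
  classical
  have h1 := h.selectBall σ L T R A B hx
  have h2 : ∀ p : Ball K × Bool, MeasFibers fun ω =>
      (if h : p.2 = true ∧ (p.1.arms.filter fun a => ¬ SuffData σ L T (lg ω) p.1 a).Nonempty then
        (p.1.arms.filter fun a => ¬ SuffData σ L T (lg ω) p.1 a).min' h.2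
      else R.playArm n (ApproxZooming.history (lg ω)) (x ω) p.1) := by
    intro p
    have h3 : MeasFibers fun ω => p.1.arms.filter fun a => ¬ SuffData σ L T (lg ω) p.1 a :=
      measFibers_filter p.1.arms fun a _ => (h.suffData σ L T p.1 a).compl
    refine h3.bind (g := fun C ω => if h : p.2 = true ∧ C.Nonempty then C.min' h.2
      else R.playArm n (ApproxZooming.history (lg ω)) (x ω) p.1) fun C => ?_
    by_cases hC : p.2 = true ∧ C.Nonempty
    · simp only [hC]
      exact measFibers_const _
    · simp only [hC, dite_false]
      intro v
      exact ((R.measurable_playArm n p.1).comp (h.history.prodMk hx)) (measurableSet_singleton v)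
  have h4 := h1.bind h2
  convert h4 using 2 with ω
  unfold ApproxZooming.selectArm
  simp only [h.length_eq]

/-- The discrete part of a trial. -/
def Trial.disc (τ : Trial K) : Ball K × Fin K × Bool := (τ.ball, τ.arm, τ.wasFlagged)

/-- The discrete part of a state. -/
def State.disc (S : State K) : Finset (Ball K) × Finset (Ball K) × List (Ball K × Fin K × Bool) :=
  (S.active, S.flagged, S.log.map Trial.disc)

lemma MeasLog.append (h : MeasLog n lg) {c p : Ω → ℝ} (hc : Measurable c) (hp : Measurable p)
    (b : Ball K) (a : Fin K) (f : Bool) :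
    MeasLog (n + 1) fun ω => lg ω ++ [⟨c ω, b, a, f, p ω⟩] := by
  obtain ⟨τs, hn, hτ, hlg⟩ := h
  refine ⟨τs ++ [fun ω => ⟨c ω, b, a, f, p ω⟩], by simp [hn], ?_, ?_⟩
  · intro τ h
    rcases List.mem_append.1 h with h | h
    · exact hτ τ h
    · rw [List.mem_singleton] at h
      exact ⟨c, p, b, a, f, hc, hp, h⟩
  · intro ω
    simp [hlg]

lemma MeasLog.map_disc (h : MeasLog n lg) :
    MeasFibers fun ω => (lg ω).map Trial.disc := by
  obtain ⟨τs, -, hτ, hlg⟩ := h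
  simp only [hlg]
  clear hlg
  induction τs with
  | nil => exact measFibers_const _
  | cons τ τs ih =>
    obtain ⟨c, p, b, a, f, hc, hp, rfl⟩ := hτ τ List.mem_cons_self
    simp only [List.map_cons]
    exact (ih fun τ' h' => hτ τ' (List.mem_cons_of_mem _ h')).comp
      fun l => Trial.disc ⟨0, b, a, f, 0⟩ :: l

/-- Fix ball, flag and arm first. The extended log then again has a deterministic discrete part, and
each branch of `step` can be treated separately. -/
lemma MeasLog.step (h : MeasLog n lg) (σ L : ℝ) (T : ℕ) (R : Rules K)
    (A B : Finset (Ball K)) {x : Ω → ℝ} (hx : Measurable x) {pay : Ω → Fin K → ℝ}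
    (hpay : ∀ a, Measurable fun ω => pay ω a) :
    MeasFibers fun ω => (step σ L T R ⟨A, B, lg ω⟩ (x ω) (pay ω)).disc := by
  classical
  have h1 := (h.selectBall σ L T R A B hx).bind
    (g := fun p ω => (p, ApproxZooming.selectArm σ L T R ⟨A, B, lg ω⟩ (x ω)))
    fun p => (h.selectArm σ L T R A B hx).comp fun a => (p, a)
  have h2 : ∀ q : (Ball K × Bool) × Fin K, MeasFibers fun ω =>
      (if q.1.2 = true then
        if ∀ b ∈ q.1.1.arms, SuffData σ L T (lg ω ++ [⟨x ω, q.1.1, q.2, q.1.2, pay ω q.2⟩]) q.1.1 b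
        then (⟨A ∪ ApproxZooming.subPartition σ L T R n
            (lg ω ++ [⟨x ω, q.1.1, q.2, q.1.2, pay ω q.2⟩]) q.1.1, B.erase q.1.1,
            lg ω ++ [⟨x ω, q.1.1, q.2, q.1.2, pay ω q.2⟩]⟩ : State K)
        else ⟨A, B, lg ω ++ [⟨x ω, q.1.1, q.2, q.1.2, pay ω q.2⟩]⟩
      else
        if 6 * σ ^ 2 * Real.log T / (L ^ 2 * q.1.1.width ^ 2) <
            ApproxZooming.count (lg ω) q.1.1 then
          ⟨A.erase q.1.1, insert q.1.1 B, lg ω ++ [⟨x ω, q.1.1, q.2, q.1.2, pay ω q.2⟩]⟩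
        else ⟨A, B, lg ω ++ [⟨x ω, q.1.1, q.2, q.1.2, pay ω q.2⟩]⟩).disc := by
    rintro ⟨⟨ρ, fl⟩, a⟩
    have h3 := h.append hx (hpay a) ρ a fl
    have h4 := h3.map_disc
    have hconst : ∀ A' B' : Finset (Ball K), MeasFibers fun ω =>
        (⟨A', B', lg ω ++ [⟨x ω, ρ, a, fl, pay ω a⟩]⟩ : State K).disc := fun A' B' =>
      h4.comp fun l => (A', B', l)
    simp only
    cases fl
    · simp only [Bool.false_eq_true, if_false]
      simp only [apply_ite State.disc]
      refine MeasFibers.ite ?_ (hconst _ _) (hconst _ _)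
      exact (h.count ρ).setOf fun c =>
        6 * σ ^ 2 * Real.log T / (L ^ 2 * ρ.width ^ 2) < (c : ℝ)
    · simp only [if_true]
      simp only [apply_ite State.disc]
      refine MeasFibers.ite ?_ ?_ (hconst _ _)
      · have : {ω | ∀ b ∈ ρ.arms, SuffData σ L T (lg ω ++ [⟨x ω, ρ, a, true, pay ω a⟩]) ρ b} =
            ⋂ b ∈ ρ.arms, {ω | SuffData σ L T (lg ω ++ [⟨x ω, ρ, a, true, pay ω a⟩]) ρ b} := by
          ext; simp
        rw [this]
        exact Finset.measurableSet_biInter _ fun b _ => h3.suffData σ L T ρ b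
      · exact (h3.subPartition σ L T R n ρ).bind
          (g := fun C ω => (⟨A ∪ C, B.erase ρ, lg ω ++ [⟨x ω, ρ, a, true, pay ω a⟩]⟩ :
            State K).disc) fun C => hconst _ _
  have h5 := h1.bind h2
  convert h5 using 3 with ω
  unfold ApproxZooming.step
  simp only [h.length_eq]

end Logs

end ApproxZooming

namespace ApproxZooming

/-! ### Measurability of the random run -/

section RandomRun

variable {K : ℕ} {Ω : Type*}

/-- The run with contexts `x`, noise `ε` and reward functions `F`. -/
def mkEnv (σ L : ℝ) (T : ℕ) (R : Rules K) (F : Fin K → ℝ → ℝ) (x ε : ℕ → ℝ) : Env K :=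
  ⟨σ, L, T, R, x, fun s a => F a (x s) + ε s⟩

variable (σ L : ℝ) (T : ℕ) (R : Rules K) (F : Fin K → ℝ → ℝ) (X ε : ℕ → Ω → ℝ)

/-- The random run with contexts `X` and noise `ε`. -/
def rEnv (ω : Ω) : Env K := mkEnv σ L T R F (fun s => X s ω) (fun s => ε s ω)

/-- The log with the given discrete parts. -/
def relog (l : List (Ball K × Fin K × Bool)) (ω : Ω) : List (Trial K) :=
  l.zipIdx.map fun p => ⟨X p.2 ω, p.1.1, p.1.2.1, p.1.2.2, F p.1.2.1 (X p.2 ω) + ε p.2 ω⟩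

lemma relog_disc (t : ℕ) (ω : Ω) :
    relog F X ε (((rEnv σ L T R F X ε ω).st t).log.map Trial.disc) ω =
      ((rEnv σ L T R F X ε ω).st t).log := by
  rw [Env.log_eq]
  unfold relog
  apply List.ext_getElem
  · simp
  · intro i h1 h2
    simp [Trial.disc, Env.tr, rEnv, mkEnv]

variable {F X ε} [mΩ : MeasurableSpace Ω]

lemma measLog_relog (hF : ∀ a, Measurable (F a)) (l : List (Ball K × Fin K × Bool))
    (hX : ∀ s < l.length, Measurable (X s)) (hε : ∀ s < l.length, Measurable (ε s)) :
    MeasLog l.length (relog F X ε l) := by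
  refine ⟨l.zipIdx.map fun p ω =>
    ⟨X p.2 ω, p.1.1, p.1.2.1, p.1.2.2, F p.1.2.1 (X p.2 ω) + ε p.2 ω⟩, by simp, ?_, ?_⟩
  · intro τ hτ
    obtain ⟨p, hp, rfl⟩ := List.mem_map.1 hτ
    have hlt : p.2 < l.length := by
      have := List.snd_lt_of_mem_zipIdx hp
      simpa using this
    exact ⟨_, _, _, _, _, hX _ hlt, ((hF _).comp (hX _ hlt)).add (hε _ hlt), rfl⟩
  · intro ω
    simp [relog]

/-- With balls, arms and flags fixed, the log is a measurable function of contexts and noise, and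
there are countably many such discrete parts. Restricting to those of length `t` lets only inputs
before trial `t` enter, so the lemma applies to σ-algebras of the past. -/
lemma measFibers_state_aux (hF : ∀ a, Measurable (F a)) {t : ℕ}
    (hX : ∀ s < t, Measurable (X s)) (hε : ∀ s < t, Measurable (ε s))
    (hdisc : MeasFibers fun ω => ((rEnv σ L T R F X ε ω).st t).disc)
    {α : Type*} {Φ : State K → Ω → α}
    (hΦ : ∀ A B lg, MeasLog t lg → MeasFibers fun ω => Φ ⟨A, B, lg ω⟩ ω) :
    MeasFibers fun ω => Φ ((rEnv σ L T R F X ε ω).st t) ω := by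
  intro w
  have : {ω | Φ ((rEnv σ L T R F X ε ω).st t) ω = w} =
      ⋃ v : {v : Finset (Ball K) × Finset (Ball K) × List (Ball K × Fin K × Bool) //
        v.2.2.length = t}, ({ω | ((rEnv σ L T R F X ε ω).st t).disc = v.1} ∩
          {ω | Φ ⟨v.1.1, v.1.2.1, relog F X ε v.1.2.2 ω⟩ ω = w}) := by
    ext ω
    have key : Φ ((rEnv σ L T R F X ε ω).st t) ω =
        Φ ⟨((rEnv σ L T R F X ε ω).st t).disc.1, ((rEnv σ L T R F X ε ω).st t).disc.2.1,
          relog F X ε ((rEnv σ L T R F X ε ω).st t).disc.2.2 ω⟩ ω := by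
      simp only [State.disc, relog_disc]
    simp only [Set.mem_ofPred_eq, Set.mem_iUnion, Set.mem_inter_iff]
    constructor
    · intro h
      refine ⟨⟨_, ?_⟩, rfl, ?_⟩
      · simp [Env.length_log]
      · rw [key] at h
        exact h
    · rintro ⟨v, h1, h2⟩
      rw [key, h1]
      exact h2
  rw [this]
  apply MeasurableSet.iUnion
  rintro ⟨v, hv⟩
  refine (hdisc v).inter (hΦ _ _ _ ?_ w)
  have := measLog_relog hF v.2.2 (by rw [hv]; exact hX) (by rw [hv]; exact hε)
  rw [hv] at this
  exact this

lemma measFibers_disc (hF : ∀ a, Measurable (F a)) {t : ℕ}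
    (hX : ∀ s < t, Measurable (X s)) (hε : ∀ s < t, Measurable (ε s)) :
    MeasFibers fun ω => ((rEnv σ L T R F X ε ω).st t).disc := by
  induction t with
  | zero => exact measFibers_const (⟨∅, {Ball.root K}, []⟩ : State K).disc
  | succ t ih =>
    have hX' : ∀ s < t, Measurable (X s) := fun s hs => hX s (by omega)
    have hε' : ∀ s < t, Measurable (ε s) := fun s hs => hε s (by omega)
    refine measFibers_state_aux σ L T R hF hX' hε' (ih hX' hε')
      (Φ := fun S ω => (step σ L T R S (X t ω) (fun a => F a (X t ω) + ε t ω)).disc) ?_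
    intro A B lg hlg
    exact hlg.step σ L T R A B (hX t (by omega)) fun a =>
      ((hF a).comp (hX t (by omega))).add (hε t (by omega))

/-- Functions of the state before trial `t` are measurable if they are for logs with
deterministic discrete parts. -/
lemma measFibers_state (hF : ∀ a, Measurable (F a)) {t : ℕ}
    (hX : ∀ s < t, Measurable (X s)) (hε : ∀ s < t, Measurable (ε s))
    {α : Type*} {Φ : State K → Ω → α}
    (hΦ : ∀ A B lg, MeasLog t lg → MeasFibers fun ω => Φ ⟨A, B, lg ω⟩ ω) :
    MeasFibers fun ω => Φ ((rEnv σ L T R F X ε ω).st t) ω :=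
  measFibers_state_aux σ L T R hF hX hε (measFibers_disc σ L T R hF hX hε) hΦ

lemma measFibers_select (hF : ∀ a, Measurable (F a)) {t : ℕ}
    (hX : ∀ s < t, Measurable (X s)) (hε : ∀ s < t, Measurable (ε s)) {x : Ω → ℝ}
    (hx : Measurable x) :
    MeasFibers fun ω => (selectBall σ L T R ((rEnv σ L T R F X ε ω).st t) (x ω),
      selectArm σ L T R ((rEnv σ L T R F X ε ω).st t) (x ω)) := by
  refine measFibers_state σ L T R hF hX hε (Φ := fun S ω => (selectBall σ L T R S (x ω),
      selectArm σ L T R S (x ω))) fun A B lg hlg => ?_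
  exact (hlg.selectBall σ L T R A B hx).bind
    (g := fun p ω => (p, selectArm σ L T R ⟨A, B, lg ω⟩ (x ω)))
    fun p => (hlg.selectArm σ L T R A B hx).comp fun a => (p, a)

/-- The ball, the arm and the flag of trial `t`. -/
lemma measFibers_trial (hF : ∀ a, Measurable (F a)) {t : ℕ}
    (hX : ∀ s ≤ t, Measurable (X s)) (hε : ∀ s < t, Measurable (ε s)) :
    MeasFibers fun ω => ((rEnv σ L T R F X ε ω).ball t, (rEnv σ L T R F X ε ω).arm t,
      (rEnv σ L T R F X ε ω).flag t) :=
  (measFibers_select σ L T R hF (fun s hs => hX s hs.le) hε (hX t le_rfl)).comp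
    fun p => (p.1.1, p.2, p.1.2)

lemma measFibers_subCount (hF : ∀ a, Measurable (F a)) {t : ℕ}
    (hX : ∀ s < t, Measurable (X s)) (hε : ∀ s < t, Measurable (ε s)) (ρ : Ball K) (a : Fin K)
    (q : Fin 64) : MeasFibers fun ω => (rEnv σ L T R F X ε ω).subCount t ρ a q := by
  classical
  have h1 : ∀ ω, (rEnv σ L T R F X ε ω).subCount t ρ a q =
      (samples ((rEnv σ L T R F X ε ω).st t).log ρ a).countP
        fun s => decide (s.context ∈ Env.sub ρ q) := by
    intro ω
    rw [Env.countP_samples]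
    unfold Env.subCount
    congr!
  simp only [h1]
  refine measFibers_state σ L T R hF hX hε (Φ := fun S _ => (samples S.log ρ a).countP
    fun s => decide (s.context ∈ Env.sub ρ q)) fun A B lg hlg => ?_
  apply hlg.countP_samples
  intro τ hτ
  simp only [decide_eq_true_eq]
  exact hτ.context measurableSet_Icc

end RandomRun

end ApproxZooming

namespace ApproxZooming

/-! ### Concentration of predictable sums of Gaussian noise -/

section Noise

open scoped ENNReal

variable {Ω : Type*} {mΩ : MeasurableSpace Ω} {P : Measure Ω}

/-- The noise sequence `ε` is adapted to `m (· + 1)` and centered Gaussian with variance `σ²` and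
independent of the past. -/
structure GaussianNoise (P : Measure Ω) (σ : ℝ) (m : ℕ → MeasurableSpace Ω) (ε : ℕ → Ω → ℝ) :
    Prop where
  le : ∀ s, m s ≤ mΩ
  mono : Monotone m
  adapted : ∀ s, Measurable[m (s + 1)] (ε s)
  indep : ∀ s, Indep (m s) (MeasurableSpace.comap (ε s) inferInstance) P
  law : ∀ s, P.map (ε s) = gaussianReal 0 (Real.toNNReal (σ ^ 2))

variable {σ : ℝ} {m : ℕ → MeasurableSpace Ω} {ε : ℕ → Ω → ℝ}

open scoped Classical in
/-- The exponential martingale of the noise that is selected by the events `A`. -/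
def expProd (σ lam : ℝ) (ε : ℕ → Ω → ℝ) (A : ℕ → Set Ω) (t : ℕ) (ω : Ω) : ℝ≥0∞ :=
  ∏ s ∈ Finset.range t, if ω ∈ A s then
    ENNReal.ofReal (Real.exp (lam * ε s ω - lam ^ 2 * σ ^ 2 / 2)) else 1

lemma GaussianNoise.measurable (h : GaussianNoise P σ m ε) (s : ℕ) : Measurable (ε s) :=
  (h.adapted s).mono (h.le _) le_rfl

lemma GaussianNoise.lintegral_exp [IsProbabilityMeasure P] (h : GaussianNoise P σ m ε) (lam : ℝ) (s : ℕ) :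
    ∫⁻ ω, ENNReal.ofReal (Real.exp (lam * ε s ω - lam ^ 2 * σ ^ 2 / 2)) ∂P = 1 := by
  have hm := h.measurable s
  have h1 : ∀ y : ℝ, Real.exp (lam * y - lam ^ 2 * σ ^ 2 / 2) =
      Real.exp (lam * y) * Real.exp (-(lam ^ 2 * σ ^ 2 / 2)) := by
    intro y
    rw [← Real.exp_add]
    ring_nf
  have h2 : Integrable (fun y => Real.exp (lam * y)) (P.map (ε s)) := by
    rw [h.law s]
    exact integrable_exp_mul_gaussianReal lam
  have h3 : Integrable (fun ω => Real.exp (lam * ε s ω)) P :=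
    h2.comp_measurable hm
  rw [← ofReal_integral_eq_lintegral_ofReal]
  · simp only [h1]
    rw [integral_mul_const]
    have h4 : ∫ ω, Real.exp (lam * ε s ω) ∂P = mgf (ε s) P lam := rfl
    rw [h4, mgf_gaussianReal (h.law s), ← Real.exp_add]
    have : 0 * lam + σ ^ 2 * lam ^ 2 / 2 + -(lam ^ 2 * σ ^ 2 / 2) = 0 := by ring
    rw [Real.coe_toNNReal _ (sq_nonneg σ), this]
    simp
  · simp only [h1]
    exact h3.mul_const _
  · exact Filter.Eventually.of_forall fun ω => (Real.exp_pos _).le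

lemma GaussianNoise.measurable_expProd (h : GaussianNoise P σ m ε) (lam : ℝ) {A : ℕ → Set Ω}
    (hA : ∀ s, MeasurableSet[m s] (A s)) (t : ℕ) : Measurable[m t] (expProd σ lam ε A t) := by
  unfold expProd
  refine Finset.measurable_fun_prod _ fun s hs => ?_
  rw [Finset.mem_range] at hs
  have h1 : Measurable[m t] (ε s) := (h.adapted s).mono (h.mono (by omega)) le_rfl
  refine Measurable.ite (h.mono hs.le _ (hA s)) ?_ measurable_const
  exact (Real.measurable_exp.comp ((h1.const_mul lam).sub_const _)).ennreal_ofReal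

/-- The factor of trial `t` has mean 1 and is independent of `m t`, to which both the earlier
product and `A t` belong; off `A t` the product does not change. With `lintegral` no integrability
has to be carried through the induction. -/
lemma GaussianNoise.lintegral_expProd [IsProbabilityMeasure P] (h : GaussianNoise P σ m ε)
    (lam : ℝ) {A : ℕ → Set Ω}
    (hA : ∀ s, MeasurableSet[m s] (A s)) (t : ℕ) : ∫⁻ ω, expProd σ lam ε A t ω ∂P = 1 := by
  classical
  induction t with
  | zero => simp [expProd]
  | succ t ih =>
    set Z : Ω → ℝ≥0∞ := fun ω =>
      ENNReal.ofReal (Real.exp (lam * ε t ω - lam ^ 2 * σ ^ 2 / 2)) with hZ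
    have hM := h.measurable_expProd lam hA t
    have hM' : Measurable (expProd σ lam ε A t) := hM.mono (h.le t) le_rfl
    have hAt : MeasurableSet (A t) := h.le t _ (hA t)
    have hsplit : ∀ ω, expProd σ lam ε A (t + 1) ω =
        (A t).indicator (expProd σ lam ε A t) ω * Z ω +
          (A t)ᶜ.indicator (expProd σ lam ε A t) ω := by
      intro ω
      unfold expProd
      rw [Finset.prod_range_succ]
      by_cases hω : ω ∈ A t <;> simp [hω, hZ]
    have hZm : Measurable[MeasurableSpace.comap (ε t) inferInstance] Z := by
      have h1 : Measurable[MeasurableSpace.comap (ε t) inferInstance] (ε t) :=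
        comap_measurable _
      exact (Real.measurable_exp.comp ((h1.const_mul lam).sub_const _)).ennreal_ofReal
    have hprod := lintegral_mul_eq_lintegral_mul_lintegral_of_independent_measurableSpace
      (h.le t) (h.measurable t).comap_le (h.indep t) (hM.indicator (hA t)) hZm
    simp only [hsplit]
    rw [lintegral_add_right _ (hM'.indicator hAt.compl), hprod, hZ, h.lintegral_exp, mul_one,
      ← lintegral_add_right _ (hM'.indicator hAt.compl), ← ih]
    congr 1
    funext ω
    by_cases hω : ω ∈ A t <;> simp [hω]

open scoped Classical in
lemma expProd_eq (lam : ℝ) (A : ℕ → Set Ω) (t : ℕ) (ω : Ω) :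
    expProd σ lam ε A t ω = ENNReal.ofReal (Real.exp
      (lam * ∑ s ∈ (Finset.range t).filter (fun s => ω ∈ A s), ε s ω -
        ((Finset.range t).filter fun s => ω ∈ A s).card * (lam ^ 2 * σ ^ 2 / 2))) := by
  unfold expProd
  rw [← Finset.prod_filter, ← ENNReal.ofReal_prod_of_nonneg (fun s _ => (Real.exp_pos _).le),
    ← Real.exp_sum, Finset.sum_sub_distrib, ← Finset.mul_sum, Finset.sum_const, nsmul_eq_mul]

-- Chernoff bound with λ = δb/(nσ²), where `b` is the square root: on the event the exponential
-- product is at least `T ^ c`, while its mean is 1. The number `n` of selected terms is fixed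
-- because λ depends on it; δ = ±1 is the side.
open scoped Classical in
lemma GaussianNoise.measure_le_of_side [IsProbabilityMeasure P] (h : GaussianNoise P σ m ε)
    (hσ : 0 < σ) {A : ℕ → Set Ω}
    (hA : ∀ s, MeasurableSet[m s] (A s)) (t n c T : ℕ) (hn : 1 ≤ n) (hT : 1 ≤ T) {δ : ℝ}
    (hδ : δ ^ 2 = 1) :
    P {ω | ((Finset.range t).filter fun s => ω ∈ A s).card = n ∧
      Real.sqrt (2 * c * σ ^ 2 * Real.log T * n) <
        δ * ∑ s ∈ (Finset.range t).filter (fun s => ω ∈ A s), ε s ω} ≤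
      ENNReal.ofReal (1 / (T : ℝ) ^ c) := by
  set b := Real.sqrt (2 * c * σ ^ 2 * Real.log T * n) with hb
  have hn' : (0 : ℝ) < n := by exact_mod_cast hn
  have hT' : (0 : ℝ) < T := by exact_mod_cast hT
  have hlog : 0 ≤ Real.log T := Real.log_nonneg (by exact_mod_cast hT)
  have hb2 : b ^ 2 = 2 * c * σ ^ 2 * Real.log T * n := Real.sq_sqrt (by positivity)
  have hb0 : 0 ≤ b := Real.sqrt_nonneg _
  set lam : ℝ := δ * (b / (n * σ ^ 2)) with hlam
  have hTc : (0 : ℝ) < (T : ℝ) ^ c := by positivity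
  have hsub : {ω | ((Finset.range t).filter fun s => ω ∈ A s).card = n ∧
      b < δ * ∑ s ∈ (Finset.range t).filter (fun s => ω ∈ A s), ε s ω} ⊆
      {ω | ENNReal.ofReal ((T : ℝ) ^ c) ≤ expProd σ lam ε A t ω} := by
    rintro ω ⟨h1, h2⟩
    simp only [Set.mem_ofPred_eq]
    rw [expProd_eq, h1]
    apply ENNReal.ofReal_le_ofReal
    set S := ∑ s ∈ (Finset.range t).filter (fun s => ω ∈ A s), ε s ω with hS
    have e1 : (T : ℝ) ^ c = Real.exp (c * Real.log T) := by
      rw [mul_comm, Real.exp_mul, Real.exp_log hT', Real.rpow_natCast]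
    rw [e1]
    apply Real.exp_le_exp.2
    have e2 : n * (lam ^ 2 * σ ^ 2 / 2) = c * Real.log T := by
      rw [hlam, mul_pow, hδ, div_pow, hb2]
      field_simp
    have e3 : lam * S = b / (n * σ ^ 2) * (δ * S) := by rw [hlam]; ring
    have e4 : b / (n * σ ^ 2) * b = 2 * (c * Real.log T) := by
      rw [div_mul_eq_mul_div, ← sq, hb2]
      field_simp
    have e5 : b / (n * σ ^ 2) * b ≤ b / (n * σ ^ 2) * (δ * S) := by
      gcongr
    rw [e2, e3]
    linarith
  have hmark := mul_meas_ge_le_lintegral ((h.measurable_expProd lam hA t).mono (h.le t) le_rfl)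
    (μ := P) (ENNReal.ofReal ((T : ℝ) ^ c))
  rw [h.lintegral_expProd lam hA t] at hmark
  refine (measure_mono hsub).trans ?_
  rw [one_div, ENNReal.ofReal_inv_of_pos hTc, ← one_div, ENNReal.le_div_iff_mul_le]
  · rwa [mul_comm]
  · left; exact (ENNReal.ofReal_pos.2 hTc).ne'
  · left; exact ENNReal.ofReal_ne_top

open scoped Classical in
lemma GaussianNoise.measureReal_le [IsProbabilityMeasure P] (h : GaussianNoise P σ m ε)
    (hσ : 0 < σ) {A : ℕ → Set Ω}
    (hA : ∀ s, MeasurableSet[m s] (A s)) (t n c T : ℕ) (hn : 1 ≤ n) (hT : 1 ≤ T) :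
    P.real {ω | ((Finset.range t).filter fun s => ω ∈ A s).card = n ∧
      Real.sqrt (2 * c * σ ^ 2 * Real.log T * n) <
        |∑ s ∈ (Finset.range t).filter (fun s => ω ∈ A s), ε s ω|} ≤ 2 / (T : ℝ) ^ c := by
  have h1 := h.measure_le_of_side hσ hA t n c T hn hT (δ := 1) (by norm_num)
  have h2 := h.measure_le_of_side hσ hA t n c T hn hT (δ := -1) (by norm_num)
  have hT' : (0 : ℝ) < T := by exact_mod_cast hT
  have h0 : (0 : ℝ) ≤ 1 / (T : ℝ) ^ c := by positivity
  have h1' := ENNReal.toReal_mono ENNReal.ofReal_ne_top h1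
  have h2' := ENNReal.toReal_mono ENNReal.ofReal_ne_top h2
  rw [ENNReal.toReal_ofReal h0] at h1' h2'
  have e : (2 : ℝ) / (T : ℝ) ^ c = 1 / (T : ℝ) ^ c + 1 / (T : ℝ) ^ c := by ring
  rw [e]
  refine le_trans ?_ (add_le_add h1' h2')
  refine le_trans (measureReal_mono ?_ (measure_ne_top _ _)) (measureReal_union_le _ _)
  rintro ω ⟨h3, h4⟩
  rcases lt_abs.1 h4 with h5 | h5
  · exact Or.inl ⟨h3, by rwa [one_mul]⟩
  · exact Or.inr ⟨h3, by rwa [neg_one_mul]⟩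

end Noise

end ApproxZooming

namespace ApproxZooming

/-! ### The event that the noise is well behaved -/

section GoodEvent

variable {K : ℕ} {Ω : Type*} (σ L : ℝ) (T : ℕ) (R : Rules K) {F : Fin K → ℝ → ℝ}
  {X ε : ℕ → Ω → ℝ}

variable (F X ε) in
/-- Trial `s` is among the first `n` plays of the ball chosen in trial `s₀`. -/
def firstPlays (s₀ n s : ℕ) : Set Ω := {ω | s₀ ≤ s ∧
  (rEnv σ L T R F X ε ω).ball s = (rEnv σ L T R F X ε ω).ball s₀ ∧
  ((Finset.range s).filter fun s' => s₀ ≤ s' ∧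
    (rEnv σ L T R F X ε ω).ball s' = (rEnv σ L T R F X ε ω).ball s₀).card < n}

variable (F X ε) in
/-- Trial `s < t` is a sample of the same kind as trial `s₀`, and its context is at least as close
to a grid point as that of trial `r`. -/
def nearSamples (s₀ t r : ℕ) (ℓ : Fin 2) (i s : ℕ) : Set Ω := {ω | s₀ ≤ s ∧ s < t ∧
  (rEnv σ L T R F X ε ω).ball s = (rEnv σ L T R F X ε ω).ball s₀ ∧
  (rEnv σ L T R F X ε ω).arm s = (rEnv σ L T R F X ε ω).arm s₀ ∧
  (rEnv σ L T R F X ε ω).flag s = true ∧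
  |X s ω - gridPoint ((rEnv σ L T R F X ε ω).ball s₀) ℓ i| ≤
    |X r ω - gridPoint ((rEnv σ L T R F X ε ω).ball s₀) ℓ i|}

section

variable [mΩ : MeasurableSpace Ω]

lemma measFibers_ball (hF : ∀ a, Measurable (F a)) {s : ℕ} (hX : ∀ s' ≤ s, Measurable (X s'))
    (hε : ∀ s' < s, Measurable (ε s')) : MeasFibers fun ω => (rEnv σ L T R F X ε ω).ball s :=
  (measFibers_trial σ L T R hF hX hε).comp Prod.fst

lemma measFibers_arm (hF : ∀ a, Measurable (F a)) {s : ℕ} (hX : ∀ s' ≤ s, Measurable (X s'))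
    (hε : ∀ s' < s, Measurable (ε s')) : MeasFibers fun ω => (rEnv σ L T R F X ε ω).arm s :=
  (measFibers_trial σ L T R hF hX hε).comp fun p => p.2.1

lemma measFibers_flag (hF : ∀ a, Measurable (F a)) {s : ℕ} (hX : ∀ s' ≤ s, Measurable (X s'))
    (hε : ∀ s' < s, Measurable (ε s')) : MeasFibers fun ω => (rEnv σ L T R F X ε ω).flag s :=
  (measFibers_trial σ L T R hF hX hε).comp fun p => p.2.2

lemma MeasFibers.measurableSet_eq {α : Type*} [Countable α] {f g : Ω → α} (hf : MeasFibers f)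
    (hg : MeasFibers g) : MeasurableSet {ω | f ω = g ω} :=
  hg.measurableSet (p := fun v ω => f ω = v) hf

lemma measurableSet_firstPlays (hF : ∀ a, Measurable (F a)) (s₀ n s : ℕ)
    (hX : ∀ s' ≤ s, Measurable (X s')) (hε : ∀ s' < s, Measurable (ε s')) :
    MeasurableSet (firstPlays σ L T R F X ε s₀ n s) := by
  unfold firstPlays
  by_cases hs : s₀ ≤ s
  · have hb : ∀ s' ≤ s, MeasFibers fun ω => (rEnv σ L T R F X ε ω).ball s' := fun s' hs' =>
      measFibers_ball σ L T R hF (fun r hr => hX r (by omega)) fun r hr => hε r (by omega)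
    simp only [hs, true_and]
    refine MeasurableSet.inter ((hb s le_rfl).measurableSet_eq (hb s₀ hs)) ?_
    refine MeasFibers.setOf (measFibers_filter (Finset.range s) fun s' hs' => ?_)
      (fun A => A.card < n)
    rw [Finset.mem_range] at hs'
    by_cases h : s₀ ≤ s'
    · simp only [h, true_and]
      exact (hb s' hs'.le).measurableSet_eq (hb s₀ hs)
    · simp [h]
  · simp [hs]

lemma measurableSet_nearSamples (hF : ∀ a, Measurable (F a)) (s₀ t r : ℕ) (ℓ : Fin 2) (i s : ℕ)
    (hX : ∀ s', Measurable (X s')) (hε : ∀ s' < s, Measurable (ε s')) :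
    MeasurableSet (nearSamples σ L T R F X ε s₀ t r ℓ i s) := by
  unfold nearSamples
  by_cases hs : s₀ ≤ s
  · by_cases ht : s < t
    · have hε' : ∀ s' < s₀, Measurable (ε s') := fun r hr => hε r (by omega)
      have hb := measFibers_ball σ L T R hF (s := s) (fun r _ => hX r) hε
      have hb₀ := measFibers_ball σ L T R hF (s := s₀) (fun r _ => hX r) hε'
      have ha := measFibers_arm σ L T R hF (s := s) (fun r _ => hX r) hε
      have ha₀ := measFibers_arm σ L T R hF (s := s₀) (fun r _ => hX r) hε'
      have hf := measFibers_flag σ L T R hF (s := s) (fun r _ => hX r) hε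
      simp only [hs, ht, true_and]
      refine (hb.measurableSet_eq hb₀).inter ((ha.measurableSet_eq ha₀).inter
        ((hf true).inter ?_))
      refine hb₀.measurableSet (p := fun ρ ω => |X s ω - gridPoint ρ ℓ i| ≤
        |X r ω - gridPoint ρ ℓ i|) fun ρ => ?_
      have h1 := hX s
      have h2 := hX r
      apply measurableSet_le <;> fun_prop
    · simp [ht]
  · simp [hs]

end

/-- There are infinitely many possible balls, so a ball is named by the first trial that chooses it,
and the time by the number `n` of its plays. Only T² events remain, and membership among the first
`n` plays is predictable. -/
lemma exists_of_not_goodMeans {ω : Ω}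
    (h : ¬ (rEnv σ L T R F X ε ω).GoodMeans fun s => ε s ω) :
    ∃ s₀ ∈ Finset.range T, ∃ n ∈ Finset.Icc 1 T, ω ∈ {ω |
      (@Finset.filter _ (fun s => ω ∈ firstPlays σ L T R F X ε s₀ n s)
        (fun _ => Classical.propDecidable _) (Finset.range T)).card = n ∧
      Real.sqrt (2 * (3 : ℕ) * σ ^ 2 * Real.log T * n) <
        |∑ s ∈ @Finset.filter _ (fun s => ω ∈ firstPlays σ L T R F X ε s₀ n s)
          (fun _ => Classical.propDecidable _) (Finset.range T), ε s ω|} := by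
  classical
  unfold Env.GoodMeans at h
  push Not at h
  obtain ⟨ρ, t, ht, hlt⟩ := h
  have ht' : t ≤ T := ht
  set e := rEnv σ L T R F X ε ω with he
  set N := (Finset.range t).filter fun s => e.ball s = ρ with hN
  have hne : N.Nonempty := by
    by_contra hemp
    rw [Finset.not_nonempty_iff_eq_empty] at hemp
    rw [hemp] at hlt
    simp at hlt
  have hmin := N.min'_mem hne
  set s₀ := N.min' hne with hs₀
  have hmin' : ∀ s ∈ N, s₀ ≤ s := fun s hs => N.min'_le s hs
  have hmem : ∀ s, s ∈ N ↔ s < t ∧ e.ball s = ρ := by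
    intro s
    simp [hN]
  have hb₀ := (hmem s₀).1 hmin
  have hNT : N.card ≤ T := by
    refine (Finset.card_filter_le _ _).trans ?_
    simpa using ht'
  refine ⟨s₀, Finset.mem_range.2 (by omega), N.card,
    Finset.mem_Icc.2 ⟨Finset.card_pos.2 hne, hNT⟩, ?_⟩
  have hfilter : ∀ inst : ∀ s, Decidable (ω ∈ firstPlays σ L T R F X ε s₀ N.card s),
      @Finset.filter _ (fun s => ω ∈ firstPlays σ L T R F X ε s₀ N.card s) inst
      (Finset.range T) = N := by
    intro inst
    ext s
    rw [Finset.mem_filter, Finset.mem_range, hmem]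
    simp only [firstPlays, Set.mem_ofPred_eq, ← he, hb₀.2]
    constructor
    · rintro ⟨-, -, h2, h3⟩
      refine ⟨?_, h2⟩
      by_contra h4
      refine absurd (Finset.card_le_card ?_) (not_le.2 h3)
      intro s' hs'
      have h5 := (hmem s').1 hs'
      exact Finset.mem_filter.2 ⟨Finset.mem_range.2 (by omega), hmin' s' hs', h5.2⟩
    · rintro ⟨h1, h2⟩
      have hsN := (hmem s).2 ⟨h1, h2⟩
      refine ⟨by omega, hmin' s hsN, h2, ?_⟩
      apply Finset.card_lt_card
      rw [Finset.ssubset_iff_of_subset]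
      · exact ⟨s, hsN, by simp⟩
      · intro s' hs'
        rw [Finset.mem_filter, Finset.mem_range] at hs'
        exact (hmem s').2 ⟨by omega, hs'.2.2⟩
  simp only [Set.mem_ofPred_eq]
  rw [hfilter]
  refine ⟨rfl, ?_⟩
  have : (2 * ((3 : ℕ) : ℝ) * σ ^ 2 * Real.log T * N.card) =
      6 * e.σ ^ 2 * Real.log e.T * N.card := by
    have h1 : e.σ = σ := rfl
    have h2 : e.T = T := rfl
    rw [h1, h2]
    push_cast
    ring
  rw [this]
  exact hlt

/-- A neighbour set is named by its first trial, its size, the time `t`, the trial `r` that gives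
the radius, and one of 402 grid points: 402 T⁴ events, hence the exponent 5. As `r` may be later
than `s`, the selection is predictable only if all contexts are known in advance. -/
lemma exists_of_not_goodNeighbors {ω : Ω}
    (h : ¬ (rEnv σ L T R F X ε ω).GoodNeighbors fun s => ε s ω) :
    ∃ s₀ ∈ Finset.range T, ∃ n ∈ Finset.Icc 1 T, ∃ t ∈ Finset.Icc 1 T, ∃ r ∈ Finset.range T,
      ∃ ℓ ∈ (Finset.univ : Finset (Fin 2)), ∃ i ∈ Finset.range 201, ω ∈ {ω |
      (@Finset.filter _ (fun s => ω ∈ nearSamples σ L T R F X ε s₀ t r ℓ i s)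
        (fun _ => Classical.propDecidable _) (Finset.range T)).card = n ∧
      Real.sqrt (2 * (5 : ℕ) * σ ^ 2 * Real.log T * n) <
        |∑ s ∈ @Finset.filter _ (fun s => ω ∈ nearSamples σ L T R F X ε s₀ t r ℓ i s)
          (fun _ => Classical.propDecidable _) (Finset.range T), ε s ω|} := by
  classical
  unfold Env.GoodNeighbors at h
  push Not at h
  obtain ⟨ρ, a, t, r, ℓ, i, ht, hr, hi, hlt⟩ := h
  have ht' : t ≤ T := ht
  set e := rEnv σ L T R F X ε ω with he
  set N := (e.sampleSet t ρ a).filter fun s => |e.x s - gridPoint ρ ℓ i| ≤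
    |e.x r - gridPoint ρ ℓ i| with hN
  have hne : N.Nonempty := by
    by_contra hemp
    rw [Finset.not_nonempty_iff_eq_empty] at hemp
    rw [hemp] at hlt
    simp at hlt
  have hmin := N.min'_mem hne
  set s₀ := N.min' hne with hs₀
  have hmin' : ∀ s ∈ N, s₀ ≤ s := fun s hs => N.min'_le s hs
  have hmem : ∀ s, s ∈ N ↔ s < t ∧ e.ball s = ρ ∧ e.arm s = a ∧ e.flag s = true ∧
      |X s ω - gridPoint ρ ℓ i| ≤ |X r ω - gridPoint ρ ℓ i| := by
    intro s
    simp only [hN, Env.sampleSet, Finset.mem_filter, Finset.mem_range, and_assoc]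
    rfl
  have hb₀ := (hmem s₀).1 hmin
  have hNT : N.card ≤ T := by
    refine (Finset.card_filter_le _ _).trans ((Finset.card_filter_le _ _).trans ?_)
    simpa using ht'
  refine ⟨s₀, Finset.mem_range.2 (by omega), N.card,
    Finset.mem_Icc.2 ⟨Finset.card_pos.2 hne, hNT⟩, t, Finset.mem_Icc.2 ⟨by omega, ht'⟩, r,
    Finset.mem_range.2 hr, ℓ, Finset.mem_univ _, i, Finset.mem_range.2 (by omega), ?_⟩
  have hfilter : ∀ inst : ∀ s, Decidable (ω ∈ nearSamples σ L T R F X ε s₀ t r ℓ i s),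
      @Finset.filter _ (fun s => ω ∈ nearSamples σ L T R F X ε s₀ t r ℓ i s) inst
      (Finset.range T) = N := by
    intro inst
    ext s
    rw [Finset.mem_filter, Finset.mem_range, hmem]
    simp only [nearSamples, Set.mem_ofPred_eq, ← he, hb₀.2.1, hb₀.2.2.1]
    constructor
    · rintro ⟨-, -, h⟩
      exact h
    · intro h
      exact ⟨by omega, hmin' s ((hmem s).2 h), h⟩
  simp only [Set.mem_ofPred_eq]
  rw [hfilter]
  refine ⟨rfl, ?_⟩
  have : (2 * ((5 : ℕ) : ℝ) * σ ^ 2 * Real.log T * N.card) =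
      10 * e.σ ^ 2 * Real.log e.T * N.card := by
    have h1 : e.σ = σ := rfl
    have h2 : e.T = T := rfl
    rw [h1, h2]
    push_cast
    ring
  rw [this]
  exact hlt

variable {mΩ : MeasurableSpace Ω} {P : Measure Ω} {m : ℕ → MeasurableSpace Ω}

lemma measureReal_biUnion_le_card_mul {ι : Type*} (I : Finset ι) (S : ι → Set Ω) {b : ℝ}
    (hS : ∀ i ∈ I, P.real (S i) ≤ b) : P.real (⋃ i ∈ I, S i) ≤ I.card * b := by
  refine (measureReal_biUnion_finset_le I S).trans ?_
  rw [← nsmul_eq_mul]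
  exact Finset.sum_le_card_nsmul I _ _ hS

/-- The noise is well behaved with probability at least `1 - 806 / T`. -/
lemma GaussianNoise.measureReal_not_good_le [IsProbabilityMeasure P] (h : GaussianNoise P σ m ε) (hσ : 0 < σ)
    (hT : 1 ≤ T) (hF : ∀ a, Measurable (F a)) (hX : ∀ s t, Measurable[m s] (X t)) :
    P.real {ω | ¬ ((rEnv σ L T R F X ε ω).GoodMeans (fun s => ε s ω) ∧
      (rEnv σ L T R F X ε ω).GoodNeighbors fun s => ε s ω)} ≤ 806 / T := by
  have hT' : (0 : ℝ) < T := by exact_mod_cast hT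
  have hε : ∀ s, ∀ s' < s, Measurable[m s] (ε s') := fun s s' hs =>
    (h.adapted s').mono (h.mono (by omega)) le_rfl
  have h1 : ∀ s₀ n s, MeasurableSet[m s] (firstPlays σ L T R F X ε s₀ n s) := fun s₀ n s =>
    @measurableSet_firstPlays K Ω σ L T R F X ε (m s) hF s₀ n s (fun s' _ => hX s s') (hε s)
  have h2 : ∀ s₀ t r ℓ i s, MeasurableSet[m s] (nearSamples σ L T R F X ε s₀ t r ℓ i s) :=
    fun s₀ t r ℓ i s => @measurableSet_nearSamples K Ω σ L T R F X ε (m s) hF s₀ t r ℓ i s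
      (hX s) (hε s)
  set I₁ := Finset.range T ×ˢ Finset.Icc 1 T with hI₁
  set I₂ := Finset.range T ×ˢ Finset.Icc 1 T ×ˢ Finset.Icc 1 T ×ˢ Finset.range T ×ˢ
    (Finset.univ : Finset (Fin 2)) ×ˢ Finset.range 201 with hI₂
  have hb₁ := measureReal_biUnion_le_card_mul (P := P) I₁ _ (b := 2 / (T : ℝ) ^ 3)
    fun p hp => h.measureReal_le hσ (h1 p.1 p.2) T p.2 3 T
      (Finset.mem_Icc.1 (Finset.mem_product.1 hp).2).1 hT
  have hb₂ := measureReal_biUnion_le_card_mul (P := P) I₂ _ (b := 2 / (T : ℝ) ^ 5)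
    fun p hp => h.measureReal_le hσ (h2 p.1 p.2.2.1 p.2.2.2.1 p.2.2.2.2.1 p.2.2.2.2.2) T p.2.1 5 T
      (Finset.mem_Icc.1 (Finset.mem_product.1 (Finset.mem_product.1 hp).2).1).1 hT
  -- T² events of probability at most 2/T³ here, and 402 T⁴ events of probability at most 2/T⁵
  -- below.
  have hc₁ : (I₁.card : ℝ) * (2 / (T : ℝ) ^ 3) = 2 / T := by
    rw [hI₁]
    simp only [Finset.card_product, Finset.card_range, Nat.card_Icc]
    push_cast
    field_simp
  have hc₂ : (I₂.card : ℝ) * (2 / (T : ℝ) ^ 5) = 804 / T := by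
    rw [hI₂]
    simp only [Finset.card_product, Finset.card_range, Nat.card_Icc, Finset.card_univ,
      Fintype.card_fin, Nat.add_sub_cancel]
    push_cast
    field_simp
    norm_num
  rw [hc₁] at hb₁
  rw [hc₂] at hb₂
  have hsum : (806 : ℝ) / T = 2 / T + 804 / T := by ring
  rw [hsum]
  refine le_trans ?_ (add_le_add hb₁ hb₂)
  refine le_trans (measureReal_mono ?_ (measure_ne_top _ _)) (measureReal_union_le _ _)
  intro ω hω
  simp only [Set.mem_ofPred_eq, not_and_or] at hω
  rcases hω with hω | hω
  · left
    obtain ⟨s₀, hs₀, n, hn, hm⟩ := exists_of_not_goodMeans σ L T R hω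
    rw [Set.mem_iUnion₂]
    exact ⟨(s₀, n), Finset.mem_product.2 ⟨hs₀, hn⟩, hm⟩
  · right
    obtain ⟨s₀, hs₀, n, hn, t, ht, r, hr, ℓ, hℓ, i, hi, hm⟩ :=
      exists_of_not_goodNeighbors σ L T R hω
    rw [Set.mem_iUnion₂]
    refine ⟨(s₀, n, t, r, ℓ, i), ?_, hm⟩
    simp only [hI₂, Finset.mem_product]
    exact ⟨hs₀, hn, ht, hr, hℓ, hi⟩

end GoodEvent

end ApproxZooming

namespace ApproxZooming

/-! ### Contexts and noise -/

section Input

variable {Ω : Type*} {mΩ : MeasurableSpace Ω} {P : Measure Ω} {σ : ℝ} {X ε : ℕ → Ω → ℝ}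

/-- The family that consists of all contexts and noise terms. -/
def pairFamily (X ε : ℕ → Ω → ℝ) (p : ℕ × Bool) : Ω → ℝ := cond p.2 (X p.1) (ε p.1)

/-- Uniform contexts and centered Gaussian noise with variance `σ²`, all independent. -/
structure IsInput (P : Measure Ω) (σ : ℝ) (X ε : ℕ → Ω → ℝ) : Prop where
  measurable_context : ∀ t, Measurable (X t)
  measurable_noise : ∀ t, Measurable (ε t)
  mem : ∀ t ω, X t ω ∈ Set.Icc (0 : ℝ) 1
  law_context : ∀ t, P.map (X t) = volume.restrict (Set.Icc 0 1)
  law_noise : ∀ t, P.map (ε t) = gaussianReal 0 (Real.toNNReal (σ ^ 2))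
  indep : iIndepFun (pairFamily X ε) P

lemma iIndepFun_bool [IsProbabilityMeasure P] {U : Bool → Ω → ℝ}
    (h : IndepFun (U true) (U false) P) : iIndepFun U P := by
  rw [iIndepFun_iff_measure_inter_preimage_eq_mul]
  intro S s hs
  have h0 := h.measure_inter_preimage_eq_mul (s true) (s false)
  by_cases ht : true ∈ S <;> by_cases hf : false ∈ S
  · have hS : S = {true, false} := by ext b; cases b <;> simp [ht, hf]
    subst hS
    rw [Finset.set_biInter_insert, Finset.set_biInter_singleton, Finset.prod_pair (by simp)]
    exact h0 (hs _ ht) (hs _ hf)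
  · have hS : S = {true} := by ext b; cases b <;> simp [ht, hf]
    subst hS
    simp
  · have hS : S = {false} := by ext b; cases b <;> simp [ht, hf]
    subst hS
    simp
  · have hS : S = ∅ := by ext b; cases b <;> simp [ht, hf]
    subst hS
    simp

/-- Independence over `t` of the pairs and independence within each pair combine to independence of
one family indexed by `ℕ × Bool`. Every notion of past is then generated by a subset of the indices.
-/
lemma isInput_of_unitInterval [IsProbabilityMeasure P] {X : ℕ → Ω → unitInterval}
    (hX : ∀ t, Measurable (X t)) (hε : ∀ t, Measurable (ε t)) (hlX : ∀ t, P.map (X t) = volume)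
    (hlε : ∀ t, P.map (ε t) = gaussianReal 0 ⟨σ ^ 2, sq_nonneg σ⟩)
    (h : ∀ t, IndepFun (X t) (ε t) P) (hi : iIndepFun (fun t ω => (X t ω, ε t ω)) P) :
    IsInput P σ (fun t ω => (X t ω : ℝ)) ε := by
  have hX' : ∀ t, Measurable fun ω => (X t ω : ℝ) := fun t => measurable_subtype_coe.comp (hX t)
  refine ⟨hX', hε, fun t ω => (X t ω).2, fun t => ?_, fun t => ?_, ?_⟩
  · rw [← unitInterval.measurePreserving_coe.map_eq, ← hlX t,
      Measure.map_map measurable_subtype_coe (hX t)]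
    rfl
  · rw [hlε t]
    congr 1
    ext
    rw [Real.coe_toNNReal _ (sq_nonneg σ)]
    rfl
  · refine iIndepFun_uncurry'
      (X := fun (t : ℕ) (b : Bool) => cond b (fun ω => (X t ω : ℝ)) (ε t)) ?_ ?_ ?_
    · rintro t (_ | _)
      · exact hε t
      · exact hX' t
    · have := hi.comp (fun _ p b => cond b (p.1 : ℝ) p.2) fun _ => by
        refine measurable_pi_lambda _ ?_
        rintro (_ | _)
        · exact measurable_snd
        · exact measurable_subtype_coe.comp measurable_fst
      refine (iIndepFun_congr fun t => ?_).1 this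
      refine Filter.Eventually.of_forall fun ω => ?_
      funext b
      cases b <;> rfl
    · intro t
      apply iIndepFun_bool
      exact (h t).comp measurable_subtype_coe measurable_id

namespace IsInput

/-- The information in the contexts and noise terms with indices in `I`. -/
abbrev sigmaAlg (X ε : ℕ → Ω → ℝ) (I : Set (ℕ × Bool)) : MeasurableSpace Ω :=
  ⨆ p ∈ I, MeasurableSpace.comap (pairFamily X ε p) inferInstance

lemma measurable_pairFamily (h : IsInput P σ X ε) (p : ℕ × Bool) :
    Measurable (pairFamily X ε p) := by
  rcases p with ⟨t, _ | _⟩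
  · exact h.measurable_noise t
  · exact h.measurable_context t

lemma sigmaAlg_le (h : IsInput P σ X ε) (I : Set (ℕ × Bool)) : sigmaAlg X ε I ≤ mΩ :=
  iSup₂_le fun p _ => (h.measurable_pairFamily p).comap_le

lemma measurable_sigmaAlg {I : Set (ℕ × Bool)} {p : ℕ × Bool} (hp : p ∈ I) :
    Measurable[sigmaAlg X ε I] (pairFamily X ε p) :=
  (comap_measurable _).mono
    (le_iSup₂ (f := fun p (_ : p ∈ I) => MeasurableSpace.comap (pairFamily X ε p) inferInstance)
      p hp) le_rfl

lemma sigmaAlg_mono {I J : Set (ℕ × Bool)} (h : I ⊆ J) : sigmaAlg X ε I ≤ sigmaAlg X ε J :=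
  biSup_mono fun _ hp => h hp

lemma indep_sigmaAlg (h : IsInput P σ X ε) {I : Set (ℕ × Bool)} {p : ℕ × Bool} (hp : p ∉ I) :
    Indep (sigmaAlg X ε I) (MeasurableSpace.comap (pairFamily X ε p) inferInstance) P := by
  have := indep_iSup_of_disjoint (fun q => (h.measurable_pairFamily q).comap_le) h.indep.iIndep
    (Set.disjoint_singleton_right.2 hp)
  simpa [sigmaAlg] using this

/-- All contexts and the noise before trial `s`. -/
abbrev noisePast (X ε : ℕ → Ω → ℝ) (s : ℕ) : MeasurableSpace Ω :=
  sigmaAlg X ε {p | p.2 = true ∨ p.1 < s}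

lemma measurable_noisePast (s t : ℕ) : Measurable[noisePast X ε s] (X t) :=
  measurable_sigmaAlg (p := (t, true)) (Or.inl rfl)

/-- All contexts are revealed from the start, because neighbour sets depend on contexts of later
trials; the noise is still independent of them. -/
lemma gaussianNoise (h : IsInput P σ X ε) : GaussianNoise P σ (noisePast X ε) ε where
  le _ := h.sigmaAlg_le _
  mono s t hst := sigmaAlg_mono fun p hp => hp.imp id fun h' => lt_of_lt_of_le h' hst
  adapted s := measurable_sigmaAlg (p := (s, false)) (Or.inr (Nat.lt_succ_self s))
  indep s := h.indep_sigmaAlg (p := (s, false)) (by simp)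
  law := h.law_noise

/-- Contexts and noise before trial `t`. -/
abbrev past (X ε : ℕ → Ω → ℝ) (t : ℕ) : MeasurableSpace Ω := sigmaAlg X ε {p | p.1 < t}

lemma measurable_past_context {s t : ℕ} (hst : s < t) : Measurable[past X ε t] (X s) :=
  measurable_sigmaAlg (p := (s, true)) hst

lemma measurable_past_noise {s t : ℕ} (hst : s < t) : Measurable[past X ε t] (ε s) :=
  measurable_sigmaAlg (p := (s, false)) hst

/-- Unlike `noisePast`, this filtration keeps the current context fresh. It serves the count of
flagged plays. -/
lemma indep_past (h : IsInput P σ X ε) (t : ℕ) :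
    Indep (past X ε t) (MeasurableSpace.comap (X t) inferInstance) P :=
  h.indep_sigmaAlg (p := (t, true)) (by simp)

lemma measureReal_context (h : IsInput P σ X ε) (t : ℕ) {p q : ℝ} (hp : 0 ≤ p) (hpq : p ≤ q)
    (hq : q ≤ 1) : P.real (X t ⁻¹' Set.Icc p q) = q - p := by
  rw [Measure.real, ← Measure.map_apply (h.measurable_context t) measurableSet_Icc,
    h.law_context t, Measure.restrict_apply measurableSet_Icc,
    Set.inter_eq_left.2 (Set.Icc_subset_Icc hp hq), Real.volume_Icc,
    ENNReal.toReal_ofReal (by linarith)]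

lemma measureReal_inter_context (h : IsInput P σ X ε) (t : ℕ) {B : Set Ω}
    (hB : MeasurableSet[past X ε t] B) {p q : ℝ} (hp : 0 ≤ p) (hpq : p ≤ q)
    (hq : q ≤ 1) : P.real (B ∩ X t ⁻¹' Set.Icc p q) = P.real B * (q - p) := by
  rw [← h.measureReal_context t hp hpq hq]
  have := (Indep_iff _ _ _).1 (h.indep_past t) B (X t ⁻¹' Set.Icc p q) hB
    ⟨_, measurableSet_Icc, rfl⟩
  simp only [Measure.real, this, ENNReal.toReal_mul]

lemma ae_irrational (h : IsInput P σ X ε) : ∀ᵐ ω ∂P, ∀ t, Irrational (X t ω) := by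
  rw [ae_all_iff]
  intro t
  have h1 : ∀ᵐ z ∂(P.map (X t)), Irrational z := by
    rw [h.law_context t]
    exact (Set.countable_range ((↑) : ℚ → ℝ)).ae_notMem _
  exact ae_of_ae_map (h.measurable_context t).aemeasurable h1

/-- The joint law of two contexts is a product, and each vertical section of the graph of `g` is a
point, a null set for the uniform law. -/
lemma ae_ne_comp [IsProbabilityMeasure P] (h : IsInput P σ X ε) {s t : ℕ} (hst : s ≠ t)
    {g : ℝ → ℝ} (hg : Measurable g) : ∀ᵐ ω ∂P, X t ω ≠ g (X s ω) := by
  have hs := h.measurable_context s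
  have ht := h.measurable_context t
  have hind : IndepFun (X s) (X t) P :=
    h.indep.indepFun (i := (s, true)) (j := (t, true)) (by simp [hst])
  have hm : MeasurableSet {p : ℝ × ℝ | p.2 = g p.1} :=
    measurableSet_eq_fun measurable_snd (hg.comp measurable_fst)
  have h1 : ∀ᵐ p ∂(P.map fun ω => (X s ω, X t ω)), p ∉ {p : ℝ × ℝ | p.2 = g p.1} := by
    rw [(indepFun_iff_map_prod_eq_prod_map_map hs.aemeasurable ht.aemeasurable).1 hind,
      h.law_context s, h.law_context t, ← measure_eq_zero_iff_ae_notMem,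
      Measure.measure_prod_null hm]
    refine Filter.Eventually.of_forall fun z => ?_
    have : Prod.mk z ⁻¹' {p : ℝ × ℝ | p.2 = g p.1} = {g z} := by ext; simp
    simp [this]
  exact ae_of_ae_map (hs.prodMk ht).aemeasurable h1

lemma ae_noTies [IsProbabilityMeasure P] (h : IsInput P σ X ε) :
    ∀ᵐ ω ∂P, ∀ s t, s ≠ t → X s ω ≠ X t ω ∧ Irrational (X s ω + X t ω) := by
  rw [ae_all_iff]
  intro s
  rw [ae_all_iff]
  intro t
  rcases eq_or_ne s t with hst | hst
  · exact Filter.Eventually.of_forall fun ω h' => absurd hst h'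
  · have h1 := h.ae_ne_comp hst measurable_id
    have h2 : ∀ᵐ ω ∂P, ∀ q : ℚ, X t ω ≠ q - X s ω := by
      rw [ae_all_iff]
      intro q
      exact h.ae_ne_comp hst (g := fun z => q - z) (measurable_const.sub measurable_id)
    filter_upwards [h1, h2] with ω h1 h2 _
    refine ⟨fun h' => h1 h'.symm, ?_⟩
    rintro ⟨q, hq⟩
    exact h2 q (by linarith)

end IsInput

end Input

end ApproxZooming

namespace ApproxZooming

/-! ### The expected number of plays over a dyadic interval -/

lemma Ball.sub_eq_of_level_index {K : ℕ} {ρ ρ' : Ball K} (h1 : ρ.level = ρ'.level)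
    (h2 : ρ.index = ρ'.index) (q : Fin 64) : Env.sub ρ q = Env.sub ρ' q := by
  unfold Env.sub
  rw [Ball.width_eq, Ball.width_eq]
  unfold Ball.lo
  rw [h1, h2]

lemma Ball.mem_of_mem_sub {K : ℕ} {ρ : Ball K} {q : Fin 64} {z : ℝ} (h : z ∈ Env.sub ρ q) :
    z ∈ Set.Icc ρ.lo ρ.hi := by
  have hw := ρ.width_pos
  have h0 : (0 : ℝ) ≤ (q : ℕ) := by positivity
  have h1 : ((q : ℕ) : ℝ) + 1 ≤ 64 := by exact_mod_cast q.2
  rw [hi_eq]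
  obtain ⟨h2, h3⟩ := h
  constructor
  · have : 0 ≤ (q : ℝ) * ρ.width / 64 := by positivity
    linarith
  · have : ((q : ℝ) + 1) * ρ.width ≤ 64 * ρ.width := by gcongr
    linarith

section Selected

variable {K : ℕ}

/-- At the context `z` a flagged ball with level `i` and index `j` would be selected in
trial `t`. -/
def Env.FlagAt (e : Env K) (i j : ℕ) (z : ℝ) (t : ℕ) : Prop :=
  (selectBall e.σ e.L e.T e.R (e.st t) z).2 = true ∧
    (selectBall e.σ e.L e.T e.R (e.st t) z).1.level = i ∧
    (selectBall e.σ e.L e.T e.R (e.st t) z).1.index = j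

/-- The arm selected at the context `z` lacks data in the `q`-th subinterval. -/
def Env.LackAt (e : Env K) (z : ℝ) (t : ℕ) (q : Fin 64) : Prop :=
  e.subCount t (selectBall e.σ e.L e.T e.R (e.st t) z).1 (selectArm e.σ e.L e.T e.R (e.st t) z) q <
    numNeighbors e.σ e.L e.T (selectBall e.σ e.L e.T e.R (e.st t) z).1

variable {e : Env K} {i j t : ℕ} {z : ℝ}

/-- Replaces the random context by a fixed irrational point `z` of the interval, so that what
remains is an event about the past. -/
lemma Env.flagAt_of_over (hz : Irrational z) (hx : Irrational (e.x t)) {ρ : Ball K}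
    (hl : ρ.level = i) (hj : ρ.index = j) (hzρ : z ∈ Set.Icc ρ.lo ρ.hi)
    (h : e.Over i j t) (hf : e.flag t = true) :
    e.FlagAt i j z t ∧ e.x t ∈ Set.Icc ρ.lo ρ.hi := by
  have hmem := (e.ball_of_flag hf).2.1
  have h1 := Ball.mem_iff_of_level_index (ρ := e.ball t) (ρ' := ρ) (h.1.trans hl.symm)
    (h.2.trans hj.symm)
  have hsel : selectBall e.σ e.L e.T e.R (e.st t) z = selectBall e.σ e.L e.T e.R (e.st t) (e.x t) :=
    selectBall_eq_of_flagged hx hz hf ((h1 z).2 hzρ)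
  refine ⟨?_, (h1 _).1 hmem⟩
  unfold FlagAt
  rw [hsel]
  exact ⟨hf, h.1, h.2⟩

lemma Env.flagAt_mem (hf : (selectBall e.σ e.L e.T e.R (e.st t) z).2 = true) :
    (selectBall e.σ e.L e.T e.R (e.st t) z).1 ∈ (e.st t).flagged := by
  have h1 := selectBall_flagged hf
  rw [mem_argmaxSet, mem_containing] at h1
  exact h1.1.1

lemma Env.exists_lackAt (hK : 1 ≤ K) (hx : ∀ t, e.x t ∈ Set.Icc (0 : ℝ) 1)
    (hk : ∀ ρ : Ball K, ρ.arms.Nonempty → 1 ≤ numNeighbors e.σ e.L e.T ρ)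
    (hf : e.FlagAt i j z t) : ∃ q, e.LackAt z t q := by
  have h1 := e.exists_not_suffData hK hx hk t _ (Env.flagAt_mem hf.1)
  have h2 := not_suffData_selectArm hf.1 h1
  rw [Env.suffData_iff] at h2
  push Not at h2
  exact h2

/-- The return from the fixed point `z` to the actual context: every irrational context in the
deficient subinterval leads to the same ball and the same arm as `z`. -/
lemma Env.useful_of_lackAt (hK : 1 ≤ K) (hx : ∀ t, e.x t ∈ Set.Icc (0 : ℝ) 1)
    (hk : ∀ ρ : Ball K, ρ.arms.Nonempty → 1 ≤ numNeighbors e.σ e.L e.T ρ)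
    (hz : Irrational z) (hxt : Irrational (e.x t)) {ρ : Ball K}
    (hl : ρ.level = i) (hj : ρ.index = j) (hf : e.FlagAt i j z t) {q : Fin 64}
    (hq : e.LackAt z t q) (hm : e.x t ∈ Env.sub ρ q) : e.Useful i j q t := by
  have h1 := Ball.mem_iff_of_level_index (hf.2.1.trans hl.symm) (hf.2.2.trans hj.symm)
  have hsel := selectBall_eq_of_flagged hz hxt hf.1 ((h1 _).2 (Ball.mem_of_mem_sub hm))
  have harm := selectArm_eq_of_flagged hsel hf.1
    (e.exists_not_suffData hK hx hk t _ (Env.flagAt_mem hf.1))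
  unfold Useful Over ball flag arm
  rw [hsel, harm]
  refine ⟨hf.2, hf.1, ?_, hq⟩
  rwa [Ball.sub_eq_of_level_index (hf.2.1.trans hl.symm) (hf.2.2.trans hj.symm)]

end Selected

section Probability

variable {Ω : Type*} {mΩ : MeasurableSpace Ω} {P : Measure Ω}

open scoped Classical in
lemma sum_measureReal_le_of_card_le [IsProbabilityMeasure P] {A : ℕ → Set Ω} (hA : ∀ s, MeasurableSet (A s)) (t : ℕ) {c : ℝ}
    (h : ∀ᵐ ω ∂P, (((Finset.range t).filter fun s => ω ∈ A s).card : ℝ) ≤ c) :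
    ∑ s ∈ Finset.range t, P.real (A s) ≤ c := by
  have h1 : ∀ s ∈ Finset.range t, Integrable ((A s).indicator fun _ => (1 : ℝ)) P :=
    fun s _ => (integrable_const 1).indicator (hA s)
  have h2 : ∑ s ∈ Finset.range t, P.real (A s) =
      ∫ ω, ∑ s ∈ Finset.range t, (A s).indicator (fun _ => (1 : ℝ)) ω ∂P := by
    rw [integral_finsetSum _ h1]
    refine Finset.sum_congr rfl fun s _ => ?_
    rw [integral_indicator (hA s)]
    simp
  rw [h2]
  have h3 : ∫ _, c ∂P = c := by simp
  rw [← h3]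
  refine integral_mono_ae (integrable_finsetSum _ h1) (integrable_const c) ?_
  filter_upwards [h] with ω hω
  refine le_trans (le_of_eq ?_) hω
  rw [Finset.card_filter]
  push_cast
  exact Finset.sum_congr rfl fun s _ => by simp [Set.indicator_apply]

variable {K : ℕ} {σ L : ℝ} {T : ℕ} {R : Rules K} {F : Fin K → ℝ → ℝ} {X ε : ℕ → Ω → ℝ}

lemma IsInput.measurableSet_over (h : IsInput P σ X ε) (hF : ∀ a, Measurable (F a)) (i j t : ℕ) :
    MeasurableSet {ω | (rEnv σ L T R F X ε ω).Over i j t} :=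
  (measFibers_ball σ L T R hF (fun s _ => h.measurable_context s)
    fun s _ => h.measurable_noise s).setOf fun ρ => ρ.level = i ∧ ρ.index = j

lemma IsInput.measurableSet_flag (h : IsInput P σ X ε) (hF : ∀ a, Measurable (F a)) (t : ℕ)
    (b : Bool) : MeasurableSet {ω | (rEnv σ L T R F X ε ω).flag t = b} :=
  measFibers_flag σ L T R hF (fun s _ => h.measurable_context s)
    (fun s _ => h.measurable_noise s) b

lemma IsInput.measurableSet_useful (h : IsInput P σ X ε) (hF : ∀ a, Measurable (F a))
    (i j : ℕ) (q : Fin 64) (t : ℕ) :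
    MeasurableSet {ω | (rEnv σ L T R F X ε ω).Useful i j q t} := by
  have h1 := measFibers_trial σ L T R hF (t := t) (fun s _ => h.measurable_context s)
    fun s _ => h.measurable_noise s
  refine h1.measurableSet (p := fun v ω => (v.1.level = i ∧ v.1.index = j) ∧ v.2.2 = true ∧
    X t ω ∈ Env.sub v.1 q ∧ (rEnv σ L T R F X ε ω).subCount t v.1 v.2.1 q <
      numNeighbors σ L T v.1) fun v => ?_
  refine (MeasurableSet.const _).inter ((MeasurableSet.const _).inter
    ((h.measurable_context t measurableSet_Icc).inter ?_))
  exact (measFibers_subCount σ L T R hF (fun s _ => h.measurable_context s)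
    (fun s _ => h.measurable_noise s) v.1 v.2.1 q).setOf fun n => n < numNeighbors σ L T v.1

lemma IsInput.measurableSet_flagAt (hF : ∀ a, Measurable (F a)) (i j : ℕ) (z : ℝ) (t : ℕ) :
    MeasurableSet[IsInput.past X ε t] {ω | (rEnv σ L T R F X ε ω).FlagAt i j z t} := by
  let _ := IsInput.past X ε t
  exact (measFibers_select σ L T R hF (t := t) (fun s hs => measurable_past_context hs)
    (fun s hs => measurable_past_noise hs) (measurable_const (a := z))).setOf
      fun v => v.1.2 = true ∧ v.1.1.level = i ∧ v.1.1.index = j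

lemma IsInput.measurableSet_lackAt (hF : ∀ a, Measurable (F a)) (z : ℝ) (t : ℕ) (q : Fin 64) :
    MeasurableSet[IsInput.past X ε t] {ω | (rEnv σ L T R F X ε ω).LackAt z t q} := by
  let _ := IsInput.past X ε t
  refine (measFibers_select σ L T R hF (t := t) (fun s hs => measurable_past_context hs)
    (fun s hs => measurable_past_noise hs) (measurable_const (a := z))).measurableSet
      (p := fun v ω => (rEnv σ L T R F X ε ω).subCount t v.1.1 v.2 q < numNeighbors σ L T v.1.1)
      fun v => ?_
  exact (measFibers_subCount σ L T R hF (fun s hs => measurable_past_context hs)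
    (fun s hs => measurable_past_noise hs) v.1.1 v.2 q).setOf fun n => n < numNeighbors σ L T v.1.1

/-- Let `B` be the past event that a flagged ball of this interval would be selected at `z`. A
flagged play has probability at most P(B)Δ by independence. On `B` the arm lacks data in some
subinterval `q`, and a context there, of probability Δ/64, makes the trial useful; this accounts for
the factor 64. -/
lemma IsInput.measureReal_flag_over_le [IsProbabilityMeasure P] (h : IsInput P σ X ε) (hF : ∀ a, Measurable (F a))
    (hK : 1 ≤ K) (hσ : 0 < σ) (hL : 0 < L) (hT : 2 ≤ T) {i j : ℕ} (hj : j < 2 ^ i) (t : ℕ) :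
    P.real {ω | (rEnv σ L T R F X ε ω).Over i j t ∧ (rEnv σ L T R F X ε ω).flag t = true} ≤
      64 * ∑ q : Fin 64, P.real {ω | (rEnv σ L T R F X ε ω).Useful i j q t} := by
  set ρ : Ball K := ⟨i, j, ∅⟩ with hρ
  obtain ⟨z, hz, hzρ⟩ := ρ.exists_irrational_mem
  have hk : ∀ ω, ∀ ρ : Ball K, ρ.arms.Nonempty → 1 ≤ numNeighbors (rEnv σ L T R F X ε ω).σ
      (rEnv σ L T R F X ε ω).L (rEnv σ L T R F X ε ω).T ρ := fun ω ρ hρ =>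
    (rEnv σ L T R F X ε ω).one_le_numNeighbors hσ hL hT hρ
  have hx : ∀ ω t, (rEnv σ L T R F X ε ω).x t ∈ Set.Icc (0 : ℝ) 1 := fun ω t => h.mem t ω
  set B : Set Ω := {ω | (rEnv σ L T R F X ε ω).FlagAt i j z t} with hB
  set Q : Fin 64 → Set Ω := fun q => B ∩ {ω | (rEnv σ L T R F X ε ω).LackAt z t q} with hQ
  have hBm : MeasurableSet[IsInput.past X ε t] B := IsInput.measurableSet_flagAt hF i j z t
  have hQm : ∀ q, MeasurableSet[IsInput.past X ε t] (Q q) := fun q =>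
    MeasurableSet.inter hBm (IsInput.measurableSet_lackAt hF z t q)
  have hw := ρ.width_pos
  have hlo := ρ.lo_nonneg
  have hhi : ρ.hi ≤ 1 := Ball.hi_le_one hj
  have hlh := ρ.hi_eq
  have h1 : P.real {ω | (rEnv σ L T R F X ε ω).Over i j t ∧
      (rEnv σ L T R F X ε ω).flag t = true} ≤ P.real B * ρ.width := by
    have h2 := h.measureReal_inter_context t hBm hlo (by linarith) hhi
    have h3 : ρ.hi - ρ.lo = ρ.width := by linarith
    rw [h3] at h2
    rw [← h2]
    refine ENNReal.toReal_mono (measure_ne_top _ _) (measure_mono_ae ?_)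
    filter_upwards [h.ae_irrational] with ω hω hm
    exact Env.flagAt_of_over hz (hω t) rfl rfl hzρ hm.1 hm.2
  have h2 : P.real B ≤ ∑ q, P.real (Q q) := by
    refine le_trans (measureReal_mono (h₂ := measure_ne_top _ _) (fun ω hω => ?_))
      (measureReal_iUnion_fintype_le Q)
    obtain ⟨q, hq⟩ := Env.exists_lackAt hK (hx ω) (hk ω) hω
    exact Set.mem_iUnion.2 ⟨q, hω, hq⟩
  have h3 : ∀ q, P.real (Q q) * (ρ.width / 64) ≤
      P.real {ω | (rEnv σ L T R F X ε ω).Useful i j q t} := by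
    intro q
    have h0 : (0 : ℝ) ≤ (q : ℕ) := by positivity
    have h1 : ((q : ℕ) : ℝ) + 1 ≤ 64 := by exact_mod_cast q.2
    have h5 : 0 ≤ (q : ℝ) * ρ.width / 64 := by positivity
    have h6 : ((q : ℝ) + 1) * ρ.width ≤ 64 * ρ.width := by gcongr
    have h4 := h.measureReal_inter_context t (hQm q) (p := ρ.lo + (q : ℝ) * ρ.width / 64)
      (q := ρ.lo + ((q : ℝ) + 1) * ρ.width / 64) (by linarith) (by linarith) (by linarith)
    have h7 : ρ.lo + ((q : ℝ) + 1) * ρ.width / 64 - (ρ.lo + (q : ℝ) * ρ.width / 64) =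
        ρ.width / 64 := by ring
    rw [h7] at h4
    rw [← h4]
    refine ENNReal.toReal_mono (measure_ne_top _ _) (measure_mono_ae ?_)
    filter_upwards [h.ae_irrational] with ω hω hm
    exact Env.useful_of_lackAt hK (hx ω) (hk ω) hz (hω t) (ρ := ρ) rfl rfl hm.1.1 hm.1.2 hm.2
  calc _ ≤ P.real B * ρ.width := h1
    _ ≤ (∑ q, P.real (Q q)) * ρ.width := by gcongr
    _ = 64 * ∑ q, P.real (Q q) * (ρ.width / 64) := by
      rw [← Finset.sum_mul]; ring
    _ ≤ _ := by gcongr with q; exact h3 q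

/-- The expected number of plays over a dyadic interval of level `i`. -/
lemma IsInput.sum_measureReal_over_le [IsProbabilityMeasure P] (h : IsInput P σ X ε) (hF : ∀ a, Measurable (F a))
    (hK : 1 ≤ K) (hσ : 0 < σ) (hL : 0 < L) (hT : 2 ≤ T)
    (hlog : 1 ≤ 5431 * σ ^ 2 * Real.log (T * K) / L ^ 2) {i j : ℕ} (hj : j < 2 ^ i) :
    ∑ t ∈ Finset.range T, P.real {ω | (rEnv σ L T R F X ε ω).Over i j t} ≤
      44501620 * K * (σ ^ 2 * Real.log (T * K) / L ^ 2) * 4 ^ i := by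
  classical
  have hx : ∀ ω t, (rEnv σ L T R F X ε ω).x t ∈ Set.Icc (0 : ℝ) 1 := fun ω t => h.mem t ω
  have hK' : (1 : ℝ) ≤ K := by exact_mod_cast hK
  have hT' : (2 : ℝ) ≤ T := by exact_mod_cast hT
  set G := σ ^ 2 * Real.log (T * K) / L ^ 2 with hG
  have hG1 : 1 ≤ 5431 * G := by
    rw [hG]
    refine hlog.trans (le_of_eq ?_)
    ring
  have h4 : (1 : ℝ) ≤ 4 ^ i := one_le_pow₀ (by norm_num)
  have hG4 : 1 ≤ 5431 * (G * 4 ^ i) := by nlinarith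
  have hun : ∑ t ∈ Finset.range T, P.real ({ω | (rEnv σ L T R F X ε ω).Over i j t} ∩
      {ω | (rEnv σ L T R F X ε ω).flag t = false}) ≤ K * (6 * G * 4 ^ i + 2) := by
    refine sum_measureReal_le_of_card_le (fun t => (h.measurableSet_over hF i j t).inter
      (h.measurableSet_flag hF t false)) T (Filter.Eventually.of_forall fun ω => ?_)
    have := (rEnv σ L T R F X ε ω).card_unflagged_over_le hK (hx ω)
      (show 1 ≤ T by omega) i j T
    refine le_trans (le_of_eq ?_) (this.trans ?_)
    · congr!
    · have e1 : (rEnv σ L T R F X ε ω).σ = σ := rfl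
      have e2 : (rEnv σ L T R F X ε ω).L = L := rfl
      have e3 : (rEnv σ L T R F X ε ω).T = T := rfl
      rw [e1, e2, e3]
      have e4 : Real.log T ≤ Real.log (T * K) :=
        Real.log_le_log (by linarith) (by nlinarith)
      have e5 : 6 * σ ^ 2 * Real.log T * 4 ^ i / L ^ 2 ≤ 6 * G * 4 ^ i := by
        have : 6 * G * 4 ^ i = 6 * σ ^ 2 * Real.log (T * K) * 4 ^ i / L ^ 2 := by
          rw [hG]; ring
        rw [this]
        gcongr
      gcongr
  set k := ⌈5431 * σ ^ 2 * Real.log (T * K) * 4 ^ i / L ^ 2⌉₊ with hkdef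
  -- Since 5431 G 4ⁱ ≥ 1, rounding up at most doubles the number of neighbours. The same inequality
  -- absorbs the summand 2 of the unflagged plays below.
  have hk : (k : ℝ) ≤ 10862 * (G * 4 ^ i) := by
    have e1 : 5431 * σ ^ 2 * Real.log (T * K) * 4 ^ i / L ^ 2 = 5431 * (G * 4 ^ i) := by
      rw [hG]; ring
    rw [hkdef, e1]
    refine (Nat.ceil_lt_add_one (by linarith)).le.trans ?_
    linarith
  have hus : ∀ q : Fin 64, ∑ t ∈ Finset.range T,
      P.real {ω | (rEnv σ L T R F X ε ω).Useful i j q t} ≤ K * k := by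
    intro q
    refine sum_measureReal_le_of_card_le (fun t => h.measurableSet_useful hF i j q t) T
      (Filter.Eventually.of_forall fun ω => ?_)
    have := (rEnv σ L T R F X ε ω).card_useful_le hK (hx ω) (i := i) (j := j) q (k := k) (by
      intro ρ hρ
      rw [hkdef, ← hρ]
      exact (rEnv σ L T R F X ε ω).numNeighbors_le hK (show 1 ≤ T by omega) ρ) T
    exact_mod_cast this
  have hfl : ∑ t ∈ Finset.range T, P.real {ω | (rEnv σ L T R F X ε ω).Over i j t ∧
      (rEnv σ L T R F X ε ω).flag t = true} ≤ 64 * (64 * (K * k)) := by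
    refine (Finset.sum_le_sum fun t _ =>
      h.measureReal_flag_over_le hF hK hσ hL hT hj t).trans ?_
    rw [← Finset.mul_sum, Finset.sum_comm]
    gcongr
    refine (Finset.sum_le_sum fun q _ => hus q).trans (le_of_eq ?_)
    simp
  have hsplit : ∀ t, P.real {ω | (rEnv σ L T R F X ε ω).Over i j t} ≤
      P.real ({ω | (rEnv σ L T R F X ε ω).Over i j t} ∩
        {ω | (rEnv σ L T R F X ε ω).flag t = false}) +
      P.real {ω | (rEnv σ L T R F X ε ω).Over i j t ∧ (rEnv σ L T R F X ε ω).flag t = true} := by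
    intro t
    refine le_trans (measureReal_mono (h₂ := measure_ne_top _ _) fun ω hω => ?_)
      (measureReal_union_le _ _)
    rcases hb : (rEnv σ L T R F X ε ω).flag t with _ | _
    · exact Or.inl ⟨hω, hb⟩
    · exact Or.inr ⟨hω, hb⟩
  calc _ ≤ _ := Finset.sum_le_sum fun t _ => hsplit t
    _ = _ := Finset.sum_add_distrib
    _ ≤ K * (6 * G * 4 ^ i + 2) + 64 * (64 * (K * (10862 * (G * 4 ^ i)))) := by
      refine add_le_add hun (hfl.trans ?_)
      gcongr
    _ ≤ K * (10868 * (G * 4 ^ i)) + 64 * (64 * (K * (10862 * (G * 4 ^ i)))) := by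
      gcongr
      linarith
    _ = _ := by ring

end Probability

end ApproxZooming

namespace ApproxZooming

/-! ### The expected regret -/

section Regret

variable {K : ℕ} {f : Fin K → unitInterval → ℝ}

/-- The reward functions, extended to the real line. -/
def extend (f : Fin K → unitInterval → ℝ) (a : Fin K) : ℝ → ℝ := Set.IccExtend zero_le_one (f a)

lemma extend_coe (a : Fin K) (x : unitInterval) : extend f a x = f a x :=
  Set.IccExtend_val zero_le_one (f a) x

lemma abs_extend_sub_le {L : ℝ} (hL : 0 ≤ L)
    (hf : ∀ a x x', |f a x - f a x'| ≤ L * |(x : ℝ) - (x' : ℝ)|) (a : Fin K) (z z' : ℝ) :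
    |extend f a z - extend f a z'| ≤ L * |z - z'| := by
  refine (hf a _ _).trans (mul_le_mul_of_nonneg_left ?_ hL)
  rw [Set.coe_projIcc, Set.coe_projIcc]
  exact (abs_max_sub_max_le_max _ _ _ _).trans
    (max_le (by simp) ((abs_min_sub_min_le_max _ _ _ _).trans (by simp)))

lemma measurable_extend {L : ℝ}
    (hf : ∀ a x x', |f a x - f a x'| ≤ L * |(x : ℝ) - (x' : ℝ)|) (a : Fin K) :
    Measurable (extend f a) :=
  (continuous_of_abs_sub_le (hf a)).Icc_extend'.measurable

lemma measurable_optReward {L : ℝ} (hK : 1 ≤ K)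
    (hf : ∀ a x x', |f a x - f a x'| ≤ L * |(x : ℝ) - (x' : ℝ)|) : Measurable (optReward f) := by
  refine (continuous_of_abs_sub_le (L := L) fun x x' => ?_).measurable
  rw [abs_le]
  have h1 := optReward_le_add hK hf x x'
  have h2 := optReward_le_add hK hf x' x
  rw [abs_sub_comm] at h2
  constructor <;> linarith

open scoped Classical in
/-- The dyadic intervals of level `i` that are relevant for the regret: all for `i < 2`, and those
that contain a context with small gap for `i ≥ 2`. -/
def relevant (f : Fin K → unitInterval → ℝ) (L : ℝ) (i : ℕ) : Finset ℕ :=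
  (Finset.range (2 ^ i)).filter fun j => 2 ≤ i → ∃ x : unitInterval, (j : ℝ) / 2 ^ i ≤ x ∧
    (x : ℝ) ≤ ((j : ℝ) + 1) / 2 ^ i ∧ gap f x ≤ 20 * L / 2 ^ i

/-- A bound on the regret of a trial in which a ball of level `i` is chosen. -/
def levelRegret (L : ℝ) (i : ℕ) : ℝ := if i < 2 then 1 else 14 * L / 2 ^ i

lemma levelRegret_nonneg {L : ℝ} (hL : 0 ≤ L) (i : ℕ) : 0 ≤ levelRegret L i := by
  unfold levelRegret
  split_ifs <;> positivity

lemma sub_nonneg_of_optReward (a : Fin K) (x : unitInterval) : 0 ≤ optReward f x - f a x :=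
  sub_nonneg.2 (le_optReward a x)

lemma optReward_sub_le_one (hK : 1 ≤ K) (h01 : ∀ a x, f a x ∈ Set.Icc (0 : ℝ) 1) (a : Fin K)
    (x : unitInterval) : optReward f x - f a x ≤ 1 := by
  obtain ⟨b, hb⟩ := exists_eq_optReward (f := f) hK x
  rw [← hb]
  linarith [(h01 b x).2, (h01 a x).1]

/-- Keep only the term of the chosen ball. If the played arm is suboptimal and the level is i ≥ 2,
the gap is at most the regret, which is at most 14L/2ⁱ, so the interval is relevant. Levels from `N`
on are covered by the last term. -/
lemma Env.Good.regret_le_sum {e : Env K} {ε : ℕ → ℝ} (h : e.Good ε (extend f))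
    (h01 : ∀ a x, f a x ∈ Set.Icc (0 : ℝ) 1) {t : ℕ} (ht : t < e.T) {x : unitInterval}
    (hx : e.x t = x) (N : ℕ) (hN : 2 ≤ N) :
    optReward f x - f (e.arm t) x ≤
      (∑ p ∈ (Finset.range N).sigma (relevant f e.L),
        levelRegret e.L p.1 * if e.Over p.1 p.2 t then 1 else 0) + 14 * e.L / 2 ^ N := by
  classical
  have hL := h.hL
  have hterm : ∀ p : (_ : ℕ) × ℕ, 0 ≤ levelRegret e.L p.1 * if e.Over p.1 p.2 t then 1 else 0 :=
    fun p => mul_nonneg (levelRegret_nonneg hL.le _) (by split_ifs <;> norm_num)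
  have htail : 0 ≤ 14 * e.L / 2 ^ N := by positivity
  have hmem := e.ball_mem_cur h.hK (h.inv t) (h.hx t)
  have hidx := (h.inv t).index _ hmem.1
  have hsum : ∀ p ∈ (Finset.range N).sigma (relevant f e.L), _ :=
    fun p hp => Finset.single_le_sum (fun p _ => hterm p) hp
  set i := (e.ball t).level with hi
  set j := (e.ball t).index with hj
  have hover : e.Over i j t := ⟨rfl, rfl⟩
  by_cases hopt : f (e.arm t) x = optReward f x
  · rw [hopt, sub_self]
    exact add_nonneg (Finset.sum_nonneg fun p _ => hterm p) htail
  rcases lt_or_ge i 2 with h2 | h2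
  · have hp : (⟨i, j⟩ : (_ : ℕ) × ℕ) ∈ (Finset.range N).sigma (relevant f e.L) := by
      simp only [Finset.mem_sigma, Finset.mem_range, relevant, Finset.mem_filter]
      exact ⟨by omega, hidx, fun h => by omega⟩
    have h3 := hsum _ hp
    simp only [if_pos hover, mul_one, levelRegret, if_pos h2] at h3
    refine (optReward_sub_le_one h.hK h01 _ _).trans ?_
    simp only [levelRegret]
    linarith
  · have h3 : optReward f x - f (e.arm t) x ≤ 14 * e.L / 2 ^ i := by
      obtain ⟨b, hb⟩ := exists_eq_optReward (f := f) h.hK x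
      have := h.regret_le ht h2 b
      rwa [hx, extend_coe, extend_coe, hb] at this
    rcases lt_or_ge i N with hiN | hiN
    · have hp : (⟨i, j⟩ : (_ : ℕ) × ℕ) ∈ (Finset.range N).sigma (relevant f e.L) := by
        simp only [Finset.mem_sigma, Finset.mem_range, relevant, Finset.mem_filter]
        refine ⟨hiN, hidx, fun _ => ⟨x, ?_, ?_, ?_⟩⟩
        · rw [← hx]; exact hmem.2.1
        · rw [← hx]; exact hmem.2.2
        · refine (gap_le hopt).trans (h3.trans ?_)
          gcongr
          norm_num
      have h4 := hsum _ hp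
      simp only [if_pos hover, mul_one, levelRegret, if_neg (not_lt.2 h2)] at h4
      simp only [levelRegret]
      linarith
    · have h4 : 14 * e.L / 2 ^ i ≤ 14 * e.L / 2 ^ N := by
        gcongr
        norm_num
      have := Finset.sum_nonneg (s := (Finset.range N).sigma (relevant f e.L)) fun p _ => hterm p
      linarith

/-- Levels 0 and 1 give at most 1 · 1 + 2 · 4 = 9, and level m + 2 gives 24M · 14L · 2^(m+2) = 1344
ML 2^m, a geometric sum. Keeping the `- 1` makes the second part vanish at `m = 0`, which
`exists_pow_balance` exploits. -/
lemma sum_relevant_le {L M : ℝ} (hK : 1 ≤ K) (hL : 0 < L)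
    (hf : ∀ a x x', |f a x - f a x'| ≤ L * |(x : ℝ) - (x' : ℝ)|)
    (hgap : ∀ i : ℕ, 1 ≤ i →
      (volume : Measure unitInterval).real {x | gap f x ≤ 22 * L / 2 ^ i} ≤ 22 * M / 2 ^ i)
    (m : ℕ) :
    ∑ i ∈ Finset.range (m + 2), ((relevant f L i).card : ℝ) * (levelRegret L i * 4 ^ i) ≤
      9 + 1344 * (M * L) * (2 ^ m - 1) := by
  classical
  have hcard : ∀ i, ((relevant f L i).card : ℝ) ≤ 2 ^ i := by
    intro i
    have : (relevant f L i).card ≤ 2 ^ i :=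
      (Finset.card_filter_le _ _).trans (by simp)
    exact_mod_cast this
  induction m with
  | zero =>
    have h0 := hcard 0
    have h1 := hcard 1
    norm_num [Finset.sum_range_succ, levelRegret] at h0 h1 ⊢
    have h0' : ((relevant f L 0).card : ℝ) ≤ 1 := by exact_mod_cast h0
    have h1' : ((relevant f L 1).card : ℝ) ≤ 2 := by exact_mod_cast h1
    linarith
  | succ m ih =>
    have h1 : ((relevant f L (m + 2)).card : ℝ) ≤ 24 * M := by
      refine card_smallGap_le hK hL hf hgap (i := m + 2) (by omega) _ (fun j hj => ?_) fun j hj => ?_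
      · exact Finset.mem_range.1 (Finset.mem_filter.1 hj).1
      · exact (Finset.mem_filter.1 hj).2 (by omega)
    have h2 : levelRegret L (m + 2) * 4 ^ (m + 2) = 14 * L * 2 ^ (m + 2) := by
      unfold levelRegret
      rw [if_neg (by omega)]
      have h4 : (4 : ℝ) ^ (m + 2) = 2 ^ (m + 2) * 2 ^ (m + 2) := by rw [← mul_pow]; norm_num
      rw [h4]
      field_simp
    have h3 : ((relevant f L (m + 2)).card : ℝ) * (14 * L * 2 ^ (m + 2)) ≤
        24 * M * (14 * L * 2 ^ (m + 2)) := by gcongr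
    rw [show m + 1 + 2 = (m + 2) + 1 by ring, Finset.sum_range_succ, h2]
    have h5 : (2 : ℝ) ^ (m + 2) = 4 * 2 ^ m := by ring
    have h6 : (2 : ℝ) ^ (m + 1) = 2 * 2 ^ m := by ring
    rw [h5] at h3 ⊢
    rw [h6]
    linarith

variable {Ω : Type*} {mΩ : MeasurableSpace Ω} {P : Measure Ω} {σ L : ℝ} {T : ℕ}
  {R : Rules K} {X : ℕ → Ω → unitInterval} {ε : ℕ → Ω → ℝ}

lemma playedArm_eq (ω : Ω) (t : ℕ) :
    playedArm σ L T R f (fun t => X t ω) (fun t => ε t ω) t =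
      (rEnv σ L T R (extend f) (fun t ω => (X t ω : ℝ)) ε ω).arm t := by
  unfold playedArm Env.arm Env.st rEnv mkEnv
  simp only [extend_coe]

lemma measurable_trialRegret (hK : 1 ≤ K)
    (hf : ∀ a x x', |f a x - f a x'| ≤ L * |(x : ℝ) - (x' : ℝ)|) (hX : ∀ t, Measurable (X t))
    (hε : ∀ t, Measurable (ε t)) (t : ℕ) :
    Measurable fun ω => optReward f (X t ω) -
      f (playedArm σ L T R f (fun t => X t ω) (fun t => ε t ω) t) (X t ω) := by
  refine ((measurable_optReward hK hf).comp (hX t)).sub ?_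
  simp only [playedArm_eq]
  have hX' : ∀ t, Measurable fun ω => (X t ω : ℝ) := fun t => measurable_subtype_coe.comp (hX t)
  have harm := measFibers_arm σ L T R (measurable_extend hf) (s := t) (fun s _ => hX' s)
    fun s _ => hε s
  have harm' : Measurable fun ω => (rEnv σ L T R (extend f) (fun t ω => (X t ω : ℝ)) ε ω).arm t :=
    measurable_to_countable' harm
  have hfm : Measurable fun p : Fin K × unitInterval => f p.1 p.2 :=
    measurable_from_prod_countable_right fun a => (continuous_of_abs_sub_le (hf a)).measurable
  exact hfm.comp (harm'.prodMk (hX t))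

lemma regret_mem (hK : 1 ≤ K) (h01 : ∀ a x, f a x ∈ Set.Icc (0 : ℝ) 1) (x : ℕ → unitInterval)
    (η : ℕ → ℝ) : 0 ≤ regret σ L T R f x η ∧ regret σ L T R f x η ≤ T := by
  unfold regret
  refine ⟨Finset.sum_nonneg fun t _ => sub_nonneg_of_optReward _ _, ?_⟩
  refine (Finset.sum_le_sum fun t _ => optReward_sub_le_one hK h01 _ _).trans ?_
  simp

lemma integrable_trialRegret [IsProbabilityMeasure P] (hK : 1 ≤ K)
    (h01 : ∀ a x, f a x ∈ Set.Icc (0 : ℝ) 1)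
    (hf : ∀ a x x', |f a x - f a x'| ≤ L * |(x : ℝ) - (x' : ℝ)|) (hX : ∀ t, Measurable (X t))
    (hε : ∀ t, Measurable (ε t)) (t : ℕ) :
    Integrable (fun ω => optReward f (X t ω) -
      f (playedArm σ L T R f (fun t => X t ω) (fun t => ε t ω) t) (X t ω)) P := by
  refine Integrable.of_bound (measurable_trialRegret hK hf hX hε t).aestronglyMeasurable 1
    (Filter.Eventually.of_forall fun ω => ?_)
  rw [Real.norm_eq_abs, abs_of_nonneg (sub_nonneg_of_optReward _ _)]
  exact optReward_sub_le_one hK h01 _ _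

lemma integrable_regret [IsProbabilityMeasure P] (hK : 1 ≤ K)
    (h01 : ∀ a x, f a x ∈ Set.Icc (0 : ℝ) 1)
    (hf : ∀ a x x', |f a x - f a x'| ≤ L * |(x : ℝ) - (x' : ℝ)|) (hX : ∀ t, Measurable (X t))
    (hε : ∀ t, Measurable (ε t)) :
    Integrable (fun ω => regret σ L T R f (fun t => X t ω) (fun t => ε t ω)) P :=
  integrable_finsetSum _ fun t _ => integrable_trialRegret hK h01 hf hX hε t

-- Pointwise bound off the null set of ties: regret at most 1 on the bad event, and
-- `Env.Good.regret_le_sum` elsewhere.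
open scoped Classical in
lemma integral_trialRegret_le [IsProbabilityMeasure P] (hK : 1 ≤ K) (hσ : 0 < σ) (hL : 0 < L)
    (hT : 2 ≤ T) (h01 : ∀ a x, f a x ∈ Set.Icc (0 : ℝ) 1)
    (hf : ∀ a x x', |f a x - f a x'| ≤ L * |(x : ℝ) - (x' : ℝ)|) (hX : ∀ t, Measurable (X t))
    (hin : IsInput P σ (fun t ω => (X t ω : ℝ)) ε) {t : ℕ} (ht : t < T) {N : ℕ} (hN : 2 ≤ N) :
    ∫ ω, (optReward f (X t ω) -
      f (playedArm σ L T R f (fun t => X t ω) (fun t => ε t ω) t) (X t ω)) ∂P ≤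
      806 / T + (∑ p ∈ (Finset.range N).sigma (relevant f L), levelRegret L p.1 *
        P.real {ω | (rEnv σ L T R (extend f) (fun t ω => (X t ω : ℝ)) ε ω).Over p.1 p.2 t}) +
        14 * L / 2 ^ N := by
  have hF := measurable_extend hf
  set E := rEnv σ L T R (extend f) (fun t ω => (X t ω : ℝ)) ε with hE
  have hbad := GaussianNoise.measureReal_not_good_le σ L T R hin.gaussianNoise hσ
    (show 1 ≤ T by omega) hF fun s t => IsInput.measurable_noisePast s t
  set Bad : Set Ω := {ω | ¬ ((E ω).GoodMeans (fun s => ε s ω) ∧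
    (E ω).GoodNeighbors fun s => ε s ω)} with hBad
  -- A measurable superset of the same measure spares proving that the bad event is measurable.
  set Bad' := toMeasurable P Bad with hBad'
  have hBm : MeasurableSet Bad' := measurableSet_toMeasurable _ _
  have hb' : P.real Bad' ≤ 806 / T := by
    rwa [Measure.real, hBad', measure_toMeasurable]
  have hOm : ∀ p : (_ : ℕ) × ℕ, MeasurableSet {ω | (E ω).Over p.1 p.2 t} := fun p =>
    hin.measurableSet_over hF p.1 p.2 t
  have hi1 : Integrable (Bad'.indicator fun _ => (1 : ℝ)) P :=
    (integrable_const 1).indicator hBm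
  have hi2 : ∀ p ∈ (Finset.range N).sigma (relevant f L), Integrable (fun ω => levelRegret L p.1 *
      {ω | (E ω).Over p.1 p.2 t}.indicator (fun _ => (1 : ℝ)) ω) P := fun p _ =>
    ((integrable_const 1).indicator (hOm p)).const_mul _
  set V : Ω → ℝ := fun ω => ∑ p ∈ (Finset.range N).sigma (relevant f L), levelRegret L p.1 *
    {ω | (E ω).Over p.1 p.2 t}.indicator (fun _ => (1 : ℝ)) ω with hV
  have hVi : Integrable V P := integrable_finsetSum _ hi2
  have hUV : Integrable (fun ω => Bad'.indicator (fun _ => (1 : ℝ)) ω + V ω) P := hi1.add hVi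
  have hVint : ∫ ω, V ω ∂P = ∑ p ∈ (Finset.range N).sigma (relevant f L), levelRegret L p.1 *
      P.real {ω | (E ω).Over p.1 p.2 t} := by
    rw [hV, integral_finsetSum _ hi2]
    refine Finset.sum_congr rfl fun p _ => ?_
    rw [integral_const_mul, integral_indicator (hOm p)]
    simp
  have hrhs : ∫ ω, (Bad'.indicator (fun _ => (1 : ℝ)) ω + V ω + 14 * L / 2 ^ N) ∂P ≤
      806 / T + (∑ p ∈ (Finset.range N).sigma (relevant f L), levelRegret L p.1 *
        P.real {ω | (E ω).Over p.1 p.2 t}) + 14 * L / 2 ^ N := by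
    rw [integral_add hUV (integrable_const _), integral_add hi1 hVi, hVint,
      integral_indicator hBm]
    simpa using hb'
  refine le_trans (integral_mono_ae (integrable_trialRegret hK h01 hf hX
    hin.measurable_noise t) (hUV.add (integrable_const _)) ?_)
    hrhs
  filter_upwards [hin.ae_noTies] with ω hties
  have hnn : 0 ≤ V ω :=
    Finset.sum_nonneg fun p _ => mul_nonneg (levelRegret_nonneg hL.le _)
      (Set.indicator_nonneg (fun _ _ => zero_le_one) _)
  have htail : 0 ≤ 14 * L / 2 ^ N := by positivity
  change _ ≤ Bad'.indicator (fun _ => (1 : ℝ)) ω + V ω + 14 * L / 2 ^ N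
  by_cases hω : ω ∈ Bad
  · have : Bad'.indicator (fun _ => (1 : ℝ)) ω = 1 := by
      rw [Set.indicator_of_mem (subset_toMeasurable P Bad hω)]
    rw [this]
    linarith [optReward_sub_le_one hK h01
      (playedArm σ L T R f (fun t => X t ω) (fun t => ε t ω) t) (X t ω)]
  · rw [hBad, Set.mem_ofPred_eq, not_not] at hω
    have hgood : (E ω).Good (fun s => ε s ω) (extend f) :=
      ⟨hK, hσ, hL, hT, fun t => hin.mem t ω, hties, fun _ _ => rfl,
        abs_extend_sub_le hL.le hf, hω.2, hω.1⟩
    have h1 := hgood.regret_le_sum h01 (t := t) ht (x := X t ω) rfl N hN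
    rw [playedArm_eq]
    have h2 : 0 ≤ Bad'.indicator (fun _ => (1 : ℝ)) ω :=
      Set.indicator_nonneg (fun _ _ => zero_le_one) _
    have h3 : ∑ p ∈ (Finset.range N).sigma (relevant f (E ω).L), (levelRegret (E ω).L p.1 *
        if (E ω).Over p.1 p.2 t then 1 else 0) = V ω :=
      Finset.sum_congr rfl fun p _ => by
        simp only [Set.indicator_apply, Set.mem_ofPred_eq]
        rfl
    rw [h3] at h1
    have h4 : (E ω).L = L := rfl
    rw [h4] at h1
    linarith

/-- The expected regret, when balls of level at least `m + 2` are not taken apart by level. -/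
lemma integral_regret_le [IsProbabilityMeasure P] (hK : 1 ≤ K) (hσ : 0 < σ) (hL : 0 < L)
    (hT : 2 ≤ T) (h01 : ∀ a x, f a x ∈ Set.Icc (0 : ℝ) 1)
    (hf : ∀ a x x', |f a x - f a x'| ≤ L * |(x : ℝ) - (x' : ℝ)|) {M : ℝ}
    (hgap : ∀ i : ℕ, 1 ≤ i →
      (volume : Measure unitInterval).real {x | gap f x ≤ 22 * L / 2 ^ i} ≤ 22 * M / 2 ^ i)
    (hlog : 1 ≤ 5431 * σ ^ 2 * Real.log (T * K) / L ^ 2) (hX : ∀ t, Measurable (X t))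
    (hin : IsInput P σ (fun t ω => (X t ω : ℝ)) ε) (m : ℕ) :
    ∫ ω, regret σ L T R f (fun t => X t ω) (fun t => ε t ω) ∂P ≤
      806 + 44501620 * K * (σ ^ 2 * Real.log (T * K) / L ^ 2) *
        (9 + 1344 * (M * L) * (2 ^ m - 1)) + 14 * L * T / 2 ^ m := by
  have hT0 : (0 : ℝ) < T := by exact_mod_cast (by omega : 0 < T)
  have hG : 0 ≤ σ ^ 2 * Real.log (T * K) / L ^ 2 := by
    have : 5431 * σ ^ 2 * Real.log (T * K) / L ^ 2 =
      5431 * (σ ^ 2 * Real.log (T * K) / L ^ 2) := by ring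
    linarith
  set G := σ ^ 2 * Real.log (T * K) / L ^ 2 with hGdef
  have hF := measurable_extend hf
  unfold regret
  rw [integral_finsetSum _ fun t _ =>
    integrable_trialRegret hK h01 hf hX hin.measurable_noise t]
  refine (Finset.sum_le_sum fun t ht => integral_trialRegret_le hK hσ hL hT h01 hf hX hin
    (Finset.mem_range.1 ht) (N := m + 2) (by omega)).trans ?_
  rw [Finset.sum_add_distrib, Finset.sum_add_distrib, Finset.sum_comm]
  simp only [Finset.sum_const, Finset.card_range, nsmul_eq_mul, ← Finset.mul_sum]
  have h1 : (T : ℝ) * (806 / T) = 806 := by field_simp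
  have h2 : (T : ℝ) * (14 * L / 2 ^ (m + 2)) ≤ 14 * L * T / 2 ^ m := by
    have h3 : (2 : ℝ) ^ m ≤ 2 ^ (m + 2) := pow_le_pow_right₀ (by norm_num) (by omega)
    rw [mul_div_assoc', mul_comm (T : ℝ)]
    gcongr
  rw [h1]
  refine add_le_add (add_le_add le_rfl ?_) h2
  calc ∑ p ∈ (Finset.range (m + 2)).sigma (relevant f L), levelRegret L p.1 *
        ∑ t ∈ Finset.range T, P.real
          {ω | (rEnv σ L T R (extend f) (fun t ω => (X t ω : ℝ)) ε ω).Over p.1 p.2 t}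
      ≤ ∑ p ∈ (Finset.range (m + 2)).sigma (relevant f L),
        levelRegret L p.1 * (44501620 * K * G * 4 ^ p.1) := by
        classical
        refine Finset.sum_le_sum fun p hp => ?_
        refine mul_le_mul_of_nonneg_left ?_ (levelRegret_nonneg hL.le _)
        refine hin.sum_measureReal_over_le hF hK hσ hL hT hlog ?_
        exact Finset.mem_range.1 (Finset.mem_filter.1 (Finset.mem_sigma.1 hp).2).1
    _ = 44501620 * K * G * ∑ i ∈ Finset.range (m + 2),
        ((relevant f L i).card : ℝ) * (levelRegret L i * 4 ^ i) := by
        rw [Finset.sum_sigma, Finset.mul_sum]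
        refine Finset.sum_congr rfl fun i _ => ?_
        simp only [Finset.sum_const, nsmul_eq_mul]
        ring
    _ ≤ _ := by
        gcongr
        exact sum_relevant_le hK hL hf hgap m

/-- With s = √(AB) choose 2^m ≤ s/B < 2^(m+1); then B 2^m ≤ s and A/2^m ≤ 2s. If A ≤ B take m = 0:
the first term vanishes and A ≤ s. -/
lemma exists_pow_balance {A B : ℝ} (hA : 0 < A) (hB : 0 < B) :
    ∃ m : ℕ, B * (2 ^ m - 1) + A / 2 ^ m ≤ 3 * Real.sqrt (A * B) := by
  have hs0 : 0 ≤ Real.sqrt (A * B) := Real.sqrt_nonneg _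
  have hs : Real.sqrt (A * B) ^ 2 = A * B := Real.sq_sqrt (by positivity)
  set s := Real.sqrt (A * B) with hsdef
  have hspos : 0 < s := Real.sqrt_pos.2 (by positivity)
  rcases le_total A B with h | h
  · refine ⟨0, ?_⟩
    have : A ≤ s := by
      apply Real.le_sqrt_of_sq_le
      nlinarith
    simp
    linarith
  · have h1 : 1 ≤ s / B := by
      rw [le_div_iff₀ hB, one_mul]
      apply Real.le_sqrt_of_sq_le
      nlinarith
    obtain ⟨m, hm1, hm2⟩ := exists_nat_pow_near h1 (one_lt_two : (1 : ℝ) < 2)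
    refine ⟨m, ?_⟩
    have hp : (0 : ℝ) < 2 ^ m := by positivity
    rw [le_div_iff₀ hB] at hm1
    rw [div_lt_iff₀ hB, pow_succ] at hm2
    have h2 : A / 2 ^ m ≤ 2 * s := by
      rw [div_le_iff₀ hp]
      have : A * B ≤ (2 * s * 2 ^ m) * B := by nlinarith
      exact le_of_mul_le_mul_right this hB
    nlinarith

end Regret

end ApproxZooming

end

/-! ### Assembly of the bound -/

theorem mainTheorem2 :
    ∃ C : ℝ, 0 < C ∧
      ∀ (K T Θ : ℕ) (σ L L' : ℝ)
        (f : Fin K → unitInterval → ℝ)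
        (typ : Fin K → Fin Θ) (g : Fin Θ → unitInterval → ℝ)
        (S : Finset (Set unitInterval))
        (R : ApproxZooming.Rules K)
        (Ω : Type*) [MeasurableSpace Ω] (P : Measure Ω) [IsProbabilityMeasure P]
        (X : ℕ → Ω → unitInterval) (ε : ℕ → Ω → ℝ),
        1 ≤ K → 1 ≤ T → 0 < σ → 0 < L → 0 < L' →
        -- the reward functions take values in `[0,1]` and are `L`-Lipschitz
        (∀ a x, f a x ∈ Set.Icc (0 : ℝ) 1) →
        (∀ a x x', |f a x - f a x'| ≤ L * |(x : ℝ) - (x' : ℝ)|) →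
        -- there are `Θ` types of arms
        Function.Surjective typ → (∀ a, f a = g (typ a)) →
        -- the optimal policy is constant on each of the intervals of the partition `S`
        ApproxZooming.IsPolicyPartition f g S →
        -- the measure of the contexts with small gap decreases linearly
        (∀ i : ℕ, 1 ≤ i →
          (volume : Measure unitInterval).real {x | ApproxZooming.gap f x ≤ 22 * L / 2 ^ i} ≤
            22 * (S.card : ℝ) * L / 2 ^ i / L') →
        -- the number of nearest neighbours used by the algorithm is at least one
        1 ≤ 5431 * σ ^ 2 * Real.log (T * K) / L ^ 2 →
        -- uniform contexts and Gaussian noise, all independent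
        (∀ t, Measurable (X t)) → (∀ t, Measurable (ε t)) →
        (∀ t, P.map (X t) = volume) →
        (∀ t, P.map (ε t) = gaussianReal 0 ⟨σ ^ 2, sq_nonneg σ⟩) →
        (∀ t, IndepFun (X t) (ε t) P) →
        iIndepFun (fun t ω => (X t ω, ε t ω)) P →
        Integrable (fun ω => ApproxZooming.regret σ L T R f (fun t => X t ω) (fun t => ε t ω)) P ∧
        ∫ ω, ApproxZooming.regret σ L T R f (fun t => X t ω) (fun t => ε t ω) ∂P ≤
          C * (σ ^ 2 / L ^ 2 * K * Real.log (T * K)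
            + Real.sqrt (σ ^ 2 * S.card * (L / L') * T * K * Real.log (T * K))) := by
  -- The binding requirement is 3 · 1344 · 44501620 < 2 · 10¹¹, with 3 from `exists_pow_balance`,
  -- 1344 from `sum_relevant_le` and 44501620 from the number of plays.
  refine ⟨200000000000, by norm_num, ?_⟩
  intro K T Θ σ L L' f typ g S R Ω _ P _ X ε hK hT hσ hL hL' h01 hf _ _ hS hgap hlog hX hε hlX hlε
    hXε hind
  have hint := ApproxZooming.integrable_regret (P := P) (σ := σ) (T := T) (R := R) hK h01 hf
    hX hε
  refine ⟨hint, ?_⟩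
  have hK' : (1 : ℝ) ≤ K := by exact_mod_cast hK
  set G := σ ^ 2 * Real.log (T * K) / L ^ 2 with hG
  have hG1 : 1 ≤ 5431 * G := by
    rw [hG]
    refine hlog.trans (le_of_eq ?_)
    ring
  have hGpos : 0 < G := by linarith
  have hKG : 1 ≤ 5431 * (K * G) := by nlinarith
  have e1 : σ ^ 2 / L ^ 2 * K * Real.log (T * K) = K * G := by rw [hG]; ring
  rw [e1]
  have hs0 := Real.sqrt_nonneg (σ ^ 2 * S.card * (L / L') * T * K * Real.log (T * K))
  -- For T = 1 the noise bounds degenerate because ln T = 0, but the regret is at most 1 ≤ 5431 K G.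
  -- The same inequality absorbs the 806 of the bad event when T ≥ 2.
  rcases (show T = 1 ∨ 2 ≤ T by omega) with hT1 | hT2
  · have h1 : ∫ ω, ApproxZooming.regret σ L T R f (fun t => X t ω) (fun t => ε t ω) ∂P ≤
        ∫ _, (1 : ℝ) ∂P := by
      refine integral_mono hint (integrable_const _) fun ω => ?_
      have := (ApproxZooming.regret_mem (σ := σ) (L := L) (T := T) (R := R) hK h01
        (fun t => X t ω) fun t => ε t ω).2
      rw [hT1] at this ⊢
      simpa using this
    simp only [integral_const, probReal_univ, smul_eq_mul, mul_one] at h1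
    linarith
  · have hT0 : (0 : ℝ) < T := by exact_mod_cast (by omega : 0 < T)
    have hScard : (0 : ℝ) < S.card := by
      obtain ⟨s, hs, -⟩ := (hS.isPartition.2 0).exists
      exact_mod_cast Finset.card_pos.2 ⟨s, hs⟩
    set M := (S.card : ℝ) * L / L' with hM
    have hMpos : 0 < M := by positivity
    have hin := ApproxZooming.isInput_of_unitInterval hX hε hlX hlε hXε hind
    have hgap' : ∀ i : ℕ, 1 ≤ i → (volume : Measure unitInterval).real
        {x | ApproxZooming.gap f x ≤ 22 * L / 2 ^ i} ≤ 22 * M / 2 ^ i := by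
      intro i hi
      refine (hgap i hi).trans (le_of_eq ?_)
      rw [hM]
      ring
    -- `A` comes from the deep levels and `B` multiplies `2 ^ m - 1` in the sum over shallow levels,
    -- up to numerical constants; their product is exactly the radicand of the claim.
    obtain ⟨m, hm⟩ := ApproxZooming.exists_pow_balance (A := L * T) (B := L * M * (K * G))
      (by positivity) (by positivity)
    have h1 := ApproxZooming.integral_regret_le (R := R) hK hσ hL hT2 h01 hf hgap' hlog
      hX hin m
    rw [← hG] at h1
    have e2 : L * T * (L * M * (K * G)) =
        σ ^ 2 * S.card * (L / L') * T * K * Real.log (T * K) := by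
      rw [hG, hM]
      field_simp
    rw [e2] at hm
    set s := Real.sqrt (σ ^ 2 * S.card * (L / L') * T * K * Real.log (T * K)) with hs
    have e3 : 44501620 * K * G * (9 + 1344 * (M * L) * (2 ^ m - 1)) =
        400514580 * (K * G) + 59810177280 * (L * M * (K * G) * (2 ^ m - 1)) := by ring
    have e4 : 14 * L * T / 2 ^ m = 14 * (L * T / 2 ^ m) := by ring
    rw [e3, e4] at h1
    have h2 : 0 ≤ L * T / 2 ^ m := by positivity
    linarith
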